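/- Let $\Lambda_s\colon[0,\infty)\to[0,\infty)$ be continuous and bounded away from zero, i.e. $\Lambda_s\ge c$ for some $c>0$. Put $$\Lambda_r(\beta)=\frac{\sqrt{2\pi}}{6}\,\frac{\frac12+\beta\vee(1-\beta)}{\sqrt{\beta\vee(1-\beta)}},\qquad \frac{P(\beta,d\alpha)}{d\alpha}=\frac32\,\frac{1\wedge\sqrt{\frac{\alpha\wedge(1-\alpha)}{\beta\wedge(1-\beta)}}}{\frac12+\beta\vee(1-\beta)},\qquad \alpha,\beta\in[0,1],$$ where $\vee,\wedge$ denote maximum and minimum and, for $\beta\in\{0,1\}$, the square root is read as $+\infty$ (so $P(0,\cdot)=P(1,\cdot)$ is the uniform law on $[0,1]$). For $N\ge2$ consider the Markov jump process on $\mathbb R_+^N=[0,\infty)^N$ with generator $$\mathcal L A(x)=\sum_{i=1}^{N-1}\Lambda_s(x_i+x_{i+1})\,\Lambda_r\Big(\frac{x_i}{x_i+x_{i+1}}\Big)\int_{[0,1]}P\Big(\frac{x_i}{x_i+x_{i+1}},d\alpha\Big)\,[A(T_{i,\alpha}x)-A(x)],$$ where $T_{i,\alpha}x=x+[\alpha x_{i+1}-(1-\alpha)x_i](e_i-e_{i+1})$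 (a term with $x_i=x_{i+1}=0$ is zero). For $\epsilon>0$ let $\mathcal S_{\epsilon,N}=\{x\in\mathbb R_+^N:\frac1N\sum_i x_i=\epsilon\}$. A probability measure $\mu$ on $\mathbb R_+^N$ is called reversible if $\int\mu(dx)[\mathcal L f(\cdot,x)](x)=\int\mu(dx)[\mathcal L f(x,\cdot)](x)$ for all bounded measurable $f\colon\mathbb R_+^N\times\mathbb R_+^N\to\mathbb R$ for which both integrands are $\mu$-integrable. A probability measure $\pi$ on $\mathcal S_{\epsilon,N}$ is called stationary if $\int\mathcal L A\,d\pi=0$ for all bounded measurable $A$. Then there is a constant $C>0$, depending only on $\Lambda_s$, such that the following hold for all $N\ge2$. 1. Let $\nu_1,\dots,\nu_N$ be probability measures on $[0,\infty)$, not all equal to the point mass $\delta_0$. The product measure $\nu_1(dx_1)\cdots\nu_N(dx_N)$ is reversible if and only if there is $\epsilon>0$ such that every $\nu_i$ is the Gamma law with shape $3/2$ and scale $\epsilon$, $$\nu_i(dx)=\nu^{(\epsilon)}(dx)=\frac{dx}{\epsilon}\sqrt{\frac x\epsilon}\;\frac{2e^{-x/\epsilon}}{\sqrt\pi},\qquad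 x>0.$$ So, up to the choice of the scale $\epsilon$, $\mu^{(\epsilon)}(dx)=\nu^{(\epsilon)}(dx_1)\cdots\nu^{(\epsilon)}(dx_N)$ is the unique reversible product measure. 2. For every $\epsilon>0$ there is exactly one stationary probability measure $\pi_{\epsilon,N}$ on $\mathcal S_{\epsilon,N}$. It is obtained by conditioning: for every $\theta>0$, $(\pi_{e,N})_{e>0}$ is the weakly continuous version of the regular conditional distribution of $x$ under $\mu^{(\theta)}$ given $\frac1N\sum_i x_i=e$. 3. For every $\epsilon>0$, $\mathcal L$ acts as a bounded operator on the complex Hilbert space $L^2(\pi_{\epsilon,N})$, and its spectrum satisfies $$\operatorname{spec}(\mathcal L)\subset\Big(-\infty,\,-C\sin^2\Big[\frac{\pi}{N+2}\Big]\Big]\cup\{0\}.$$ -/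

import Mathlib

open MeasureTheory ProbabilityTheory Set
open scoped ENNReal BoundedContinuousFunction

noncomputable section

namespace BilliardLattice

/-- Energy configurations of a chain of `N = n + 1` sites. The bonds are indexed by `i : Fin n`;
bond `i` joins the neighbouring sites `i.castSucc` and `i.succ`. All measures considered below
are concentrated on configurations with non-negative energies. -/
abbrev Config (n : ℕ) : Type := Fin (n + 1) → ℝ

/-- The mean energy per site. -/
def meanEnergy {n : ℕ} (x : Config n) : ℝ := ∑ i, (1 / ((n : ℝ) + 1)) * x i

/-- The simplex of non-negative configurations with mean energy `ε` per site. -/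
def simplex (n : ℕ) (ε : ℝ) : Set (Config n) := {x | (∀ i, 0 ≤ x i) ∧ meanEnergy x = ε}

/-- The energy exchange across bond `i`: the sites `i.castSucc`, `i.succ` receive the fractions
`α` and `1 - α` of their total energy. -/
def exchange {n : ℕ} (i : Fin n) (α : ℝ) (x : Config n) : Config n :=
  x + (α * x i.succ - (1 - α) * x i.castSucc) •
    ((Pi.single i.castSucc 1 : Config n) - Pi.single i.succ 1)

/-- The density of the transition kernel of the three-dimensional billiard lattice,
`(3/2) * (1 ∧ √((α ∧ (1-α)) / (β ∧ (1-β)))) / (1/2 + β ∨ (1-β))`. For `β ∧ (1-β) = 0` the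
square root is read as `+∞`, so that the minimum is `1`. -/
def kernelDensity (β α : ℝ) : ℝ :=
  3 / 2 * (if min β (1 - β) = 0 then 1 else min 1 √(min α (1 - α) / min β (1 - β))) /
    (1 / 2 + max β (1 - β))

/-- The transition kernel `P(β, dα)` on `[0, 1]`. -/
def exchangeLaw (β : ℝ) : Measure ℝ :=
  (volume.restrict (Icc 0 1)).withDensity fun α => ENNReal.ofReal (kernelDensity β α)

/-- The rate function `Λ_r` of the energy ratio. -/
def rateRatio (β : ℝ) : ℝ :=
  √(2 * Real.pi) / 6 * ((1 / 2 + max β (1 - β)) / √(max β (1 - β)))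

/-- The fraction of the energy of bond `i` that sits at its left site. (If both energies vanish
its value is irrelevant, since `exchange i α x = x` then.) -/
def ratio {n : ℕ} (i : Fin n) (x : Config n) : ℝ :=
  x i.castSucc / (x i.castSucc + x i.succ)

/-- The generator
`𝓛 A(x) = ∑ᵢ Λ_s(xᵢ + xᵢ₊₁) Λ_r(xᵢ / (xᵢ + xᵢ₊₁)) ∫ P(xᵢ / (xᵢ + xᵢ₊₁), dα) [A(T_{i,α} x) - A(x)]`,
for real or complex observables `A`. -/
def generator {E : Type*} [NormedAddCommGroup E] [NormedSpace ℝ E] (Λs : ℝ → ℝ) {n : ℕ}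
    (A : Config n → E) (x : Config n) : E :=
  ∑ i : Fin n, (Λs (x i.castSucc + x i.succ) * rateRatio (ratio i x)) •
    ∫ α, (A (exchange i α x) - A x) ∂(exchangeLaw (ratio i x))

/-- Reversibility of `μ`: `∫ μ(dx) [𝓛 f(·, x)](x) = ∫ μ(dx) [𝓛 f(x, ·)](x)` for all bounded
measurable `f` for which the two integrals exist. (They always do when the rates are bounded on
the support of `μ`; when `Λ_s` is unbounded they do at least for all `f` that vanish at large
energies.) -/
def IsReversible (Λs : ℝ → ℝ) {n : ℕ} (μ : Measure (Config n)) : Prop :=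
  ∀ f : Config n → Config n → ℝ, Measurable (Function.uncurry f) → (∃ M, ∀ x y, |f x y| ≤ M) →
    Integrable (fun x => generator Λs (fun y => f y x) x) μ →
    Integrable (fun x => generator Λs (fun y => f x y) x) μ →
    ∫ x, generator Λs (fun y => f y x) x ∂μ = ∫ x, generator Λs (fun y => f x y) x ∂μ

/-- `π` is a stationary distribution of the process on the simplex of mean energy `ε`. -/
structure IsStationaryOn (Λs : ℝ → ℝ) {n : ℕ} (ε : ℝ) (π : Measure (Config n)) : Prop where
  isProbabilityMeasure : IsProbabilityMeasure π
  concentrated : π (simplex n ε)ᶜ = 0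
  integral_generator : ∀ A : Config n → ℝ, Measurable A → (∃ M, ∀ x, |A x| ≤ M) →
    ∫ x, generator Λs A x ∂π = 0

/-- The Gamma law with shape `3/2` and scale `ε`, of density
`(1/ε) * √(x/ε) * 2 * exp (-x/ε) / √π` on `(0, ∞)`. -/
def siteLaw (ε : ℝ) : Measure ℝ := gammaMeasure (3 / 2) (1 / ε)

/-- The measures `κ ε`, `ε > 0`, are obtained by conditioning `μ` on the mean energy: `κ` is the
regular conditional distribution of `x` given the mean energy, in the version which for every
`ε > 0` is concentrated on the simplex of mean energy `ε` and is weakly continuous in `ε`. -/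
structure IsConditioning {n : ℕ} (μ : Measure (Config n)) (κ : Kernel ℝ (Config n)) : Prop where
  isMarkovKernel : IsMarkovKernel κ
  hasCondDistrib : HasCondDistrib id meanEnergy κ μ
  concentrated : ∀ ε : ℝ, 0 < ε → κ ε (simplex n ε)ᶜ = 0
  weaklyContinuous : ∀ g : Config n →ᵇ ℝ, ContinuousOn (fun ε => ∫ x, g x ∂(κ ε)) (Ioi 0)

/-- The bounded operator `T` on the complex space `L²(π)` is the action of the generator. -/
def IsGeneratorOnL2 (Λs : ℝ → ℝ) {n : ℕ} (π : Measure (Config n))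
    (T : Lp ℂ 2 π →L[ℂ] Lp ℂ 2 π) : Prop :=
  ∀ (A : Config n → ℂ) (hA : MemLp A 2 π), T (hA.toLp A) =ᵐ[π] generator Λs A

end BilliardLattice

end

/-! Everything rests on one computation. With w(α) = √(α(1-α)), the product of w(β) and the jump
density from β to α is a constant times √(β∧(1-β)) ∧ √(α∧(1-α)), hence symmetric in α and β
(`detailed_balance`). Two independent Gamma energies of shape 3/2 and common scale have a ratio that
is independent of their sum and has density proportional to w. So the jump measure of each bond is
symmetric under the Gamma product law (`isSymmetricOn_pi_siteLaw`), and a factor such as Λ_s of the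
conserved bond energy does no harm.

Conditioning: an exponential tilt only changes the scale of a Gamma law, and the direction, i.e. the
configuration divided by its mean energy, does not see the scale. Hence direction and mean energy
are independent (`map_meanEnergy_direction`), and the conditional law at mean energy ε is the law of
ε times the direction (`condLaw`). Rescaling commutes with exchanges, so the symmetry passes to the
simplices.

Spectral gap: the jump density is bounded below by √(2π)/4 · w(α), uniformly in β. Hence the
Dirichlet form of the generator dominates a multiple of that of the heat bath, which resamples the
ratio of a bond from the normalized w. In terms of partial sums of the energies, a heat bath step
replaces one partial sum by a random convex combination of its neighbours, on average their
midpoint. Running two copies with the same bond and the same α therefore contracts the ℓ¹ distance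
of partial sums weighted by the first Dirichlet eigenvector sin(πm/(n+1)). Self-adjointness turns
this Lipschitz contraction into an L² contraction (`norm_le_of_norm_pow_le`, `heat_gap`).

Uniqueness of the stationary law: a competitor μ need not have a density, so L² alone does not
suffice. A Hahn set of μ minus the conditional law is shrunk to a set left by almost no exchange. If
it is null for the conditional law it is empty, because exchanges spread a point over a set of
positive measure (`eq_empty_of_invariant_null`); otherwise it has full measure by the gap. Either
way one probability measure lies below the other, so they agree.

Reversible product laws: a test function that divides out the jump rate of one bond shows that a
reversible law is invariant under the heat bath of that bond. By the symmetry of w neighbouring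
marginals coincide, and testing with xy·exp(-p(x+y)) gives a differential equation for the Laplace
transform of the common marginal, with solutions (1+bp)^(-3/2) (`exists_laplaceMoment_eq`). -/

noncomputable section

namespace BilliardLattice

/-! ### The exchange map -/

/-- The energy of bond `i`. -/
def bondEnergy {n : ℕ} (i : Fin n) (x : Config n) : ℝ := x i.castSucc + x i.succ

lemma castSucc_ne_succ {n : ℕ} (i : Fin n) : i.castSucc ≠ i.succ := i.castSucc_lt_succ.ne

lemma exchange_castSucc {n : ℕ} (i : Fin n) (α : ℝ) (x : Config n) :
    exchange i α x i.castSucc = α * bondEnergy i x := by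
  simp [exchange, bondEnergy, castSucc_ne_succ]; ring

lemma exchange_succ {n : ℕ} (i : Fin n) (α : ℝ) (x : Config n) :
    exchange i α x i.succ = (1 - α) * bondEnergy i x := by
  simp [exchange, bondEnergy, (castSucc_ne_succ i).symm]; ring

lemma exchange_of_ne {n : ℕ} {i : Fin n} {j : Fin (n + 1)} (α : ℝ) (x : Config n)
    (h₁ : j ≠ i.castSucc) (h₂ : j ≠ i.succ) : exchange i α x j = x j := by
  simp [exchange, h₁, h₂]

lemma exchange_update {n : ℕ} (i : Fin n) (α : ℝ) (x : Config n) :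
    exchange i α x = Function.update (Function.update x i.castSucc (α * bondEnergy i x)) i.succ
      ((1 - α) * bondEnergy i x) := by
  ext j
  by_cases h₂ : j = i.succ
  · subst h₂; simp [exchange_succ]
  · by_cases h₁ : j = i.castSucc
    · subst h₁; simp [exchange_castSucc, castSucc_ne_succ]
    · simp [exchange_of_ne, h₁, h₂]

lemma bondEnergy_exchange {n : ℕ} (i : Fin n) (α : ℝ) (x : Config n) :
    bondEnergy i (exchange i α x) = bondEnergy i x := by
  rw [bondEnergy, exchange_castSucc, exchange_succ]; ring

lemma ratio_eq {n : ℕ} (i : Fin n) (x : Config n) :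
    ratio i x = x i.castSucc / bondEnergy i x := rfl

lemma ratio_exchange {n : ℕ} (i : Fin n) (α : ℝ) {x : Config n} (h : bondEnergy i x ≠ 0) :
    ratio i (exchange i α x) = α := by
  rw [ratio_eq, bondEnergy_exchange, exchange_castSucc, mul_div_cancel_right₀ _ h]

lemma exchange_eq_self {n : ℕ} {i : Fin n} (α : ℝ) {x : Config n} (hx : ∀ j, 0 ≤ x j)
    (h : bondEnergy i x = 0) : exchange i α x = x := by
  have h₁ : x i.castSucc = 0 := by
    have := hx i.castSucc; have := hx i.succ; unfold bondEnergy at h; linarith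
  have h₂ : x i.succ = 0 := by unfold bondEnergy at h; linarith
  ext j
  by_cases h₂' : j = i.succ
  · subst h₂'; rw [exchange_succ, h, h₂, mul_zero]
  · by_cases h₁' : j = i.castSucc
    · subst h₁'; rw [exchange_castSucc, h, h₁, mul_zero]
    · simp [exchange_of_ne, h₁', h₂']

lemma exchange_smul {n : ℕ} (i : Fin n) (α c : ℝ) (x : Config n) :
    exchange i α (c • x) = c • exchange i α x := by
  ext j
  simp only [exchange, Pi.add_apply, Pi.smul_apply, Pi.sub_apply, smul_eq_mul]; ring

lemma bondEnergy_smul {n : ℕ} (i : Fin n) (c : ℝ) (x : Config n) :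
    bondEnergy i (c • x) = c * bondEnergy i x := by
  simp [bondEnergy, mul_add]

lemma ratio_smul {n : ℕ} (i : Fin n) {c : ℝ} (hc : c ≠ 0) (x : Config n) :
    ratio i (c • x) = ratio i x := by
  rw [ratio_eq, bondEnergy_smul, Pi.smul_apply, smul_eq_mul, mul_div_mul_left _ _ hc, ratio_eq]

lemma bondEnergy_nonneg {n : ℕ} (i : Fin n) {x : Config n} (hx : ∀ j, 0 ≤ x j) :
    0 ≤ bondEnergy i x := add_nonneg (hx _) (hx _)

lemma ratio_mem {n : ℕ} (i : Fin n) {x : Config n} (hx : ∀ j, 0 ≤ x j) :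
    ratio i x ∈ Icc (0 : ℝ) 1 :=
  ⟨div_nonneg (hx _) (bondEnergy_nonneg i hx),
    div_le_one_of_le₀ (le_add_of_nonneg_right (hx _)) (bondEnergy_nonneg i hx)⟩

lemma exchange_nonneg {n : ℕ} (i : Fin n) {α : ℝ} (hα : α ∈ Icc (0 : ℝ) 1) {x : Config n}
    (hx : ∀ j, 0 ≤ x j) (j : Fin (n + 1)) : 0 ≤ exchange i α x j := by
  by_cases h₂ : j = i.succ
  · subst h₂
    rw [exchange_succ]; exact mul_nonneg (by linarith [hα.2]) (bondEnergy_nonneg i hx)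
  · by_cases h₁ : j = i.castSucc
    · subst h₁; rw [exchange_castSucc]; exact mul_nonneg hα.1 (bondEnergy_nonneg i hx)
    · rw [exchange_of_ne _ _ h₁ h₂]; exact hx j

lemma sum_exchange {n : ℕ} (i : Fin n) (α : ℝ) (x : Config n) :
    ∑ j, exchange i α x j = ∑ j, x j := by
  simp only [exchange, Pi.add_apply, Pi.smul_apply, Pi.sub_apply, smul_eq_mul,
    Finset.sum_add_distrib, ← Finset.mul_sum, Finset.sum_sub_distrib]
  simp

lemma meanEnergy_eq {n : ℕ} (x : Config n) :
    meanEnergy x = 1 / ((n : ℝ) + 1) * ∑ j, x j := by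
  rw [meanEnergy, Finset.mul_sum]

lemma meanEnergy_exchange {n : ℕ} (i : Fin n) (α : ℝ) (x : Config n) :
    meanEnergy (exchange i α x) = meanEnergy x := by
  rw [meanEnergy_eq, meanEnergy_eq, sum_exchange]

lemma meanEnergy_smul {n : ℕ} (c : ℝ) (x : Config n) :
    meanEnergy (c • x) = c * meanEnergy x := by
  simp only [meanEnergy_eq, Pi.smul_apply, smul_eq_mul, ← Finset.mul_sum]; ring

lemma exchange_mem_simplex {n : ℕ} (i : Fin n) {α ε : ℝ} (hα : α ∈ Icc (0 : ℝ) 1)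
    {x : Config n} (hx : x ∈ simplex n ε) : exchange i α x ∈ simplex n ε :=
  ⟨exchange_nonneg i hα hx.1, by rw [meanEnergy_exchange, hx.2]⟩

@[fun_prop]
lemma continuous_bondEnergy {n : ℕ} (i : Fin n) : Continuous (bondEnergy i) := by
  unfold bondEnergy; fun_prop

@[fun_prop]
lemma measurable_bondEnergy {n : ℕ} (i : Fin n) : Measurable (bondEnergy i) :=
  (continuous_bondEnergy i).measurable

@[fun_prop]
lemma measurable_ratio {n : ℕ} (i : Fin n) : Measurable (ratio i : Config n → ℝ) := by
  unfold ratio; fun_prop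

@[fun_prop]
lemma continuous_meanEnergy {n : ℕ} : Continuous (meanEnergy : Config n → ℝ) := by
  unfold meanEnergy; fun_prop

@[fun_prop]
lemma measurable_meanEnergy {n : ℕ} : Measurable (meanEnergy : Config n → ℝ) :=
  continuous_meanEnergy.measurable

lemma continuous_exchange {n : ℕ} (i : Fin n) :
    Continuous (fun p : Config n × ℝ => exchange i p.2 p.1) := by
  unfold exchange; fun_prop

@[fun_prop]
lemma measurable_exchange {n : ℕ} (i : Fin n) :
    Measurable (fun p : Config n × ℝ => exchange i p.2 p.1) :=
  (continuous_exchange i).measurable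

@[fun_prop]
lemma measurable_exchange_left {n : ℕ} (i : Fin n) (x : Config n) :
    Measurable (fun α : ℝ => exchange i α x) :=
  (measurable_exchange i).comp (measurable_const.prodMk measurable_id)

lemma measurableSet_nonneg (n : ℕ) : MeasurableSet {x : Config n | ∀ j, 0 ≤ x j} := by
  have : {x : Config n | ∀ j, 0 ≤ x j} = ⋂ j, {x | 0 ≤ x j} := by ext; simp
  rw [this]
  exact MeasurableSet.iInter fun j => measurableSet_le measurable_const (measurable_pi_apply j)

lemma measurableSet_simplex (n : ℕ) (ε : ℝ) : MeasurableSet (simplex n ε) :=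
  (measurableSet_nonneg n).inter (measurable_meanEnergy (measurableSet_singleton ε))

/-! ### The jump rates -/

/-- The uniform law on `[0, 1]`. -/
abbrev unitVol : Measure ℝ := volume.restrict (Icc 0 1)

instance : IsProbabilityMeasure unitVol := ⟨by simp [unitVol]⟩

lemma ae_unitVol : ∀ᵐ α ∂unitVol, α ∈ Ioo (0 : ℝ) 1 := by
  rw [unitVol, restrict_Ioo_eq_restrict_Icc.symm]
  exact ae_restrict_mem measurableSet_Ioo

/-- The density of the exchange rate across a bond, apart from the factor depending on the bond
energy. -/
def jumpRate (β α : ℝ) : ℝ := rateRatio β * kernelDensity β α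

/-- The unnormalized density `√(α (1 - α))` of the equilibrium law of the energy ratio. -/
def ratioWeight (α : ℝ) : ℝ := √(α * (1 - α))

lemma half_le_max (β : ℝ) : 1 / 2 ≤ max β (1 - β) := by
  rcases le_total β (1 - β) with h | h
  · rw [max_eq_right h]; linarith
  · rw [max_eq_left h]; linarith

lemma kernelDensity_nonneg (β α : ℝ) : 0 ≤ kernelDensity β α := by
  have := half_le_max β
  unfold kernelDensity
  split_ifs <;> positivity

lemma rateRatio_nonneg (β : ℝ) : 0 ≤ rateRatio β := by
  have := half_le_max β
  unfold rateRatio; positivity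

lemma jumpRate_eq (β α : ℝ) : jumpRate β α = √(2 * Real.pi) / 4 *
    ((if min β (1 - β) = 0 then 1 else min 1 √(min α (1 - α) / min β (1 - β))) /
      √(max β (1 - β))) := by
  have h := half_le_max β
  have h' : 0 < √(max β (1 - β)) := Real.sqrt_pos.2 (by linarith)
  have h'' : (1 / 2 + max β (1 - β)) ≠ 0 := by linarith
  rw [jumpRate, rateRatio, kernelDensity]
  generalize (if min β (1 - β) = 0 then (1 : ℝ) else _) = I
  generalize max β (1 - β) = M at *
  field_simp
  ring

lemma jumpRate_nonneg (β α : ℝ) : 0 ≤ jumpRate β α :=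
  mul_nonneg (rateRatio_nonneg β) (kernelDensity_nonneg β α)

lemma jumpRate_le (β α : ℝ) : jumpRate β α ≤ √(2 * Real.pi) / 2 := by
  have h := half_le_max β
  have h' : 1 / 2 ≤ √(max β (1 - β)) := by
    rw [Real.le_sqrt' (by norm_num)]; linarith
  rw [jumpRate_eq]
  have hI : (if min β (1 - β) = 0 then (1 : ℝ) else min 1 √(min α (1 - α) / min β (1 - β))) ≤ 1 := by
    split_ifs
    · exact le_rfl
    · exact min_le_left _ _
  have : (if min β (1 - β) = 0 then (1 : ℝ) else min 1 √(min α (1 - α) / min β (1 - β))) /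
      √(max β (1 - β)) ≤ 2 := by
    rw [div_le_iff₀ (by linarith)]; linarith
  nlinarith [Real.sqrt_nonneg (2 * Real.pi)]

lemma mul_one_sub_eq_min_mul_max (a : ℝ) : a * (1 - a) = min a (1 - a) * max a (1 - a) :=
  (min_mul_max _ _).symm

lemma ratioWeight_nonneg (α : ℝ) : 0 ≤ ratioWeight α := Real.sqrt_nonneg _

lemma ratioWeight_pos {α : ℝ} (hα : α ∈ Ioo (0 : ℝ) 1) : 0 < ratioWeight α :=
  Real.sqrt_pos.2 (mul_pos hα.1 (by linarith [hα.2]))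

lemma ratioWeight_le_one (α : ℝ) : ratioWeight α ≤ 1 := by
  exact Real.sqrt_le_one.2 (by nlinarith [sq_nonneg (α - 1 / 2)])

/-- The minorization behind both the spectral gap and the boundedness of `heatTest`; the bound does
not depend on β. The factor 1/√(β∨(1-β)) is at least 1, and since β∧(1-β) ≤ 1 the quotient under the
root is at least α∧(1-α) ≥ α(1-α). -/
lemma ratioWeight_le_jumpRate {β α : ℝ} (hβ : β ∈ Icc (0 : ℝ) 1) (hα : α ∈ Icc (0 : ℝ) 1) :
    √(2 * Real.pi) / 4 * ratioWeight α ≤ jumpRate β α := by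
  rw [jumpRate_eq]
  gcongr
  have h := half_le_max β
  have hM : max β (1 - β) ≤ 1 := max_le hβ.2 (by linarith [hβ.1])
  have hm : 0 ≤ min β (1 - β) := le_min hβ.1 (by linarith [hβ.2])
  have hsM : √(max β (1 - β)) ≤ 1 := Real.sqrt_le_one.2 hM
  rw [le_div_iff₀ (Real.sqrt_pos.2 (by linarith))]
  refine (mul_le_of_le_one_right (ratioWeight_nonneg α) hsM).trans ?_
  split_ifs with h0
  · exact ratioWeight_le_one α
  · refine le_min (ratioWeight_le_one α) (Real.sqrt_le_sqrt ?_)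
    have hm' : 0 < min β (1 - β) := lt_of_le_of_ne hm (Ne.symm h0)
    have hmα : 0 ≤ min α (1 - α) := le_min hα.1 (by linarith [hα.2])
    rw [le_div_iff₀ hm', mul_one_sub_eq_min_mul_max, mul_assoc]
    refine mul_le_of_le_one_right hmα (mul_le_one₀ (max_le hα.2 (by linarith [hα.1])) hm ?_)
    exact (min_le_left _ _).trans hβ.2

lemma jumpRate_pos {β α : ℝ} (hβ : β ∈ Icc (0 : ℝ) 1) (hα : α ∈ Ioo (0 : ℝ) 1) :
    0 < jumpRate β α :=
  lt_of_lt_of_le (mul_pos (by positivity) (ratioWeight_pos hα))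
    (ratioWeight_le_jumpRate hβ (Ioo_subset_Icc_self hα))

/-- Write √(β(1-β)) as √(β∧(1-β)) · √(β∨(1-β)). The second factor cancels the denominator of the
jump density, the first clears the denominator inside the minimum, and what remains is symmetric in
the two ratios. -/
lemma ratioWeight_mul_jumpRate {β : ℝ} (α : ℝ) (hβ : β ∈ Ioo (0 : ℝ) 1) :
    ratioWeight β * jumpRate β α =
      √(2 * Real.pi) / 4 * min √(min β (1 - β)) √(min α (1 - α)) := by
  have hmβ : 0 < min β (1 - β) := lt_min hβ.1 (by linarith [hβ.2])
  have hM := half_le_max β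
  have hs : 0 < √(min β (1 - β)) := Real.sqrt_pos.2 hmβ
  have hs' : 0 < √(max β (1 - β)) := Real.sqrt_pos.2 (by linarith)
  rw [jumpRate_eq, if_neg hmβ.ne', ratioWeight, mul_one_sub_eq_min_mul_max,
    Real.sqrt_mul hmβ.le, Real.sqrt_div' _ hmβ.le]
  have : √(min β (1 - β)) * min 1 (√(min α (1 - α)) / √(min β (1 - β))) =
      min √(min β (1 - β)) √(min α (1 - α)) := by
    rw [mul_min_of_nonneg _ _ hs.le, mul_one, mul_div_cancel₀ _ hs.ne']
  rw [← this]
  field_simp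

lemma detailed_balance {β α : ℝ} (hβ : β ∈ Ioo (0 : ℝ) 1) (hα : α ∈ Ioo (0 : ℝ) 1) :
    ratioWeight β * jumpRate β α = ratioWeight α * jumpRate α β := by
  rw [ratioWeight_mul_jumpRate _ hβ, ratioWeight_mul_jumpRate _ hα, min_comm √_]

lemma measurable_kernelDensity : Measurable (fun p : ℝ × ℝ => kernelDensity p.1 p.2) := by
  unfold kernelDensity
  refine Measurable.div (Measurable.const_mul (Measurable.ite ?_ ?_ ?_) _) ?_
  · exact measurableSet_eq_fun (by fun_prop) (by fun_prop)
  all_goals fun_prop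

@[fun_prop]
lemma measurable_rateRatio : Measurable rateRatio := by
  unfold rateRatio; fun_prop

lemma measurable_jumpRate : Measurable (fun p : ℝ × ℝ => jumpRate p.1 p.2) :=
  (measurable_rateRatio.comp measurable_fst).mul measurable_kernelDensity

@[fun_prop]
lemma continuous_ratioWeight : Continuous ratioWeight := by
  unfold ratioWeight; fun_prop

@[fun_prop]
lemma measurable_ratioWeight : Measurable ratioWeight := continuous_ratioWeight.measurable

/-- The normalization of `ratioWeight`. -/
def weightMass : ℝ := ∫ α, ratioWeight α ∂unitVol

lemma integrable_ratioWeight : Integrable ratioWeight unitVol :=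
  Integrable.of_bound continuous_ratioWeight.aestronglyMeasurable 1
    (Filter.Eventually.of_forall fun α => by
      rw [Real.norm_of_nonneg (ratioWeight_nonneg α)]; exact ratioWeight_le_one α)

lemma weightMass_pos : 0 < weightMass := by
  rw [weightMass, integral_pos_iff_support_of_nonneg ratioWeight_nonneg integrable_ratioWeight]
  refine lt_of_lt_of_le ?_ (measure_mono (s := Ioo 0 1) fun α hα => (ratioWeight_pos hα).ne')
  rw [Measure.restrict_apply measurableSet_Ioo, inter_eq_left.2 Ioo_subset_Icc_self]
  simp

lemma exchangeLaw_integral {E : Type*} [NormedAddCommGroup E] [NormedSpace ℝ E] (β : ℝ)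
    (g : ℝ → E) : ∫ α, g α ∂(exchangeLaw β) = ∫ α, kernelDensity β α • g α ∂unitVol := by
  have hm : Measurable (fun α => ENNReal.ofReal (kernelDensity β α)) :=
    (measurable_kernelDensity.comp (measurable_const.prodMk measurable_id)).ennreal_ofReal
  rw [exchangeLaw, integral_withDensity_eq_integral_toReal_smul hm
    (Filter.Eventually.of_forall fun _ => ENNReal.ofReal_lt_top)]
  simp_rw [ENNReal.toReal_ofReal (kernelDensity_nonneg β _)]

lemma generator_eq {E : Type*} [NormedAddCommGroup E] [NormedSpace ℝ E] (Λs : ℝ → ℝ) {n : ℕ}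
    (A : Config n → E) (x : Config n) :
    generator Λs A x = ∑ i : Fin n, ∫ α, (Λs (bondEnergy i x) * jumpRate (ratio i x) α) •
      (A (exchange i α x) - A x) ∂unitVol := by
  unfold generator
  refine Finset.sum_congr rfl fun i _ => ?_
  rw [exchangeLaw_integral, ← integral_smul]
  simp only [smul_smul, jumpRate, bondEnergy, mul_assoc]


/-! ### Polar decomposition of a bond and symmetry of the exchange kernels -/

lemma lintegral_comp_mul_left {s : ℝ} (hs : 0 < s) {h : ℝ → ℝ≥0∞} (hh : Measurable h) :
    ∫⁻ x, h x = ∫⁻ β, h (β * s) * ENNReal.ofReal s := by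
  have h1 := Real.map_volume_mul_right hs.ne'
  have h2 : ∫⁻ β, h (β * s) = ENNReal.ofReal |s⁻¹| * ∫⁻ x, h x := by
    rw [← lintegral_map (μ := volume) (g := fun β => β * s) hh (by fun_prop), h1,
      lintegral_smul_measure, smul_eq_mul]
  rw [lintegral_mul_const _ (by fun_prop), h2, mul_comm, ← mul_assoc,
    ← ENNReal.ofReal_mul hs.le, abs_of_pos (inv_pos.2 hs), mul_inv_cancel₀ hs.ne',
    ENNReal.ofReal_one, one_mul]

/-- The substitution x = βs, y = (1-β)s with Jacobian s, obtained from a shift of y, Tonelli and a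
scaling of x. -/
lemma lintegral_polar {Φ : ℝ → ℝ → ℝ≥0∞} (hΦ : Measurable (Function.uncurry Φ)) :
    ∫⁻ x in Ioi (0 : ℝ), ∫⁻ y in Ioi (0 : ℝ), Φ x y =
      ∫⁻ s in Ioi (0 : ℝ), ∫⁻ β in Ioo (0 : ℝ) 1,
        Φ (β * s) ((1 - β) * s) * ENNReal.ofReal s := by
  -- The constraint 0 < x < s sits in an indicator, so that shift and exchange of integrals take
  -- place on the whole line.
  let Ψ : ℝ → ℝ → ℝ≥0∞ := fun s x =>
    (Ioo 0 s).indicator (fun x => Φ x (s - x)) x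
  have hΨ : Measurable (Function.uncurry Ψ) := by
    have : Function.uncurry Ψ = {p : ℝ × ℝ | 0 < p.2 ∧ p.2 < p.1}.indicator
        (fun p => Function.uncurry Φ (p.2, p.1 - p.2)) := by
      ext p
      by_cases hp : 0 < p.2 ∧ p.2 < p.1
      · rw [indicator_of_mem (by exact hp)]
        simp [Function.uncurry, Ψ, hp]
      · rw [indicator_of_notMem (by exact hp)]
        simp only [Function.uncurry, Ψ]
        exact indicator_of_notMem (by exact hp) _
    rw [this]
    refine Measurable.indicator (hΦ.comp (by fun_prop)) ?_
    exact (measurableSet_lt measurable_const measurable_snd).inter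
      (measurableSet_lt measurable_snd measurable_fst)
  calc ∫⁻ x in Ioi (0 : ℝ), ∫⁻ y in Ioi (0 : ℝ), Φ x y
      = ∫⁻ x, ∫⁻ s, Ψ s x := by
        rw [← lintegral_indicator measurableSet_Ioi]
        refine lintegral_congr fun x => ?_
        by_cases hx : 0 < x
        · rw [indicator_of_mem (mem_Ioi.2 hx), ← lintegral_indicator measurableSet_Ioi,
            ← lintegral_sub_right_eq_self _ x]
          refine lintegral_congr fun s => ?_
          simp [Ψ, indicator, hx]
        · rw [indicator_of_notMem (by simpa using hx)]
          simp [Ψ, indicator, hx]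
    _ = ∫⁻ s, ∫⁻ x, Ψ s x := by
        rw [lintegral_lintegral_swap]
        exact (hΨ.comp measurable_swap).aemeasurable
    _ = _ := by
        rw [← lintegral_indicator measurableSet_Ioi]
        refine lintegral_congr fun s => ?_
        by_cases hs : 0 < s
        · rw [indicator_of_mem (mem_Ioi.2 hs), lintegral_comp_mul_left (h := Ψ s) hs
            (hΨ.comp (measurable_const.prodMk measurable_id)),
            ← lintegral_indicator measurableSet_Ioo]
          refine lintegral_congr fun β => ?_
          by_cases hβ : β ∈ Ioo (0 : ℝ) 1
          · have : β * s ∈ Ioo 0 s := ⟨mul_pos hβ.1 hs, by nlinarith [hβ.2]⟩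
            rw [indicator_of_mem hβ]
            simp only [Ψ]
            rw [indicator_of_mem this]
            congr 2; ring
          · have : β * s ∉ Ioo 0 s := by
              rintro ⟨h1, h2⟩
              exact hβ ⟨pos_of_mul_pos_left h1 hs.le, by nlinarith⟩
            rw [indicator_of_notMem hβ]
            simp only [Ψ]
            rw [indicator_of_notMem this, zero_mul]
        · rw [indicator_of_notMem (by simpa using hs)]
          have : Ψ s = fun _ => 0 := by
            ext x
            have : x ∉ Ioo 0 s := fun h => hs (h.1.trans h.2)
            simp [Ψ, this]
          rw [this]; simp

instance isProbabilityMeasure_siteLaw {ε : ℝ} [hε : Fact (0 < ε)] :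
    IsProbabilityMeasure (siteLaw ε) :=
  isProbabilityMeasure_gammaMeasure (by norm_num) (one_div_pos.2 hε.out)

lemma lintegral_siteLaw {ε : ℝ} (g : ℝ → ℝ≥0∞) (hg : Measurable g) :
    ∫⁻ x, g x ∂(siteLaw ε) = ∫⁻ x in Ioi (0 : ℝ), gammaPDF (3 / 2) (1 / ε) x * g x := by
  have hm : Measurable (gammaPDF (3 / 2) (1 / ε)) := (measurable_gammaPDFReal _ _).ennreal_ofReal
  rw [siteLaw, gammaMeasure, lintegral_withDensity_eq_lintegral_mul _ hm hg,
    ← lintegral_indicator measurableSet_Ioi]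
  refine lintegral_congr_ae ?_
  have h0 : ∀ᵐ x : ℝ, x ≠ 0 := by simp [ae_iff, measure_singleton]
  filter_upwards [h0] with x hx
  rcases lt_or_gt_of_ne hx with h | h
  · simp [indicator, gammaPDF_of_neg h]
  · simp [indicator, h]

/-- Here the shape 3/2 enters: two densities with factor √x produce exactly the weight √(β(1-β)),
and the exponentials combine to a function of the sum alone. This is the independence of sum and
ratio. -/
lemma gammaPDF_mul_gammaPDF {r s β : ℝ} (hr : 0 < r) (hs : 0 < s) (hβ : β ∈ Ioo (0 : ℝ) 1) :
    gammaPDF (3 / 2) r (β * s) * gammaPDF (3 / 2) r ((1 - β) * s) =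
      ENNReal.ofReal ((r ^ (3 / 2 : ℝ) / Real.Gamma (3 / 2)) ^ 2 * s * Real.exp (-(r * s))) *
        ENNReal.ofReal (ratioWeight β) := by
  have hβ' : 0 < 1 - β := by linarith [hβ.2]
  have h1 : 0 ≤ β * s := (mul_pos hβ.1 hs).le
  have h2 : 0 ≤ (1 - β) * s := (mul_pos hβ' hs).le
  have hc : 0 ≤ r ^ (3 / 2 : ℝ) / Real.Gamma (3 / 2) := by positivity
  rw [gammaPDF_of_nonneg h1, gammaPDF_of_nonneg h2, ← ENNReal.ofReal_mul (by positivity),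
    ← ENNReal.ofReal_mul (by positivity)]
  congr 1
  have e : (3 / 2 - 1 : ℝ) = 1 / 2 := by norm_num
  rw [e, ← Real.sqrt_eq_rpow, ← Real.sqrt_eq_rpow, ratioWeight, Real.sqrt_mul hβ.1.le,
    Real.sqrt_mul hβ'.le, Real.sqrt_mul hβ.1.le]
  have e2 : Real.exp (-(r * (β * s))) * Real.exp (-(r * ((1 - β) * s))) = Real.exp (-(r * s)) := by
    rw [← Real.exp_add]; congr 1; ring
  have e3 : √s * √s = s := Real.mul_self_sqrt hs.le
  rw [← e2]
  generalize r ^ (3 / 2 : ℝ) / Real.Gamma (3 / 2) = c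
  linear_combination (c ^ 2 * √β * √(1 - β) * Real.exp (-(r * (β * s))) *
    Real.exp (-(r * ((1 - β) * s)))) * e3

lemma lintegral_siteLaw_pair {ε : ℝ} (hε : 0 < ε) {φ : ℝ → ℝ → ℝ≥0∞}
    (hφ : Measurable (Function.uncurry φ)) :
    ∫⁻ x, ∫⁻ y, φ x y ∂(siteLaw ε) ∂(siteLaw ε) =
      ∫⁻ s in Ioi (0 : ℝ), ENNReal.ofReal (((1 / ε) ^ (3 / 2 : ℝ) / Real.Gamma (3 / 2)) ^ 2 * s *
          Real.exp (-(1 / ε * s))) * ENNReal.ofReal s *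
        ∫⁻ β, ENNReal.ofReal (ratioWeight β) * φ (β * s) ((1 - β) * s) ∂unitVol := by
  have := Fact.mk hε
  have hm : Measurable (gammaPDF (3 / 2) (1 / ε)) := (measurable_gammaPDFReal _ _).ennreal_ofReal
  rw [lintegral_siteLaw (fun x => ∫⁻ y, φ x y ∂(siteLaw ε)) hφ.lintegral_prod_right']
  have hφ' : ∀ x, Measurable (φ x) := fun x => hφ.comp (measurable_const.prodMk measurable_id)
  have h1 : ∀ x, gammaPDF (3 / 2) (1 / ε) x * ∫⁻ y, φ x y ∂(siteLaw ε) =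
      ∫⁻ y in Ioi (0 : ℝ), gammaPDF (3 / 2) (1 / ε) x * (gammaPDF (3 / 2) (1 / ε) y * φ x y) := by
    intro x
    rw [lintegral_siteLaw _ (hφ' x), lintegral_const_mul _ (by fun_prop)]
  simp_rw [h1]
  rw [lintegral_polar (Φ := fun x y =>
    gammaPDF (3 / 2) (1 / ε) x * (gammaPDF (3 / 2) (1 / ε) y * φ x y))]
  · refine setLIntegral_congr_fun measurableSet_Ioi fun s hs => ?_
    have hs : 0 < s := hs
    rw [unitVol, ← restrict_Ioo_eq_restrict_Icc, ← lintegral_const_mul]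
    · refine setLIntegral_congr_fun measurableSet_Ioo fun β hβ => ?_
      rw [← mul_assoc, gammaPDF_mul_gammaPDF (one_div_pos.2 hε) hs hβ]
      ring
    · exact (by fun_prop : Measurable fun β => ENNReal.ofReal (ratioWeight β)).mul
        (hφ.comp (g := Function.uncurry φ) (f := fun β => (β * s, (1 - β) * s)) (by fun_prop))
  · exact (hm.comp measurable_fst).mul ((hm.comp measurable_snd).mul hφ)

/-- Symmetry of the measure `π(dx) k(x, α) dα` under exchanging the configurations before and after
the jump across bond `i`. -/
def IsSymmetricOn {n : ℕ} (i : Fin n) (k : Config n → ℝ → ℝ) (π : Measure (Config n)) : Prop :=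
  ∀ F : Config n → Config n → ℝ≥0∞, Measurable (Function.uncurry F) →
    ∫⁻ x, ∫⁻ α, ENNReal.ofReal (k x α) * F x (exchange i α x) ∂unitVol ∂π =
      ∫⁻ x, ∫⁻ α, ENNReal.ofReal (k x α) * F (exchange i α x) x ∂unitVol ∂π

lemma lmarginal_pair {ι : Type*} [DecidableEq ι] {ν : ι → Measure ℝ}
    [∀ i, SigmaFinite (ν i)] {a b : ι} (hab : a ≠ b) {f : (ι → ℝ) → ℝ≥0∞} (hf : Measurable f)
    (x : ι → ℝ) : (∫⋯∫⁻_({a, b} : Finset ι), f ∂ν) x =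
      ∫⁻ u, ∫⁻ v, f (Function.update (Function.update x a u) b v) ∂(ν b) ∂(ν a) := by
  rw [lmarginal_insert f hf (by simpa using hab)]
  simp_rw [lmarginal_singleton]

/-- Freeze all sites outside the bond. In polar coordinates an exchange keeps s and replaces β by α,
so the claim is Tonelli for the symmetric weight `ratioWeight β * κ β α`. -/
lemma isSymmetricOn_pi_siteLaw {n : ℕ} (i : Fin n) {ε : ℝ} (hε : 0 < ε) {κ : ℝ → ℝ → ℝ}
    (hκ : Measurable (Function.uncurry κ))
    (hbal : ∀ β ∈ Ioo (0 : ℝ) 1, ∀ α ∈ Ioo (0 : ℝ) 1,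
      ratioWeight β * κ β α = ratioWeight α * κ α β) :
    IsSymmetricOn i (fun x α => κ (ratio i x) α) (Measure.pi fun _ => siteLaw ε) := by
  have := Fact.mk hε
  intro F hF
  have hmeas : ∀ G : Config n → Config n → ℝ≥0∞, Measurable (Function.uncurry G) →
      Measurable fun p : Config n × ℝ =>
        ENNReal.ofReal (κ (ratio i p.1) p.2) * G p.1 (exchange i p.2 p.1) := by
    intro G hG
    exact ((hκ.comp ((measurable_ratio i).comp measurable_fst |>.prodMk measurable_snd)
      ).ennreal_ofReal).mul (hG.comp (measurable_fst.prodMk (measurable_exchange i)))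
  -- The marginal over the two sites of the bond, written so that source and target are the same
  -- expression in β and in α; interchanging the arguments of F then amounts to interchanging β and
  -- α.
  have key : ∀ G : Config n → Config n → ℝ≥0∞, Measurable (Function.uncurry G) → ∀ x : Config n,
      (∫⋯∫⁻_({i.castSucc, i.succ} : Finset (Fin (n + 1))), (fun x => ∫⁻ α,
        ENNReal.ofReal (κ (ratio i x) α) * G x (exchange i α x) ∂unitVol)
          ∂(fun _ => siteLaw ε)) x =
      ∫⁻ s in Ioi (0 : ℝ), ENNReal.ofReal (((1 / ε) ^ (3 / 2 : ℝ) / Real.Gamma (3 / 2)) ^ 2 * s *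
          Real.exp (-(1 / ε * s))) * ENNReal.ofReal s *
        ∫⁻ β, ∫⁻ α, ENNReal.ofReal (ratioWeight β * κ β α) *
          G (Function.update (Function.update x i.castSucc (β * s)) i.succ ((1 - β) * s))
            (Function.update (Function.update x i.castSucc (α * s)) i.succ ((1 - α) * s))
          ∂unitVol ∂unitVol := by
    intro G hG x
    have hf := (hmeas G hG).lintegral_prod_right' (ν := unitVol)
    rw [lmarginal_pair (castSucc_ne_succ i) hf, lintegral_siteLaw_pair hε]
    · refine setLIntegral_congr_fun measurableSet_Ioi fun s hs => ?_
      have hs : 0 < s := hs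
      simp only
      congr 1
      refine lintegral_congr fun β => ?_
      set z := Function.update (Function.update x i.castSucc (β * s)) i.succ ((1 - β) * s) with hz
      have hzs : bondEnergy i z = s := by
        rw [bondEnergy, hz]
        simp [Function.update_of_ne (castSucc_ne_succ i)]
        ring
      have hzr : ratio i z = β := by
        rw [ratio_eq, hzs, hz]
        simp [Function.update_of_ne (castSucc_ne_succ i), hs.ne']
      rw [← lintegral_const_mul (f := fun α => ENNReal.ofReal (κ (ratio i z) α) *
        G z (exchange i α z)) _ ((hmeas G hG).comp (measurable_const.prodMk measurable_id))]
      refine lintegral_congr fun α => ?_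
      have hze : exchange i α z =
          Function.update (Function.update x i.castSucc (α * s)) i.succ ((1 - α) * s) := by
        rw [exchange_update, hzs, hz, Function.update_comm (castSucc_ne_succ i).symm,
          Function.update_idem, Function.update_idem]
      rw [hzr, hze]
      rw [ENNReal.ofReal_mul (ratioWeight_nonneg β), mul_assoc]
    · refine hf.comp (f := fun p : ℝ × ℝ =>
        Function.update (Function.update x i.castSucc p.1) i.succ p.2) ?_
      rw [measurable_pi_iff]
      intro j
      by_cases h₂ : j = i.succ
      · subst h₂; simpa using measurable_snd
      · by_cases h₁ : j = i.castSucc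
        · subst h₁; simpa [castSucc_ne_succ] using measurable_fst
        · simp [h₁, h₂]
  have hF' : Measurable (Function.uncurry fun x y => F y x) := hF.comp measurable_swap
  refine lintegral_eq_of_lmarginal_eq {i.castSucc, i.succ}
    ((hmeas F hF).lintegral_prod_right' (ν := unitVol))
    ((hmeas _ hF').lintegral_prod_right' (ν := unitVol)) ?_
  funext x
  refine (key F hF x).trans (Eq.trans ?_ (key _ hF' x).symm)
  refine setLIntegral_congr_fun measurableSet_Ioi fun s hs => ?_
  congr 1
  have hupd : Measurable fun β : ℝ =>
      Function.update (Function.update x i.castSucc (β * s)) i.succ ((1 - β) * s) := by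
    rw [measurable_pi_iff]
    intro j
    by_cases h₂ : j = i.succ
    · subst h₂; simp only [Function.update_self]; fun_prop
    · by_cases h₁ : j = i.castSucc
      · subst h₁; simp only [castSucc_ne_succ, ne_eq, not_false_eq_true, Function.update_of_ne,
          Function.update_self]; fun_prop
      · simp [h₁, h₂]
  rw [lintegral_lintegral_swap]
  · refine lintegral_congr_ae ?_
    filter_upwards [ae_unitVol] with α hα
    refine lintegral_congr_ae ?_
    filter_upwards [ae_unitVol] with β hβ
    rw [hbal β hβ α hα]
  · refine Measurable.aemeasurable ?_
    refine Measurable.mul ?_ (hF.comp (f := fun p : ℝ × ℝ => _)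
      ((hupd.comp measurable_fst).prodMk (hupd.comp measurable_snd)))
    exact (((measurable_ratioWeight).comp measurable_fst).mul hκ).ennreal_ofReal

/-- A factor that is constant along exchanges can be absorbed into the test function. It serves for
Λ_s of the bond energy and for cutoffs in the total energy. -/
lemma IsSymmetricOn.mul_left {n : ℕ} {i : Fin n} {k : Config n → ℝ → ℝ} {π : Measure (Config n)}
    (h : IsSymmetricOn i k π) {c : Config n → ℝ} (hc : Measurable c) (hc0 : ∀ x, 0 ≤ c x)
    (hinv : ∀ α x, c (exchange i α x) = c x) :
    IsSymmetricOn i (fun x α => c x * k x α) π := by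
  intro F hF
  have := h (fun x y => ENNReal.ofReal (c x) * F x y)
    ((hc.comp measurable_fst).ennreal_ofReal.mul hF)
  simp only [hinv] at this
  simp only [ENNReal.ofReal_mul (hc0 _)]
  simpa only [mul_assoc, mul_left_comm] using this


/-! ### Laplace transforms determine finite measures on the half-line -/

/-- The function `exp (-x)` on the half-line. -/
def expNeg : NNReal →ᵇ ℝ :=
  BoundedContinuousFunction.ofNormedAddCommGroup (fun x : NNReal => Real.exp (-(x : ℝ)))
    (by fun_prop) 1 fun x => by
      rw [Real.norm_of_nonneg (Real.exp_nonneg _), Real.exp_le_one_iff]; simp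

lemma expNeg_pow_apply (k : ℕ) (x : NNReal) : (expNeg ^ k) x = Real.exp (-(k * (x : ℝ))) := by
  rw [BoundedContinuousFunction.coe_pow, Pi.pow_apply]
  change Real.exp (-(x : ℝ)) ^ k = _
  rw [← Real.exp_nat_mul]; congr 1; ring

/-- Polynomials in exp(-x) form a point-separating algebra of bounded continuous functions, so the
transform at the natural numbers already determines the measure. -/
lemma measure_eq_of_laplace_nnreal {P Q : Measure NNReal} [IsFiniteMeasure P] [IsFiniteMeasure Q]
    (h : ∀ k : ℕ, ∫ x, Real.exp (-(k * (x : ℝ))) ∂P = ∫ x, Real.exp (-(k * (x : ℝ))) ∂Q) :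
    P = Q := by
  let A : StarSubalgebra ℝ (NNReal →ᵇ ℝ) :=
    { Algebra.adjoin ℝ {expNeg} with
      star_mem' := fun {a} ha => by
        have : star a = a := by ext x; simp
        rw [this]; exact ha }
  refine ext_of_forall_mem_subalgebra_integral_eq_of_polish (𝕜 := ℝ) (A := A) ?_ ?_
  · intro x y hxy
    refine ⟨expNeg, ⟨_, ⟨expNeg, Algebra.subset_adjoin rfl, rfl⟩, rfl⟩, ?_⟩
    change Real.exp (-(x : ℝ)) ≠ Real.exp (-(y : ℝ))
    intro h'
    exact hxy (NNReal.coe_injective (neg_injective (Real.exp_injective h')))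
  · intro g hg
    have hg' : g ∈ Algebra.adjoin ℝ {expNeg} := hg
    rw [Algebra.adjoin_singleton_eq_range_aeval] at hg'
    obtain ⟨p, rfl⟩ := hg'
    clear hg
    change ∫ x, (Polynomial.aeval expNeg p : NNReal →ᵇ ℝ) x ∂P =
      ∫ x, (Polynomial.aeval expNeg p : NNReal →ᵇ ℝ) x ∂Q
    induction p using Polynomial.induction_on' with
    | add p q hp hq =>
      simp only [map_add, BoundedContinuousFunction.coe_add, Pi.add_apply]
      rw [integral_add (BoundedContinuousFunction.integrable _ _)
        (BoundedContinuousFunction.integrable _ _), hp, hq,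
        integral_add (BoundedContinuousFunction.integrable _ _)
        (BoundedContinuousFunction.integrable _ _)]
    | monomial k a =>
      have : ∀ x, (Polynomial.aeval expNeg (Polynomial.monomial k a) : NNReal →ᵇ ℝ) x =
          a * Real.exp (-(k * (x : ℝ))) := by
        intro x
        rw [Polynomial.aeval_monomial, Algebra.algebraMap_eq_smul_one, smul_mul_assoc, one_mul,
          BoundedContinuousFunction.smul_apply, expNeg_pow_apply, smul_eq_mul]
      simp_rw [this, integral_const_mul, h k]

lemma measure_eq_of_laplace {P Q : Measure ℝ} [IsFiniteMeasure P] [IsFiniteMeasure Q]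
    (hP : P (Iio 0) = 0) (hQ : Q (Iio 0) = 0)
    (h : ∀ k : ℕ, ∫ x, Real.exp (-(k * x)) ∂P = ∫ x, Real.exp (-(k * x)) ∂Q) : P = Q := by
  have ae : ∀ {ρ : Measure ℝ}, ρ (Iio 0) = 0 → ∀ᵐ x ∂ρ, 0 ≤ x := by
    intro ρ hρ
    rw [ae_iff]; convert hρ using 2; ext x; simp
  have key : P.map Real.toNNReal = Q.map Real.toNNReal := by
    have : IsFiniteMeasure (P.map Real.toNNReal) := Measure.isFiniteMeasure_map _ _
    have : IsFiniteMeasure (Q.map Real.toNNReal) := Measure.isFiniteMeasure_map _ _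
    refine measure_eq_of_laplace_nnreal fun k => ?_
    have hρ : ∀ {ρ : Measure ℝ}, ρ (Iio 0) = 0 →
        ∫ x, Real.exp (-(k * (x : ℝ))) ∂(ρ.map Real.toNNReal) = ∫ x, Real.exp (-(k * x)) ∂ρ := by
      intro ρ hρ
      rw [integral_map (by fun_prop) (by fun_prop)]
      refine integral_congr_ae ?_
      filter_upwards [ae hρ] with x hx
      rw [Real.coe_toNNReal x hx]
    rw [hρ hP, hρ hQ, h k]
  have back : ∀ {ρ : Measure ℝ}, ρ (Iio 0) = 0 →
      (ρ.map Real.toNNReal).map ((↑) : NNReal → ℝ) = ρ := by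
    intro ρ hρ
    rw [Measure.map_map (by fun_prop) (by fun_prop)]
    conv_rhs => rw [← Measure.map_id (μ := ρ)]
    refine Measure.map_congr ?_
    filter_upwards [ae hρ] with x hx
    simp [Real.coe_toNNReal x hx]
  rw [← back hP, ← back hQ, key]

/-! ### Products of measures with densities -/

lemma lmarginal_prod {ι : Type*} [DecidableEq ι] {X : ι → Type*}
    [∀ i, MeasurableSpace (X i)] {ν : ∀ i, Measure (X i)} [∀ i, SigmaFinite (ν i)]
    {f : ∀ i, X i → ℝ≥0∞} (hf : ∀ i, Measurable (f i)) (s : Finset ι) (x : ∀ i, X i) :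
    (∫⋯∫⁻_s, (fun x => ∏ i ∈ s, f i (x i)) ∂ν) x = ∏ i ∈ s, ∫⁻ y, f i y ∂(ν i) := by
  induction s using Finset.induction_on generalizing x with
  | empty => simp
  | insert i s hi ih =>
    have hm : ∀ t : Finset ι, Measurable (fun x : ∀ i, X i => ∏ i ∈ t, f i (x i)) := fun t =>
      Finset.measurable_prod _ fun j _ => (hf j).comp (measurable_pi_apply j)
    rw [lmarginal_insert _ (hm _) hi]
    have : ∀ y, (∫⋯∫⁻_s, (fun x => ∏ j ∈ insert i s, f j (x j)) ∂ν) (Function.update x i y) =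
        f i y * ∏ j ∈ s, ∫⁻ y, f j y ∂(ν j) := by
      intro y
      rw [← ih (Function.update x i y), lmarginal, lmarginal, ← lintegral_const_mul]
      · refine lintegral_congr fun z => ?_
        rw [Finset.prod_insert hi]
        congr 2
        rw [Function.updateFinset]
        simp [hi]
      · exact (hm s).comp measurable_updateFinset
    simp_rw [this]
    rw [lintegral_mul_const _ (hf i), Finset.prod_insert hi]

lemma lintegral_pi_prod {ι : Type*} [Fintype ι] {X : ι → Type*}
    [∀ i, MeasurableSpace (X i)] {ν : ∀ i, Measure (X i)} [∀ i, SigmaFinite (ν i)]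
    {f : ∀ i, X i → ℝ≥0∞} (hf : ∀ i, Measurable (f i)) :
    ∫⁻ x, ∏ i, f i (x i) ∂(Measure.pi ν) = ∏ i, ∫⁻ y, f i y ∂(ν i) := by
  classical
  by_cases hne : Nonempty (∀ i, X i)
  · obtain ⟨x⟩ := hne
    rw [lintegral_eq_lmarginal_univ x, lmarginal_prod hf]
  · have hE : IsEmpty (∀ i, X i) := not_nonempty_iff.1 hne
    obtain ⟨i, hi⟩ : ∃ i, IsEmpty (X i) := by
      by_contra! hcon
      exact hne ⟨fun i => (hcon i).some⟩
    rw [Finset.prod_eq_zero (Finset.mem_univ i)]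
    · rw [lintegral_of_isEmpty]
    · rw [lintegral_of_isEmpty]

lemma pi_withDensity {ι : Type*} [Fintype ι] {X : ι → Type*}
    [∀ i, MeasurableSpace (X i)] {ν : ∀ i, Measure (X i)} [∀ i, SigmaFinite (ν i)]
    {f : ∀ i, X i → ℝ≥0∞} (hf : ∀ i, Measurable (f i))
    [∀ i, SigmaFinite ((ν i).withDensity (f i))] :
    Measure.pi (fun i => (ν i).withDensity (f i)) =
      (Measure.pi ν).withDensity fun x => ∏ i, f i (x i) := by
  refine Measure.pi_eq fun s hs => ?_
  rw [withDensity_apply _ (MeasurableSet.univ_pi hs), Measure.restrict_pi_pi,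
    lintegral_pi_prod hf]
  exact Finset.prod_congr rfl fun i _ => (withDensity_apply _ (hs i)).symm

/-! ### Scaling and tilting of the Gamma laws -/

/-- The product of the Gamma laws of scale `θ`. -/
abbrev gibbs (n : ℕ) (θ : ℝ) : Measure (Config n) := Measure.pi fun _ => siteLaw θ

lemma gammaPDF_scale {r c x : ℝ} (hr : 0 < r) (hc : 0 < c) (hx : 0 < x) :
    gammaPDF (3 / 2) (r / c) (x * c) * ENNReal.ofReal c = gammaPDF (3 / 2) r x := by
  have : 0 < x * c := mul_pos hx hc
  rw [gammaPDF_of_nonneg this.le, gammaPDF_of_nonneg hx.le, ← ENNReal.ofReal_mul (by positivity)]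
  congr 1
  rw [Real.mul_rpow hx.le hc.le, Real.div_rpow hr.le hc.le]
  have e : c ^ (3 / 2 : ℝ) = c ^ (3 / 2 - 1 : ℝ) * c := by
    rw [← Real.rpow_add_one hc.ne']; norm_num
  have e2 : r / c * (x * c) = r * x := by field_simp
  have h0 : c ^ (3 / 2 - 1 : ℝ) ≠ 0 := (Real.rpow_pos_of_pos hc _).ne'
  have h1 : Real.Gamma (3 / 2) ≠ 0 := (Real.Gamma_pos_of_pos (by norm_num)).ne'
  rw [e, e2]
  field_simp

lemma map_siteLaw {θ c : ℝ} (hθ : 0 < θ) (hc : 0 < c) :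
    (siteLaw θ).map (fun x => c * x) = siteLaw (c * θ) := by
  have hm : ∀ r, Measurable (gammaPDF (3 / 2) r) := fun r =>
    (measurable_gammaPDFReal _ _).ennreal_ofReal
  refine Measure.ext_of_lintegral _ fun g hg => ?_
  rw [lintegral_map hg (by fun_prop), lintegral_siteLaw _ (by fun_prop), lintegral_siteLaw _ hg,
    ← lintegral_indicator measurableSet_Ioi, ← lintegral_indicator measurableSet_Ioi,
    lintegral_comp_mul_left (h := indicator (Ioi 0)
      (fun x => gammaPDF (3 / 2) (1 / (c * θ)) x * g x)) hc
      (((hm _).mul hg).indicator measurableSet_Ioi)]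
  refine lintegral_congr fun x => ?_
  by_cases hx : 0 < x
  · rw [indicator_of_mem (mem_Ioi.2 hx), indicator_of_mem (mem_Ioi.2 (mul_pos hx hc)),
      ← gammaPDF_scale (one_div_pos.2 hθ) hc hx]
    have : 1 / θ / c = 1 / (c * θ) := by field_simp
    rw [this, mul_comm x c]; ring
  · rw [indicator_of_notMem (by simpa using hx), indicator_of_notMem, zero_mul]
    simp only [mem_Ioi, not_lt] at hx ⊢
    exact mul_nonpos_of_nonpos_of_nonneg hx hc.le

lemma map_smul_gibbs {n : ℕ} {θ c : ℝ} (hθ : 0 < θ) (hc : 0 < c) :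
    (gibbs n θ).map (fun x => c • x) = gibbs n (c * θ) := by
  have := Fact.mk hθ
  have := Fact.mk (mul_pos hc hθ)
  have : ∀ i : Fin (n + 1), SigmaFinite ((siteLaw θ).map (fun x => c * x)) := fun i => by
    rw [map_siteLaw hθ hc]; infer_instance
  have h := Measure.pi_map_pi (μ := fun _ : Fin (n + 1) => siteLaw θ)
    (f := fun _ x => c * x) (fun i => by fun_prop)
  simp only [map_siteLaw hθ hc] at h
  exact h

/-- A factor exp(-px) raises the rate of a Gamma law by p and leaves its shape. The prefactor, the
reciprocal of the Laplace transform at p, is what `laplaceMoment_siteLaw` reads off. -/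
lemma siteLaw_tilt {θ p : ℝ} (hθ : 0 < θ) (hp : 0 ≤ p) :
    siteLaw (1 / (1 / θ + p)) = (siteLaw θ).withDensity fun x =>
      ENNReal.ofReal ((1 + θ * p) ^ (3 / 2 : ℝ) * Real.exp (-(p * x))) := by
  have hm : ∀ r, Measurable (gammaPDF (3 / 2) r) := fun r =>
    (measurable_gammaPDFReal _ _).ennreal_ofReal
  have hr : 0 < 1 / θ + p := by positivity
  rw [siteLaw, siteLaw, gammaMeasure, gammaMeasure, ← withDensity_mul _ (hm _) (by fun_prop),
    one_div_one_div]
  congr 1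
  ext x
  rw [Pi.mul_apply]
  rcases lt_or_ge x 0 with hx | hx
  · rw [gammaPDF_of_neg hx, gammaPDF_of_neg hx, zero_mul]
  · rw [gammaPDF_of_nonneg hx, gammaPDF_of_nonneg hx, ← ENNReal.ofReal_mul (by positivity)]
    congr 1
    have e : 1 / θ + p = 1 / θ * (1 + θ * p) := by field_simp
    have e2 : Real.exp (-((1 / θ + p) * x)) = Real.exp (-(1 / θ * x)) * Real.exp (-(p * x)) := by
      rw [← Real.exp_add]; congr 1; ring
    rw [e2, e, Real.mul_rpow (by positivity) (by positivity)]
    ring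

lemma gibbs_tilt {n : ℕ} {θ p : ℝ} (hθ : 0 < θ) (hp : 0 ≤ p) :
    gibbs n (1 / (1 / θ + p)) = (gibbs n θ).withDensity fun x =>
      ENNReal.ofReal (((1 + θ * p) ^ (3 / 2 : ℝ)) ^ (n + 1) * Real.exp (-(p * ∑ i, x i))) := by
  have := Fact.mk hθ
  have hθ' : 0 < 1 / (1 / θ + p) := by positivity
  have := Fact.mk hθ'
  have : ∀ i : Fin (n + 1), SigmaFinite ((siteLaw θ).withDensity fun x =>
      ENNReal.ofReal ((1 + θ * p) ^ (3 / 2 : ℝ) * Real.exp (-(p * x)))) := fun i => by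
    rw [← siteLaw_tilt hθ hp]; infer_instance
  rw [gibbs, siteLaw_tilt hθ hp, pi_withDensity (fun i => by fun_prop)]
  congr 1
  ext x
  rw [← ENNReal.ofReal_prod_of_nonneg (fun i _ => by positivity), Finset.prod_mul_distrib,
    Finset.prod_const, ← Real.exp_sum, Finset.sum_neg_distrib, Finset.mul_sum]
  simp

lemma ae_siteLaw_pos {θ : ℝ} (hθ : 0 < θ) : ∀ᵐ y ∂(siteLaw θ), 0 < y := by
  have := Fact.mk hθ
  have h0 : ∫⁻ y, (Iic (0 : ℝ)).indicator (fun _ => (1 : ℝ≥0∞)) y ∂(siteLaw θ) = 0 := by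
    rw [lintegral_siteLaw _ (by exact measurable_const.indicator measurableSet_Iic)]
    rw [setLIntegral_congr_fun (g := fun _ => 0) measurableSet_Ioi, lintegral_zero]
    intro y (hy : 0 < y)
    simp [hy]
  rw [lintegral_indicator_const measurableSet_Iic, one_mul] at h0
  rw [ae_iff]; convert h0 using 2; ext y; simp

lemma ae_gibbs_pos {n : ℕ} {θ : ℝ} (hθ : 0 < θ) : ∀ᵐ x ∂(gibbs n θ), ∀ j, 0 < x j := by
  have := Fact.mk hθ
  rw [eventually_countable_forall]
  exact fun j => (measurePreserving_eval (fun _ : Fin (n + 1) => siteLaw θ)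
    j).quasiMeasurePreserving.ae (ae_siteLaw_pos hθ)

/-! ### The conditional laws given the mean energy -/

/-- The configuration rescaled to mean energy one. -/
def direction {n : ℕ} (x : Config n) : Config n := (meanEnergy x)⁻¹ • x

lemma measurable_direction {n : ℕ} : Measurable (direction : Config n → Config n) := by
  unfold direction; fun_prop

/-- The law of the direction under the Gamma product law. -/
def directionLaw (n : ℕ) : Measure (Config n) := (gibbs n 1).map direction

instance (n : ℕ) : IsProbabilityMeasure (directionLaw n) := by
  have := Fact.mk (one_pos : (0 : ℝ) < 1)
  exact Measure.isProbabilityMeasure_map measurable_direction.aemeasurable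

lemma direction_smul {n : ℕ} {c : ℝ} (hc : c ≠ 0) (x : Config n) :
    direction (c • x) = direction x := by
  rw [direction, direction, meanEnergy_smul, smul_smul, mul_inv, mul_right_comm,
    inv_mul_cancel₀ hc, one_mul]

lemma map_direction_gibbs {n : ℕ} {θ : ℝ} (hθ : 0 < θ) :
    (gibbs n θ).map direction = directionLaw n := by
  have h := map_smul_gibbs (n := n) one_pos hθ
  rw [mul_one] at h
  rw [← h, Measure.map_map measurable_direction (by fun_prop), directionLaw]
  congr 1
  ext1 x
  exact direction_smul hθ.ne' x

lemma meanEnergy_pos {n : ℕ} {x : Config n} (hx : ∀ j, 0 < x j) : 0 < meanEnergy x := by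
  rw [meanEnergy_eq]
  have : 0 < ∑ j, x j := Finset.sum_pos (fun j _ => hx j) Finset.univ_nonempty
  positivity

/-- The tilted Gamma product law is a Gamma product law of another scale, and the direction has the
same law under both. So the Laplace transform of the mean energy on a direction event is the
probability of the event times a number that does not depend on it. -/
lemma lintegral_exp_direction {n : ℕ} {θ : ℝ} (hθ : 0 < θ) {G : Set (Config n)}
    (hG : MeasurableSet G) (k : ℕ) :
    ∫⁻ x in direction ⁻¹' G, ENNReal.ofReal (Real.exp (-(k * meanEnergy x))) ∂(gibbs n θ) =
      directionLaw n G * (ENNReal.ofReal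
        (((1 + θ * (k / (n + 1))) ^ (3 / 2 : ℝ)) ^ (n + 1)))⁻¹ := by
  -- The tilt per site is k/(n+1), because the mean energy is the sum divided by n+1.
  have hp : (0 : ℝ) ≤ k / (n + 1) := by positivity
  have hm := measurable_direction hG
  have hc : 0 < ((1 + θ * (k / (n + 1) : ℝ)) ^ (3 / 2 : ℝ)) ^ (n + 1) := by positivity
  set c := ((1 + θ * (k / (n + 1) : ℝ)) ^ (3 / 2 : ℝ)) ^ (n + 1)
  have h : directionLaw n G = ENNReal.ofReal c *
      ∫⁻ x in direction ⁻¹' G, ENNReal.ofReal (Real.exp (-(k * meanEnergy x))) ∂(gibbs n θ) := by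
    rw [← map_direction_gibbs (show 0 < 1 / (1 / θ + (k : ℝ) / (n + 1)) by positivity),
      Measure.map_apply measurable_direction hG, gibbs_tilt hθ hp, withDensity_apply _ hm,
      ← lintegral_const_mul _ (by fun_prop)]
    refine lintegral_congr fun x => ?_
    rw [← ENNReal.ofReal_mul hc.le, meanEnergy_eq]
    congr 3
    ring
  rw [h, mul_comm, ← mul_assoc, ENNReal.inv_mul_cancel (ENNReal.ofReal_pos.2 hc).ne'
    ENNReal.ofReal_ne_top, one_mul]

/-- Independence of mean energy and direction: for every direction event, the law of the mean energy
restricted to it has a Laplace transform proportional to the unrestricted one, hence is itself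
proportional. -/
lemma map_meanEnergy_direction {n : ℕ} {θ : ℝ} (hθ : 0 < θ) :
    (gibbs n θ).map (fun x => (meanEnergy x, direction x)) =
      ((gibbs n θ).map meanEnergy).prod (directionLaw n) := by
  have := Fact.mk hθ
  symm
  refine Measure.prod_eq fun A G hA hG => ?_
  have hm := measurable_direction hG
  have key : ((gibbs n θ).restrict (direction ⁻¹' G)).map meanEnergy =
      directionLaw n G • (gibbs n θ).map meanEnergy := by
    have : IsFiniteMeasure (directionLaw n G • (gibbs n θ).map meanEnergy) :=
      Measure.smul_finite _ (measure_ne_top _ _)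
    have hneg : ∀ B : Set (Config n), ((gibbs n θ).restrict B).map meanEnergy (Iio 0) = 0 := by
      intro B
      rw [Measure.map_apply measurable_meanEnergy measurableSet_Iio]
      refine le_antisymm ((Measure.restrict_apply_le _ _).trans (le_of_eq ?_)) zero_le
      have : ∀ᵐ x ∂(gibbs n θ), x ∉ meanEnergy ⁻¹' Iio 0 := by
        filter_upwards [ae_gibbs_pos hθ] with x hx
        simpa using (meanEnergy_pos hx).le
      exact measure_eq_zero_iff_ae_notMem.2 this
    refine measure_eq_of_laplace (hneg _) ?_ fun k => ?_
    · have := hneg univ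
      rw [Measure.restrict_univ] at this
      simp [this]
    · have h1 := lintegral_exp_direction (n := n) hθ hG k
      have h2 := lintegral_exp_direction (n := n) hθ MeasurableSet.univ k
      rw [preimage_univ, Measure.restrict_univ, measure_univ, one_mul] at h2
      rw [integral_map (by fun_prop) (by fun_prop), integral_smul_measure,
        integral_map (by fun_prop) (by fun_prop),
        integral_eq_lintegral_of_nonneg_ae (Filter.Eventually.of_forall fun _ => Real.exp_nonneg _)
          (by fun_prop),
        integral_eq_lintegral_of_nonneg_ae (Filter.Eventually.of_forall fun _ => Real.exp_nonneg _)
          (by fun_prop), h1, h2, ENNReal.toReal_mul, smul_eq_mul]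
  have h3 := congrArg (fun ρ => ρ A) key
  simp only [Measure.smul_apply, smul_eq_mul] at h3
  rw [Measure.map_apply measurable_meanEnergy hA,
    Measure.restrict_apply (measurable_meanEnergy hA)] at h3
  rw [Measure.map_apply (measurable_meanEnergy.prodMk measurable_direction) (hA.prod hG),
    mul_comm, ← h3]
  rfl

/-- The law on the simplex of mean energy `ε`: the rescaled law of the direction. -/
def condLaw (n : ℕ) : Kernel ℝ (Config n) :=
  (Kernel.deterministic id measurable_id ×ₖ Kernel.const ℝ (directionLaw n)).map
    fun p : ℝ × Config n => p.1 • p.2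

lemma condLaw_apply {n : ℕ} (ε : ℝ) : condLaw n ε = (directionLaw n).map (fun u => ε • u) := by
  rw [condLaw, Kernel.map_apply _ (by fun_prop), Kernel.prod_apply, Kernel.deterministic_apply,
    Kernel.const_apply, Measure.dirac_prod, Measure.map_map (by fun_prop) (by fun_prop)]
  rfl

lemma condLaw_eq_map_gibbs {n : ℕ} (ε : ℝ) :
    condLaw n ε = (gibbs n 1).map (fun x => ε • direction x) := by
  rw [condLaw_apply, directionLaw, Measure.map_map (by fun_prop) measurable_direction]
  rfl

instance (n : ℕ) : IsMarkovKernel (condLaw n) :=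
  ⟨fun ε => by
    rw [condLaw_apply]; exact Measure.isProbabilityMeasure_map (by fun_prop)⟩

lemma ae_condLaw {n : ℕ} {ε : ℝ} (hε : 0 < ε) : ∀ᵐ x ∂(condLaw n ε), x ∈ simplex n ε := by
  rw [condLaw_eq_map_gibbs, ae_map_iff (f := fun x => ε • direction x)
    (p := fun x => x ∈ simplex n ε) (measurable_direction.const_smul ε).aemeasurable
    (measurableSet_simplex n ε)]
  filter_upwards [ae_gibbs_pos one_pos] with x hx
  have hm := meanEnergy_pos hx
  refine ⟨fun j => ?_, ?_⟩
  · simp only [direction, Pi.smul_apply, smul_eq_mul]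
    have := hx j
    positivity
  · rw [meanEnergy_smul, direction, meanEnergy_smul, inv_mul_cancel₀ hm.ne', mul_one]

/-- Almost surely a configuration is its mean energy times its direction, so independence of the two
identifies the conditional law. -/
lemma hasCondDistrib_condLaw {n : ℕ} {θ : ℝ} (hθ : 0 < θ) :
    HasCondDistrib id meanEnergy (condLaw n) (gibbs n θ) := by
  have := Fact.mk hθ
  refine ⟨by fun_prop, ?_⟩
  refine Measure.ext_of_lintegral _ fun f hf => ?_
  rw [lintegral_map hf (by fun_prop), Measure.lintegral_compProd hf]
  have h1 : ∀ e, ∫⁻ x, f (e, x) ∂(condLaw n e) = ∫⁻ u, f (e, e • u) ∂(directionLaw n) := by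
    intro e
    rw [condLaw_apply, lintegral_map (by fun_prop) (by fun_prop)]
  simp_rw [h1]
  have hf' : Measurable fun p : ℝ × Config n => f (p.1, p.1 • p.2) := by fun_prop
  rw [← lintegral_prod (fun p : ℝ × Config n => f (p.1, p.1 • p.2)) hf'.aemeasurable,
    ← map_meanEnergy_direction hθ,
    lintegral_map hf' (measurable_meanEnergy.prodMk measurable_direction)]
  refine lintegral_congr_ae ?_
  filter_upwards [ae_gibbs_pos hθ] with x hx
  have hm := meanEnergy_pos hx
  simp only [direction, smul_smul, mul_inv_cancel₀ hm.ne', one_smul, id]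

lemma isConditioning_condLaw {n : ℕ} {θ : ℝ} (hθ : 0 < θ) :
    IsConditioning (gibbs n θ) (condLaw n) where
  isMarkovKernel := inferInstance
  hasCondDistrib := hasCondDistrib_condLaw hθ
  concentrated ε hε := mem_ae_iff.1 (ae_condLaw (n := n) hε)
  weaklyContinuous g := by
    refine Continuous.continuousOn ?_
    have : ∀ ε, ∫ x, g x ∂(condLaw n ε) = ∫ u, g (ε • u) ∂(directionLaw n) := by
      intro ε
      rw [condLaw_apply, integral_map (by fun_prop) (by fun_prop)]
    simp_rw [this]
    refine continuous_of_dominated (bound := fun _ => ‖g‖) (fun ε => by fun_prop)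
      (fun ε => Filter.Eventually.of_forall fun u => g.norm_coe_le_norm _)
      (integrable_const _) (Filter.Eventually.of_forall fun u => by fun_prop)

/-- No disintegration is needed: rescaling to mean energy ε commutes with exchanges and preserves
ratios, so the symmetry of the Gamma product law is pushed forward. -/
lemma isSymmetricOn_condLaw {n : ℕ} (i : Fin n) {ε : ℝ} (hε : 0 < ε) {κ : ℝ → ℝ → ℝ}
    (hκ : Measurable (Function.uncurry κ))
    (hbal : ∀ β ∈ Ioo (0 : ℝ) 1, ∀ α ∈ Ioo (0 : ℝ) 1,
      ratioWeight β * κ β α = ratioWeight α * κ α β) :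
    IsSymmetricOn i (fun x α => κ (ratio i x) α) (condLaw n ε) := by
  intro F hF
  have hd : Measurable fun x : Config n => ε • direction x := measurable_direction.const_smul ε
  have hmeas : ∀ G : Config n → Config n → ℝ≥0∞, Measurable (Function.uncurry G) →
      Measurable fun x : Config n => ∫⁻ α, ENNReal.ofReal (κ (ratio i x) α) *
        G x (exchange i α x) ∂unitVol := by
    intro G hG
    refine Measurable.lintegral_prod_right' (f := fun p : Config n × ℝ =>
        ENNReal.ofReal (κ (ratio i p.1) p.2) * G p.1 (exchange i p.2 p.1)) ?_
    exact ((hκ.comp ((measurable_ratio i).comp measurable_fst |>.prodMk measurable_snd)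
      ).ennreal_ofReal).mul (hG.comp (measurable_fst.prodMk (measurable_exchange i)))
  have key : ∀ G : Config n → Config n → ℝ≥0∞, Measurable (Function.uncurry G) →
      ∫⁻ x, ∫⁻ α, ENNReal.ofReal (κ (ratio i x) α) * G x (exchange i α x) ∂unitVol
        ∂(condLaw n ε) =
      ∫⁻ x, ∫⁻ α, ENNReal.ofReal (κ (ratio i x) α) *
        G (ε • direction x) (ε • direction (exchange i α x)) ∂unitVol ∂(gibbs n 1) := by
    intro G hG
    rw [condLaw_eq_map_gibbs, lintegral_map (hmeas G hG) hd]
    refine lintegral_congr_ae ?_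
    filter_upwards [ae_gibbs_pos one_pos] with x hx
    have hm := inv_pos.2 (meanEnergy_pos hx)
    simp only [direction, exchange_smul, meanEnergy_exchange]
    rw [ratio_smul i hε.ne', ratio_smul i hm.ne']
  rw [key F hF, key (fun x y => F y x) (hF.comp measurable_swap)]
  exact isSymmetricOn_pi_siteLaw i one_pos hκ hbal (fun x y => F (ε • direction x) (ε • direction y))
    (hF.comp ((hd.comp measurable_fst).prodMk (hd.comp measurable_snd)))


/-! ### Symmetric jump operators on `L²` -/

section JumpOperator

open scoped InnerProductSpace ComplexConjugate

variable {X Y : Type*} [MeasurableSpace X] [MeasurableSpace Y] {π : Measure X} {J : Measure Y}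

lemma quasiMeasurePreserving_of_map_le {φ : Y → X} {C : ℝ≥0∞} (hφ : Measurable φ)
    (h : J.map φ ≤ C • π) : Measure.QuasiMeasurePreserving φ J π :=
  ⟨hφ, Measure.absolutelyContinuous_of_le_smul h⟩

lemma memLp_comp_of_map_le {φ : Y → X} {C : ℝ≥0∞} (hφ : Measurable φ) (hC : C ≠ ∞)
    (h : J.map φ ≤ C • π) {f : X → ℂ} (hf : MemLp f 2 π) : MemLp (f ∘ φ) 2 J := by
  have h1 : MemLp f 2 (J.map φ) := hf.of_measure_le_smul hC h
  exact (memLp_map_measure_iff h1.aestronglyMeasurable hφ.aemeasurable).1 h1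

/-- Composition with `φ`, as an operator between `L²` spaces. -/
def compOp (φ : Y → X) {C : ℝ≥0∞} (hφ : Measurable φ) (hC : C ≠ ∞)
    (h : J.map φ ≤ C • π) : Lp ℂ 2 π →L[ℂ] Lp ℂ 2 J :=
  LinearMap.mkContinuous
    { toFun := fun f => (memLp_comp_of_map_le hφ hC h (Lp.memLp f)).toLp
      map_add' := fun f g => by
        rw [← MemLp.toLp_add]
        exact MemLp.toLp_congr _ _
          ((quasiMeasurePreserving_of_map_le hφ h).ae_eq_comp (Lp.coeFn_add f g))
      map_smul' := fun c f => by
        rw [RingHom.id_apply, ← MemLp.toLp_const_smul]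
        exact MemLp.toLp_congr _ _
          ((quasiMeasurePreserving_of_map_le hφ h).ae_eq_comp (Lp.coeFn_smul c f)) }
    (C ^ (1 / 2 : ℝ)).toReal
    (fun f => by
      simp only [LinearMap.coe_mk, AddHom.coe_mk, Lp.norm_toLp]
      rw [Lp.norm_def, ← ENNReal.toReal_mul]
      refine ENNReal.toReal_mono (ENNReal.mul_ne_top (by simp [hC]) (Lp.eLpNorm_ne_top f)) ?_
      have h1 : MemLp f 2 (J.map φ) := (Lp.memLp f).of_measure_le_smul hC h
      rw [← eLpNorm_map_measure h1.aestronglyMeasurable hφ.aemeasurable]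
      refine (eLpNorm_mono_measure _ h).trans ?_
      refine (eLpNorm_smul_measure_of_ne_top (by simp) f C).le.trans ?_
      simp)

lemma compOp_coeFn {φ : Y → X} {C : ℝ≥0∞} (hφ : Measurable φ) (hC : C ≠ ∞)
    (h : J.map φ ≤ C • π) (f : Lp ℂ 2 π) : compOp φ hφ hC h f =ᵐ[J] f ∘ φ :=
  (memLp_comp_of_map_le hφ hC h (Lp.memLp f)).coeFn_toLp

lemma compOp_toLp {φ : Y → X} {C : ℝ≥0∞} (hφ : Measurable φ) (hC : C ≠ ∞)
    (h : J.map φ ≤ C • π) {f : X → ℂ} (hf : MemLp f 2 π) :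
    compOp φ hφ hC h hf.toLp =ᵐ[J] f ∘ φ :=
  (compOp_coeFn hφ hC h _).trans
    ((quasiMeasurePreserving_of_map_le hφ h).ae_eq_comp hf.coeFn_toLp)

variable {a b : Y → X} {C : ℝ≥0∞}

lemma map_eq_of_map_prodMk_eq (ha : Measurable a) (hb : Measurable b)
    (hab : J.map (fun y => (a y, b y)) = J.map fun y => (b y, a y)) : J.map b = J.map a := by
  have := congrArg (Measure.map Prod.fst) hab
  rw [Measure.map_map measurable_fst (by fun_prop), Measure.map_map measurable_fst (by fun_prop)]
    at this
  exact this.symm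

lemma map_target_le (ha : Measurable a) (hb : Measurable b)
    (hab : J.map (fun y => (a y, b y)) = J.map fun y => (b y, a y)) (h : J.map a ≤ C • π) :
    J.map b ≤ C • π :=
  (map_eq_of_map_prodMk_eq ha hb hab).trans_le h

/-- Both inner products are integrals against the joint law of source and target, which is symmetric
by `hab`. -/
lemma inner_compOp_swap (ha : Measurable a) (hb : Measurable b) (hC : C ≠ ∞)
    (hab : J.map (fun y => (a y, b y)) = J.map fun y => (b y, a y)) (h : J.map a ≤ C • π)
    (h' : J.map b ≤ C • π) (f g : Lp ℂ 2 π) :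
    ⟪compOp a ha hC h g, compOp b hb hC h' f⟫_ℂ = ⟪compOp b hb hC h' g, compOp a ha hC h f⟫_ℂ := by
  rw [L2.inner_def, L2.inner_def]
  have hf := (Lp.aestronglyMeasurable f).mono_ac (quasiMeasurePreserving_of_map_le ha h).2
  have hg := (Lp.aestronglyMeasurable g).mono_ac (quasiMeasurePreserving_of_map_le ha h).2
  have hf' := (Lp.aestronglyMeasurable f).mono_ac (quasiMeasurePreserving_of_map_le hb h').2
  have hg' := (Lp.aestronglyMeasurable g).mono_ac (quasiMeasurePreserving_of_map_le hb h').2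
  have hqa := quasiMeasurePreserving_of_map_le ha h
  have hqb := quasiMeasurePreserving_of_map_le hb h'
  have meas : ∀ {c d : Y → X} (hc : Measurable c) (hd : Measurable d),
      AEStronglyMeasurable f (J.map d) → AEStronglyMeasurable g (J.map c) →
      AEStronglyMeasurable (fun p : X × X => ⟪g p.1, f p.2⟫_ℂ) (J.map fun y => (c y, d y)) := by
    intro c d hc hd h1 h2
    refine AEStronglyMeasurable.inner ?_ ?_
    · refine AEStronglyMeasurable.comp_measurable (f := fun p : X × X => p.1) ?_ measurable_fst
      rwa [Measure.map_map measurable_fst (by fun_prop)]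
    · refine AEStronglyMeasurable.comp_measurable (f := fun p : X × X => p.2) ?_ measurable_snd
      rwa [Measure.map_map measurable_snd (by fun_prop)]
  calc ∫ y, ⟪compOp a ha hC h g y, compOp b hb hC h' f y⟫_ℂ ∂J
      = ∫ y, ⟪g (a y), f (b y)⟫_ℂ ∂J := by
        refine integral_congr_ae ?_
        filter_upwards [compOp_coeFn ha hC h g, compOp_coeFn hb hC h' f] with y h1 h2
        rw [h1, h2]; rfl
    _ = ∫ p, ⟪g p.1, f p.2⟫_ℂ ∂(J.map fun y => (a y, b y)) := by
        rw [integral_map (by fun_prop) (meas ha hb hf' hg)]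
    _ = ∫ y, ⟪g (b y), f (a y)⟫_ℂ ∂J := by
        rw [hab, integral_map (by fun_prop) (meas hb ha hf hg')]
    _ = ∫ y, ⟪compOp b hb hC h' g y, compOp a ha hC h f y⟫_ℂ ∂J := by
        refine integral_congr_ae ?_
        filter_upwards [compOp_coeFn hb hC h' g, compOp_coeFn ha hC h f] with y h1 h2
        rw [h1, h2]; rfl

lemma norm_compOp_eq (ha : Measurable a) (hb : Measurable b) (hC : C ≠ ∞)
    (hab : J.map (fun y => (a y, b y)) = J.map fun y => (b y, a y)) (h : J.map a ≤ C • π)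
    (h' : J.map b ≤ C • π) (f : Lp ℂ 2 π) :
    ‖compOp b hb hC h' f‖ = ‖compOp a ha hC h f‖ := by
  have key : ∀ {c : Y → X} (hc : Measurable c) (hle : J.map c ≤ C • π),
      ‖compOp c hc hC hle f‖ = (eLpNorm f 2 (J.map c)).toReal := by
    intro c hc hle
    have h1 : MemLp f 2 (J.map c) := (Lp.memLp f).of_measure_le_smul hC hle
    rw [Lp.norm_def, eLpNorm_congr_ae (compOp_coeFn hc hC hle f),
      eLpNorm_map_measure h1.aestronglyMeasurable hc.aemeasurable]
  rw [key ha h, key hb h', map_eq_of_map_prodMk_eq ha hb hab]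

/-- The increment `f(target) - f(source)` along the jumps. -/
def gradOp (ha : Measurable a) (hb : Measurable b) (hC : C ≠ ∞) (h : J.map a ≤ C • π)
    (h' : J.map b ≤ C • π) : Lp ℂ 2 π →L[ℂ] Lp ℂ 2 J :=
  compOp b hb hC h' - compOp a ha hC h

/-- The generator of the jump process with jump measure `J`. -/
def jumpOp (ha : Measurable a) (hb : Measurable b) (hC : C ≠ ∞) (h : J.map a ≤ C • π)
    (h' : J.map b ≤ C • π) : Lp ℂ 2 π →L[ℂ] Lp ℂ 2 π :=
  (ContinuousLinearMap.adjoint (compOp a ha hC h)) ∘L gradOp ha hb hC h h'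

lemma jumpOp_inner_symm (ha : Measurable a) (hb : Measurable b) (hC : C ≠ ∞)
    (hab : J.map (fun y => (a y, b y)) = J.map fun y => (b y, a y)) (h : J.map a ≤ C • π)
    (h' : J.map b ≤ C • π) (f g : Lp ℂ 2 π) :
    ⟪jumpOp ha hb hC h h' g, f⟫_ℂ = ⟪g, jumpOp ha hb hC h h' f⟫_ℂ := by
  rw [jumpOp, ContinuousLinearMap.comp_apply, ContinuousLinearMap.comp_apply,
    ContinuousLinearMap.adjoint_inner_left, ContinuousLinearMap.adjoint_inner_right, gradOp,
    sub_apply, sub_apply, inner_sub_left, inner_sub_right,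
    inner_compOp_swap ha hb hC hab]

/-- The Dirichlet form. Source and target have the same law, so the two squared norms in the
expansion of the gradient are equal and the cross terms coincide. -/
lemma inner_jumpOp_self (ha : Measurable a) (hb : Measurable b) (hC : C ≠ ∞)
    (hab : J.map (fun y => (a y, b y)) = J.map fun y => (b y, a y)) (h : J.map a ≤ C • π)
    (h' : J.map b ≤ C • π) (f : Lp ℂ 2 π) :
    (⟪f, jumpOp ha hb hC h h' f⟫_ℂ).re = -(1 / 2) * ‖gradOp ha hb hC h h' f‖ ^ 2 := by
  have h1 : ⟪f, jumpOp ha hb hC h h' f⟫_ℂ = ⟪compOp a ha hC h f, gradOp ha hb hC h h' f⟫_ℂ := by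
    rw [jumpOp, ContinuousLinearMap.comp_apply, ContinuousLinearMap.adjoint_inner_right]
  have h2 := norm_compOp_eq ha hb hC hab h h' f
  have h3 := norm_sub_sq (𝕜 := ℂ) (compOp b hb hC h' f) (compOp a ha hC h f)
  have h4 := inner_compOp_swap ha hb hC hab h h' f f
  have h5 : (⟪compOp a ha hC h f, compOp a ha hC h f⟫_ℂ).re = ‖compOp a ha hC h f‖ ^ 2 :=
    inner_self_eq_norm_sq (𝕜 := ℂ) _
  rw [h1, gradOp, sub_apply, inner_sub_right, Complex.sub_re, h5, h4, h3, h2]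
  simp only [RCLike.re_to_complex]
  ring

lemma norm_gradOp_sq (ha : Measurable a) (hb : Measurable b) (hC : C ≠ ∞) (h : J.map a ≤ C • π)
    (h' : J.map b ≤ C • π) (f : Lp ℂ 2 π) :
    ENNReal.ofReal (‖gradOp ha hb hC h h' f‖ ^ 2) = ∫⁻ y, ‖f (b y) - f (a y)‖ₑ ^ 2 ∂J := by
  rw [ENNReal.ofReal_pow (norm_nonneg _), ofReal_norm, Lp.enorm_def]
  have hp := eLpNorm_nnreal_pow_eq_lintegral (μ := J) (f := gradOp ha hb hC h h' f) (p := 2)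
    (by norm_num)
  simp only [NNReal.coe_ofNat, ENNReal.coe_ofNat, ENNReal.rpow_ofNat] at hp
  rw [hp]
  refine lintegral_congr_ae ?_
  have h0 := Lp.coeFn_sub (compOp b hb hC h' f) (compOp a ha hC h f)
  filter_upwards [h0, compOp_coeFn hb hC h' f, compOp_coeFn ha hC h f] with y h1 h2 h3
  rw [gradOp, sub_apply, h1, Pi.sub_apply, h2, h3]
  rfl

end JumpOperator


/-! ### Jump measures of the bonds -/

/-- A bounded measurable density of jump rates. -/
structure IsBoundedRate {n : ℕ} (k : Config n → ℝ → ℝ) (M : ℝ) : Prop where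
  measurable : Measurable (Function.uncurry k)
  nonneg : ∀ x α, 0 ≤ k x α
  le : ∀ x α, k x α ≤ M

/-- The measure `π(dx) k(x, α) dα`. -/
def jumpMeasure {n : ℕ} (k : Config n → ℝ → ℝ) (π : Measure (Config n)) :
    Measure (Config n × ℝ) :=
  (π.prod unitVol).withDensity fun p => ENNReal.ofReal (k p.1 p.2)

/-- The configuration after a jump across bond `i`. -/
def target {n : ℕ} (i : Fin n) (p : Config n × ℝ) : Config n := exchange i p.2 p.1

lemma measurable_target {n : ℕ} (i : Fin n) : Measurable (target i) := measurable_exchange i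

section

variable {n : ℕ} {i : Fin n} {k : Config n → ℝ → ℝ} {M : ℝ} {π : Measure (Config n)}

lemma IsBoundedRate.measurable_ofReal (hk : IsBoundedRate k M) :
    Measurable fun p : Config n × ℝ => ENNReal.ofReal (k p.1 p.2) :=
  hk.measurable.ennreal_ofReal

lemma lintegral_jumpMeasure (hk : IsBoundedRate k M) {G : Config n × ℝ → ℝ≥0∞}
    (hG : Measurable G) : ∫⁻ p, G p ∂(jumpMeasure k π) =
      ∫⁻ x, ∫⁻ α, ENNReal.ofReal (k x α) * G (x, α) ∂unitVol ∂π := by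
  rw [jumpMeasure, lintegral_withDensity_eq_lintegral_mul _ hk.measurable_ofReal hG,
    lintegral_prod _ (hk.measurable_ofReal.mul hG).aemeasurable]
  rfl

/-- The jump measure ignores places where the rate vanishes, whence the proviso on `k x α`. -/
lemma ae_jumpMeasure (hk : IsBoundedRate k M) {p : Config n × ℝ → Prop}
    (h : ∀ᵐ q ∂(jumpMeasure k π), p q) : ∀ᵐ x ∂π, ∀ᵐ α ∂unitVol, k x α ≠ 0 → p (x, α) := by
  rw [jumpMeasure, ae_withDensity_iff hk.measurable_ofReal] at h
  filter_upwards [Measure.ae_ae_of_ae_prod h] with x hx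
  filter_upwards [hx] with α hα hne
  refine hα ?_
  simpa using lt_of_le_of_ne (hk.nonneg x α) (Ne.symm hne)

lemma map_fst_jumpMeasure_le (hk : IsBoundedRate k M) :
    (jumpMeasure k π).map Prod.fst ≤ ENNReal.ofReal M • π := by
  refine Measure.le_iff.2 fun S hS => ?_
  rw [← lintegral_indicator_one hS, lintegral_map (measurable_one.indicator hS) measurable_fst,
    lintegral_jumpMeasure (G := fun p => S.indicator 1 p.1) hk
      ((measurable_one.indicator hS).comp measurable_fst)]
  calc _ ≤ ∫⁻ x, ENNReal.ofReal M * S.indicator 1 x ∂π := by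
        refine lintegral_mono fun x => ?_
        calc _ ≤ ∫⁻ _, ENNReal.ofReal M * S.indicator 1 x ∂unitVol := by
              refine lintegral_mono fun α => ?_
              exact mul_le_mul_left (ENNReal.ofReal_le_ofReal (hk.le x α)) _
          _ = _ := by simp
    _ = _ := by
        rw [lintegral_const_mul _ (measurable_one.indicator hS), lintegral_indicator_one hS]; rfl

lemma map_jumpMeasure_swap (hk : IsBoundedRate k M) (hs : IsSymmetricOn i k π) :
    (jumpMeasure k π).map (fun p => (p.1, target i p)) =
      (jumpMeasure k π).map fun p => (target i p, p.1) := by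
  have ht := measurable_target i
  refine Measure.ext_of_lintegral _ fun F hF => ?_
  rw [lintegral_map hF (by fun_prop), lintegral_map hF (by fun_prop),
    lintegral_jumpMeasure hk (by fun_prop), lintegral_jumpMeasure hk (by fun_prop)]
  exact hs (fun x y => F (x, y)) hF

lemma map_target_jumpMeasure_le (hk : IsBoundedRate k M) (hs : IsSymmetricOn i k π) :
    (jumpMeasure k π).map (target i) ≤ ENNReal.ofReal M • π :=
  map_target_le measurable_fst (measurable_target i) (map_jumpMeasure_swap hk hs)
    (map_fst_jumpMeasure_le hk)

/-- The jump operator of bond `i` on `L²(π)`. -/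
def bondOp (hk : IsBoundedRate k M) (hs : IsSymmetricOn i k π) : Lp ℂ 2 π →L[ℂ] Lp ℂ 2 π :=
  jumpOp (J := jumpMeasure k π) measurable_fst (measurable_target i) ENNReal.ofReal_ne_top
    (map_fst_jumpMeasure_le hk) (map_target_jumpMeasure_le hk hs)

/-- The gradient along the jumps across bond `i`. -/
def bondGrad (hk : IsBoundedRate k M) (hs : IsSymmetricOn i k π) :
    Lp ℂ 2 π →L[ℂ] Lp ℂ 2 (jumpMeasure k π) :=
  gradOp (J := jumpMeasure k π) measurable_fst (measurable_target i) ENNReal.ofReal_ne_top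
    (map_fst_jumpMeasure_le hk) (map_target_jumpMeasure_le hk hs)

open scoped InnerProductSpace in
lemma bondOp_inner_symm (hk : IsBoundedRate k M) (hs : IsSymmetricOn i k π) (f g : Lp ℂ 2 π) :
    ⟪bondOp hk hs g, f⟫_ℂ = ⟪g, bondOp hk hs f⟫_ℂ :=
  jumpOp_inner_symm _ _ _ (map_jumpMeasure_swap hk hs) _ _ f g

open scoped InnerProductSpace in
lemma inner_bondOp_self (hk : IsBoundedRate k M) (hs : IsSymmetricOn i k π) (f : Lp ℂ 2 π) :
    (⟪f, bondOp hk hs f⟫_ℂ).re = -(1 / 2) * ‖bondGrad hk hs f‖ ^ 2 :=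
  inner_jumpOp_self _ _ _ (map_jumpMeasure_swap hk hs) _ _ f

lemma norm_bondGrad_sq (hk : IsBoundedRate k M) (hs : IsSymmetricOn i k π) (f : Lp ℂ 2 π) :
    ENNReal.ofReal (‖bondGrad hk hs f‖ ^ 2) =
      ∫⁻ p, ‖f (target i p) - f p.1‖ₑ ^ 2 ∂(jumpMeasure k π) :=
  norm_gradOp_sq _ _ _ _ _ f

variable [IsFiniteMeasure π]

lemma isFiniteMeasure_jumpMeasure (hk : IsBoundedRate k M) :
    IsFiniteMeasure (jumpMeasure k π) := by
  refine ⟨?_⟩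
  have h := map_fst_jumpMeasure_le hk (π := π) univ
  rw [Measure.map_apply measurable_fst MeasurableSet.univ, preimage_univ] at h
  refine h.trans_lt ?_
  exact ENNReal.mul_lt_top ENNReal.ofReal_lt_top (measure_lt_top π univ)

lemma integral_jumpMeasure {E : Type*} [NormedAddCommGroup E] [NormedSpace ℝ E]
    (hk : IsBoundedRate k M) {h : Config n × ℝ → E} (hh : Integrable h (jumpMeasure k π)) :
    Integrable (fun x => ∫ α, k x α • h (x, α) ∂unitVol) π ∧
    ∫ p, h p ∂(jumpMeasure k π) = ∫ x, ∫ α, k x α • h (x, α) ∂unitVol ∂π := by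
  have e : ∀ p : Config n × ℝ, (ENNReal.ofReal (k p.1 p.2)).toReal • h p = k p.1 p.2 • h p :=
    fun p => by rw [ENNReal.toReal_ofReal (hk.nonneg _ _)]
  have h1 : Integrable (fun p : Config n × ℝ => k p.1 p.2 • h p) (π.prod unitVol) := by
    rw [jumpMeasure, integrable_withDensity_iff_integrable_smul' hk.measurable_ofReal
      (Filter.Eventually.of_forall fun _ => ENNReal.ofReal_lt_top)] at hh
    simpa only [e] using hh
  refine ⟨h1.integral_prod_left, ?_⟩
  rw [jumpMeasure, integral_withDensity_eq_integral_toReal_smul hk.measurable_ofReal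
      (Filter.Eventually.of_forall fun _ => ENNReal.ofReal_lt_top)]
  simp only [e]
  exact integral_prod _ h1

-- Identifies the abstract operator with the pointwise formula: the adjoint of composition with the
-- first projection is integration over α against the rate, as is seen by pairing with indicator
-- functions.
open scoped InnerProductSpace in
lemma bondOp_toLp (hk : IsBoundedRate k M) (hs : IsSymmetricOn i k π) {A : Config n → ℂ}
    (hA : MemLp A 2 π) :
    bondOp hk hs hA.toLp =ᵐ[π] fun x => ∫ α, k x α • (A (exchange i α x) - A x) ∂unitVol := by
  have := isFiniteMeasure_jumpMeasure (π := π) hk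
  set J := jumpMeasure k π with hJ
  have hle := map_fst_jumpMeasure_le (π := π) hk
  have hle' := map_target_jumpMeasure_le hk hs
  set u := bondGrad hk hs hA.toLp with hu
  have hu_ae : u =ᵐ[J] fun p => A (target i p) - A p.1 := by
    have h0 := Lp.coeFn_sub (compOp (J := J) (target i) (measurable_target i)
      ENNReal.ofReal_ne_top hle' hA.toLp) (compOp Prod.fst measurable_fst
      ENNReal.ofReal_ne_top hle hA.toLp)
    filter_upwards [h0, compOp_toLp measurable_fst ENNReal.ofReal_ne_top hle hA,
      compOp_toLp (measurable_target i) ENNReal.ofReal_ne_top hle' hA] with y h1 h2 h3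
    rw [hu, bondGrad, gradOp, sub_apply, h1, Pi.sub_apply, h2, h3]
    rfl
  have hu_int : Integrable u J := (Lp.memLp u).integrable (by norm_num)
  obtain ⟨hint, -⟩ := integral_jumpMeasure hk hu_int
  have e1 : (fun x => ∫ α, k x α • u (x, α) ∂unitVol) =ᵐ[π]
      fun x => ∫ α, k x α • (A (exchange i α x) - A x) ∂unitVol := by
    filter_upwards [ae_jumpMeasure hk hu_ae] with x hx
    refine integral_congr_ae ?_
    filter_upwards [hx] with α hα
    by_cases h0 : k x α = 0
    · simp [h0]
    · rw [hα h0]; rfl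
  refine Filter.EventuallyEq.trans ?_ e1
  refine Integrable.ae_eq_of_forall_setIntegral_eq _ _
    ((Lp.memLp _).integrable (by norm_num)) hint fun S hS _ => ?_
  have h2 : ∫ x in S, bondOp hk hs hA.toLp x ∂π =
      ⟪indicatorConstLp 2 hS (measure_ne_top π S) (1 : ℂ), bondOp hk hs hA.toLp⟫_ℂ := by
    rw [L2.inner_indicatorConstLp_one]
  rw [h2, bondOp, jumpOp, ContinuousLinearMap.comp_apply,
    ContinuousLinearMap.adjoint_inner_right, L2.inner_def]
  have h3 : compOp (J := J) Prod.fst measurable_fst ENNReal.ofReal_ne_top hle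
      (indicatorConstLp 2 hS (measure_ne_top π S) (1 : ℂ)) =ᵐ[J]
      (S.indicator fun _ => (1 : ℂ)) ∘ Prod.fst :=
    (compOp_coeFn measurable_fst ENNReal.ofReal_ne_top hle _).trans
      ((quasiMeasurePreserving_of_map_le measurable_fst hle).ae_eq_comp indicatorConstLp_coeFn)
  have h4 : ∫ p, ⟪compOp (J := J) Prod.fst measurable_fst ENNReal.ofReal_ne_top hle
      (indicatorConstLp 2 hS (measure_ne_top π S) (1 : ℂ)) p, u p⟫_ℂ ∂J =
      ∫ p, (Prod.fst ⁻¹' S).indicator u p ∂J := by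
    refine integral_congr_ae ?_
    filter_upwards [h3] with p hp
    rw [hp]
    by_cases h : p.1 ∈ S
    · simp [h, indicator]
    · simp [h, indicator]
  refine h4.trans ?_
  rw [(integral_jumpMeasure hk (hu_int.indicator (measurable_fst hS))).2,
    ← integral_indicator hS]
  refine integral_congr_ae (Filter.Eventually.of_forall fun x => ?_)
  by_cases h : x ∈ S
  · simp [h, indicator]
  · simp [h, indicator]

/-- Source and target have the same law under the jump measure, so the integral of the increment of
A vanishes. -/
lemma integral_jump_eq_zero (hk : IsBoundedRate k M) (hs : IsSymmetricOn i k π)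
    {A : Config n → ℝ} (hA : Measurable A) {B : ℝ} (hB : ∀ x, |A x| ≤ B) :
    Integrable (fun x => ∫ α, k x α • (A (exchange i α x) - A x) ∂unitVol) π ∧
    ∫ x, ∫ α, k x α • (A (exchange i α x) - A x) ∂unitVol ∂π = 0 := by
  have := isFiniteMeasure_jumpMeasure (π := π) hk
  have ht := measurable_target i
  have hi1 : Integrable (fun p => A (target i p)) (jumpMeasure k π) :=
    Integrable.of_bound (hA.comp ht).aestronglyMeasurable B (Filter.Eventually.of_forall fun p => hB _)
  have hi2 : Integrable (fun p : Config n × ℝ => A p.1) (jumpMeasure k π) :=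
    Integrable.of_bound (hA.comp measurable_fst).aestronglyMeasurable B
      (Filter.Eventually.of_forall fun p => hB _)
  have h := integral_jumpMeasure hk (hi1.sub hi2)
  refine ⟨h.1, h.2.symm.trans ?_⟩
  have h5 := map_eq_of_map_prodMk_eq measurable_fst ht (map_jumpMeasure_swap hk hs)
  simp only [Pi.sub_apply]
  rw [integral_sub hi1 hi2, sub_eq_zero,
    ← integral_map ht.aemeasurable (f := A) hA.aestronglyMeasurable, h5,
    integral_map measurable_fst.aemeasurable hA.aestronglyMeasurable]

end


/-! ### Contraction of the heat bath dynamics -/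

/-- The total energy of the first `m` sites. -/
def cumEnergy {n : ℕ} (x : Config n) (m : ℕ) : ℝ := ∑ j : Fin (n + 1), if j.val < m then x j else 0

lemma cumEnergy_zero {n : ℕ} (x : Config n) : cumEnergy x 0 = 0 := by simp [cumEnergy]

lemma cumEnergy_last {n : ℕ} (x : Config n) : cumEnergy x (n + 1) = ∑ j, x j := by
  simp only [cumEnergy, Fin.is_lt, if_true]

lemma cumEnergy_succ {n : ℕ} (x : Config n) (j : Fin (n + 1)) :
    cumEnergy x (j.val + 1) = cumEnergy x j.val + x j := by
  have : ∀ l : Fin (n + 1), (if l.val < j.val + 1 then x l else 0) =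
      (if l.val < j.val then x l else 0) + if l = j then x l else 0 := by
    intro l
    rcases lt_trichotomy l j with h | h | h
    · simp [h, Nat.lt_succ_of_lt h, h.ne]
    · simp [h]
    · have h1 : ¬ l.val < j.val + 1 := by have : j.val < l.val := h; omega
      have h2 : ¬ l.val < j.val := by have : j.val < l.val := h; omega
      simp [h1, h.ne', not_lt.2 h.le]
  simp only [cumEnergy, this, Finset.sum_add_distrib]
  simp

lemma cumEnergy_sub {n : ℕ} (x y : Config n) (m : ℕ) :
    cumEnergy (x - y) m = cumEnergy x m - cumEnergy y m := by
  simp only [cumEnergy, ← Finset.sum_sub_distrib]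
  refine Finset.sum_congr rfl fun j _ => ?_
  split_ifs <;> simp

lemma cumEnergy_exchange_of_ne {n : ℕ} (i : Fin n) (α : ℝ) (x : Config n) {m : ℕ}
    (hm : m ≠ i.val + 1) : cumEnergy (exchange i α x) m = cumEnergy x m := by
  have : ∀ j : Fin (n + 1), (if j.val < m then exchange i α x j else 0) =
      (if j.val < m then x j else 0) + (α * x i.succ - (1 - α) * x i.castSucc) *
        ((if j = i.castSucc then (if i.val < m then 1 else 0) else 0) -
          (if j = i.succ then (if i.val < m then 1 else 0) else 0)) := by
    intro j
    have hiff : i.val + 1 < m ↔ i.val < m := by omega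
    by_cases h₂ : j = i.succ
    · subst h₂
      by_cases h : i.val < m
      · simp only [Fin.val_succ, hiff, h, if_true, exchange_succ, bondEnergy,
          (castSucc_ne_succ i).symm, if_false]; ring
      · simp [Fin.val_succ, hiff, h]
    · by_cases h₁ : j = i.castSucc
      · subst h₁
        by_cases h : i.val < m
        · simp only [Fin.val_castSucc, h, if_true, exchange_castSucc, bondEnergy,
            castSucc_ne_succ i, if_false]; ring
        · simp [h]
      · simp [exchange_of_ne, h₁, h₂]
  simp only [cumEnergy, this, Finset.sum_add_distrib, ← Finset.mul_sum, Finset.sum_sub_distrib]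
  simp

/-- Together with `cumEnergy_exchange_of_ne`: in terms of partial sums an exchange moves a single
coordinate, to a convex combination of its two neighbours. The contraction estimate is based on
this. -/
lemma cumEnergy_exchange {n : ℕ} (i : Fin n) (α : ℝ) (x : Config n) :
    cumEnergy (exchange i α x) (i.val + 1) =
      (1 - α) * cumEnergy x i.val + α * cumEnergy x (i.val + 2) := by
  have h1 := cumEnergy_succ (exchange i α x) i.castSucc
  have h2 := cumEnergy_succ x i.castSucc
  have h3 := cumEnergy_succ x i.succ
  simp only [Fin.val_castSucc, Fin.val_succ] at h1 h2 h3
  rw [h1, h3, h2, cumEnergy_exchange_of_ne _ _ _ (by omega), exchange_castSucc, bondEnergy]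
  ring

/-- The weights of the contracting distance. -/
def sineWeight (n m : ℕ) : ℝ := Real.sin (Real.pi * m / (n + 1))

lemma sineWeight_zero (n : ℕ) : sineWeight n 0 = 0 := by simp [sineWeight]

lemma sineWeight_last (n : ℕ) : sineWeight n (n + 1) = 0 := by
  have : ((n : ℝ) + 1) ≠ 0 := by positivity
  simp [sineWeight, this]

lemma sineWeight_pos {n m : ℕ} (hm : m < n) : 0 < sineWeight n (m + 1) := by
  have hm' : (m : ℝ) + 1 < n + 1 := by exact_mod_cast Nat.succ_lt_succ hm
  refine Real.sin_pos_of_pos_of_lt_pi (by push_cast; positivity) ?_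
  rw [div_lt_iff₀ (by positivity)]
  push_cast
  exact mul_lt_mul_of_pos_left hm' Real.pi_pos

lemma sineWeight_nonneg {n m : ℕ} (hm : m < n) : 0 ≤ sineWeight n (m + 1) := (sineWeight_pos hm).le

/-- The weights are an eigenvector of the neighbour sum on {1, …, n} with zeros at 0 and n+1;
positivity in between makes them admissible as weights of a distance. -/
lemma sineWeight_add (n m : ℕ) : sineWeight n (m + 2) + sineWeight n m =
    2 * Real.cos (Real.pi / (n + 1)) * sineWeight n (m + 1) := by
  have h1 : Real.pi * ((m + 2 : ℕ) : ℝ) / (n + 1) =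
      Real.pi * ((m + 1 : ℕ) : ℝ) / (n + 1) + Real.pi / (n + 1) := by push_cast; ring
  have h2 : Real.pi * (m : ℝ) / (n + 1) =
      Real.pi * ((m + 1 : ℕ) : ℝ) / (n + 1) - Real.pi / (n + 1) := by push_cast; ring
  rw [sineWeight, sineWeight, sineWeight, h1, h2, Real.sin_add, Real.sin_sub]
  ring

/-- The contracting distance from zero. -/
def sineNorm {n : ℕ} (h : Config n) : ℝ :=
  ∑ m ∈ Finset.range n, sineWeight n (m + 1) * |cumEnergy h (m + 1)|

lemma sineNorm_nonneg {n : ℕ} (h : Config n) : 0 ≤ sineNorm h :=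
  Finset.sum_nonneg fun _ hm =>
    mul_nonneg (sineWeight_nonneg (Finset.mem_range.1 hm)) (abs_nonneg _)

/-- Summation by parts moves the neighbour sum onto the weights. The boundary terms vanish because
both the weights and the sequence are zero at 0 and n+1. -/
lemma sum_sineWeight_neighbours {n : ℕ} {a : ℕ → ℝ} (h0 : a 0 = 0) (hn : a (n + 1) = 0) :
    ∑ m ∈ Finset.range n, sineWeight n (m + 1) * (a m + a (m + 2)) =
      2 * Real.cos (Real.pi / (n + 1)) *
        ∑ m ∈ Finset.range n, sineWeight n (m + 1) * a (m + 1) := by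
  have h1 : ∑ m ∈ Finset.range n, sineWeight n (m + 1) * a m =
      ∑ m ∈ Finset.range n, sineWeight n (m + 2) * a (m + 1) := by
    have e1 := Finset.sum_range_succ (fun m => sineWeight n (m + 1) * a m) n
    have e2 := Finset.sum_range_succ' (fun m => sineWeight n (m + 1) * a m) n
    simp only [sineWeight_last, h0, zero_mul, mul_zero, add_zero] at e1 e2
    rw [← e1, e2]
  have h2 : ∑ m ∈ Finset.range n, sineWeight n (m + 1) * a (m + 2) =
      ∑ m ∈ Finset.range n, sineWeight n m * a (m + 1) := by
    have e1 := Finset.sum_range_succ (fun m => sineWeight n m * a (m + 1)) n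
    have e2 := Finset.sum_range_succ' (fun m => sineWeight n m * a (m + 1)) n
    simp only [sineWeight_zero, hn, zero_mul, mul_zero, add_zero] at e1 e2
    rw [← e1, e2]
  simp only [mul_add, Finset.sum_add_distrib]
  rw [h1, h2, ← Finset.sum_add_distrib, Finset.mul_sum]
  refine Finset.sum_congr rfl fun m _ => ?_
  rw [← mul_assoc, ← sineWeight_add]; ring

lemma sineNorm_exchange_le {n : ℕ} (i : Fin n) {α : ℝ} (hα : α ∈ Icc (0 : ℝ) 1) (h : Config n) :
    sineNorm (exchange i α h) ≤ sineNorm h + sineWeight n (i.val + 1) *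
      ((1 - α) * |cumEnergy h i.val| + α * |cumEnergy h (i.val + 2)| -
        |cumEnergy h (i.val + 1)|) := by
  have hi : i.val ∈ Finset.range n := Finset.mem_range.2 i.2
  rw [sineNorm, sineNorm, ← Finset.add_sum_erase _ _ hi, ← Finset.add_sum_erase _ _ hi]
  have h1 : ∑ m ∈ (Finset.range n).erase i.val,
      sineWeight n (m + 1) * |cumEnergy (exchange i α h) (m + 1)| =
      ∑ m ∈ (Finset.range n).erase i.val, sineWeight n (m + 1) * |cumEnergy h (m + 1)| := by
    refine Finset.sum_congr rfl fun m hm => ?_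
    rw [cumEnergy_exchange_of_ne]
    have := Finset.ne_of_mem_erase hm
    omega
  rw [h1, cumEnergy_exchange]
  have h2 : |(1 - α) * cumEnergy h i.val + α * cumEnergy h (i.val + 2)| ≤
      (1 - α) * |cumEnergy h i.val| + α * |cumEnergy h (i.val + 2)| := by
    refine (abs_add_le _ _).trans (le_of_eq ?_)
    rw [abs_mul, abs_mul, abs_of_nonneg (sub_nonneg.2 hα.2), abs_of_nonneg hα.1]
  have h3 := mul_le_mul_of_nonneg_left h2 (sineWeight_nonneg i.2)
  linarith

/-- The density of the law of the new energy ratio in the heat bath dynamics. -/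
def heatDensity (α : ℝ) : ℝ := ratioWeight α / weightMass

lemma heatDensity_nonneg (α : ℝ) : 0 ≤ heatDensity α :=
  div_nonneg (ratioWeight_nonneg α) weightMass_pos.le

lemma heatDensity_le (α : ℝ) : heatDensity α ≤ 1 / weightMass :=
  div_le_div_of_nonneg_right (ratioWeight_le_one α) weightMass_pos.le

@[fun_prop]
lemma continuous_heatDensity : Continuous heatDensity := by unfold heatDensity; fun_prop

lemma integral_heatDensity : ∫ α, heatDensity α ∂unitVol = 1 := by
  simp only [heatDensity]
  rw [integral_div, ← weightMass, div_self weightMass_pos.ne']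

lemma integrable_mul_heatDensity {g : ℝ → ℝ} (hg : Continuous g) :
    Integrable (fun α => heatDensity α * g α) unitVol := by
  have : Continuous fun α => heatDensity α * g α := by fun_prop
  exact this.integrableOn_Icc

lemma integral_unitVol_symm (g : ℝ → ℝ) : ∫ α, g (1 - α) ∂unitVol = ∫ α, g α ∂unitVol := by
  rw [unitVol, integral_Icc_eq_integral_Ioc, integral_Icc_eq_integral_Ioc,
    ← intervalIntegral.integral_of_le zero_le_one, ← intervalIntegral.integral_of_le zero_le_one,
    intervalIntegral.integral_comp_sub_left (fun α => g α)]
  simp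

lemma heatDensity_symm (α : ℝ) : heatDensity (1 - α) = heatDensity α := by
  rw [heatDensity, heatDensity, ratioWeight, ratioWeight]; congr 2; ring

/-- Only the symmetry of the density under α ↦ 1-α is used. This mean makes the two neighbouring
partial sums enter with equal weight. -/
lemma integral_heatDensity_mul_id : ∫ α, heatDensity α * α ∂unitVol = 1 / 2 := by
  have h := integral_unitVol_symm fun α => heatDensity α * α
  simp only [heatDensity_symm, mul_sub, mul_one] at h
  rw [integral_sub (by simpa using integrable_mul_heatDensity continuous_const (g := fun _ => 1))
    (integrable_mul_heatDensity (g := fun α => α) continuous_id), integral_heatDensity] at h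
  linarith

lemma integral_sineNorm_exchange_le {n : ℕ} (i : Fin n) (h : Config n) :
    ∫ α, heatDensity α * sineNorm (exchange i α h) ∂unitVol ≤
      sineNorm h + sineWeight n (i.val + 1) * ((|cumEnergy h i.val| + |cumEnergy h (i.val + 2)|) / 2 -
        |cumEnergy h (i.val + 1)|) := by
  have hc : Continuous fun α => sineNorm (exchange i α h) := by
    have : Continuous fun α : ℝ => exchange i α h :=
      (continuous_exchange i).comp (Continuous.prodMk continuous_const continuous_id)
    unfold sineNorm cumEnergy
    refine continuous_finsetSum _ fun m _ => continuous_const.mul (continuous_abs.comp ?_)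
    refine continuous_finsetSum _ fun j _ => ?_
    split_ifs
    · exact (continuous_apply j).comp this
    · exact continuous_const
  set a := |cumEnergy h i.val|
  set b := |cumEnergy h (i.val + 2)|
  set c := |cumEnergy h (i.val + 1)|
  set w := sineWeight n (i.val + 1)
  calc ∫ α, heatDensity α * sineNorm (exchange i α h) ∂unitVol
      ≤ ∫ α, heatDensity α * (sineNorm h + w * ((1 - α) * a + α * b - c)) ∂unitVol := by
        refine integral_mono_ae (integrable_mul_heatDensity hc)
          (integrable_mul_heatDensity (by fun_prop)) ?_
        filter_upwards [ae_unitVol] with α hα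
        exact mul_le_mul_of_nonneg_left (sineNorm_exchange_le i (Ioo_subset_Icc_self hα) h)
          (heatDensity_nonneg α)
    _ = ∫ α, ((sineNorm h + w * (a - c)) * heatDensity α + (w * (b - a)) * (heatDensity α * α))
          ∂unitVol := by
        refine integral_congr_ae (Filter.Eventually.of_forall fun α => ?_)
        simp only; ring
    _ = _ := by
        rw [integral_add, integral_const_mul, integral_const_mul, integral_heatDensity,
          integral_heatDensity_mul_id]
        · ring
        · refine Integrable.const_mul ?_ _
          simpa using integrable_mul_heatDensity continuous_const (g := fun _ => 1)
        · exact (integrable_mul_heatDensity continuous_id).const_mul _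

/-- Each bond contributes half the sum of the neighbouring |partial sums| minus the middle one;
summing against the eigenvector gives -(1 - cos(π/(n+1))). Zero total energy makes the last partial
sum vanish. -/
lemma sum_integral_sineNorm_exchange_le {n : ℕ} {h : Config n} (h0 : ∑ j, h j = 0) :
    ∑ i : Fin n, ∫ α, heatDensity α * sineNorm (exchange i α h) ∂unitVol ≤
      (n - (1 - Real.cos (Real.pi / (n + 1)))) * sineNorm h := by
  refine (Finset.sum_le_sum fun i _ => integral_sineNorm_exchange_le i h).trans (le_of_eq ?_)
  have key := sum_sineWeight_neighbours (n := n) (a := fun m => |cumEnergy h m|)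
    (by simp [cumEnergy_zero]) (by simp [cumEnergy_last, h0])
  rw [Finset.sum_add_distrib, Fin.sum_univ_eq_sum_range (fun m => sineWeight n (m + 1) *
    ((|cumEnergy h m| + |cumEnergy h (m + 2)|) / 2 - |cumEnergy h (m + 1)|))]
  have e : ∑ m ∈ Finset.range n, sineWeight n (m + 1) *
      ((|cumEnergy h m| + |cumEnergy h (m + 2)|) / 2 - |cumEnergy h (m + 1)|) =
      (1 / 2) * ∑ m ∈ Finset.range n, sineWeight n (m + 1) *
        (|cumEnergy h m| + |cumEnergy h (m + 2)|) - sineNorm h := by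
    rw [sineNorm, Finset.mul_sum, ← Finset.sum_sub_distrib]
    refine Finset.sum_congr rfl fun m _ => ?_
    ring
  rw [e, key, ← sineNorm]
  simp
  ring

/-- Site energies are differences of consecutive partial sums and every interior weight is positive.
Hence ordinary Lipschitz functions are Lipschitz for the contracting distance on a simplex. -/
lemma norm_le_sineNorm {n : ℕ} : ∃ R : ℝ, 0 ≤ R ∧ ∀ h : Config n, ∑ j, h j = 0 →
    ‖h‖ ≤ R * sineNorm h := by
  set R := ∑ m ∈ Finset.range n, 1 / sineWeight n (m + 1) with hR
  have hR0 : 0 ≤ R := Finset.sum_nonneg fun m hm =>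
    div_nonneg zero_le_one (sineWeight_nonneg (Finset.mem_range.1 hm))
  refine ⟨2 * R, by positivity, fun h h0 => ?_⟩
  have hS := sineNorm_nonneg h
  have key : ∀ m ≤ n + 1, |cumEnergy h m| ≤ R * sineNorm h := by
    intro m hm
    rcases Nat.eq_zero_or_pos m with rfl | hpos
    · rw [cumEnergy_zero, abs_zero]; positivity
    · rcases hm.eq_or_lt with rfl | hlt
      · rw [cumEnergy_last, h0, abs_zero]; positivity
      · obtain ⟨l, rfl⟩ : ∃ l, m = l + 1 := ⟨m - 1, by omega⟩
        have hl : l < n := by omega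
        have h1 : sineWeight n (l + 1) * |cumEnergy h (l + 1)| ≤ sineNorm h :=
          Finset.single_le_sum (f := fun m => sineWeight n (m + 1) * |cumEnergy h (m + 1)|)
            (fun m hm => mul_nonneg (sineWeight_nonneg (Finset.mem_range.1 hm)) (abs_nonneg _))
            (Finset.mem_range.2 hl)
        have h2 : 1 / sineWeight n (l + 1) ≤ R :=
          Finset.single_le_sum (f := fun m => 1 / sineWeight n (m + 1))
            (fun m hm => div_nonneg zero_le_one (sineWeight_nonneg (Finset.mem_range.1 hm)))
            (Finset.mem_range.2 hl)
        calc |cumEnergy h (l + 1)|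
            = 1 / sineWeight n (l + 1) * (sineWeight n (l + 1) * |cumEnergy h (l + 1)|) := by
              have := (sineWeight_pos hl).ne'
              field_simp
          _ ≤ R * sineNorm h := mul_le_mul h2 h1
              (mul_nonneg (sineWeight_nonneg hl) (abs_nonneg _)) hR0
  refine (pi_norm_le_iff_of_nonneg (by positivity)).2 fun j => ?_
  have h1 := cumEnergy_succ h j
  have h2 := key j.val (by omega)
  have h3 := key (j.val + 1) (by omega)
  have : h j = cumEnergy h (j.val + 1) - cumEnergy h j.val := by linarith
  rw [this, Real.norm_eq_abs]
  refine (abs_sub _ _).trans ?_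
  linarith

lemma exchange_sub {n : ℕ} (i : Fin n) (α : ℝ) (x y : Config n) :
    exchange i α x - exchange i α y = exchange i α (x - y) := by
  ext j
  simp only [exchange, Pi.add_apply, Pi.smul_apply, Pi.sub_apply, smul_eq_mul]; ring

lemma sum_eq_of_mem_simplex {n : ℕ} {ε : ℝ} {x : Config n} (hx : x ∈ simplex n ε) :
    ∑ j, x j = (n + 1) * ε := by
  have := hx.2
  rw [meanEnergy_eq] at this
  rw [← this]
  field_simp

lemma sum_sub_eq_zero {n : ℕ} {ε : ℝ} {x y : Config n} (hx : x ∈ simplex n ε)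
    (hy : y ∈ simplex n ε) : ∑ j, (x - y) j = 0 := by
  simp only [Pi.sub_apply, Finset.sum_sub_distrib, sum_eq_of_mem_simplex hx,
    sum_eq_of_mem_simplex hy, sub_self]

lemma cumEnergy_mem {n : ℕ} {ε : ℝ} {x : Config n} (hx : x ∈ simplex n ε) (m : ℕ) :
    cumEnergy x m ∈ Icc 0 ((n + 1) * ε) := by
  refine ⟨Finset.sum_nonneg fun j _ => ?_, ?_⟩
  · split_ifs
    · exact hx.1 j
    · exact le_rfl
  · rw [← sum_eq_of_mem_simplex hx]
    refine Finset.sum_le_sum fun j _ => ?_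
    split_ifs
    · exact le_rfl
    · exact hx.1 j

lemma sineNorm_sub_le {n : ℕ} {ε : ℝ} {x y : Config n} (hx : x ∈ simplex n ε)
    (hy : y ∈ simplex n ε) : sineNorm (x - y) ≤ n * ((n + 1) * ε) := by
  have : ∀ m ∈ Finset.range n, sineWeight n (m + 1) * |cumEnergy (x - y) (m + 1)| ≤
      (n + 1) * ε := by
    intro m hm
    have h1 := cumEnergy_mem hx (m + 1)
    have h2 := cumEnergy_mem hy (m + 1)
    have h3 : |cumEnergy (x - y) (m + 1)| ≤ (n + 1) * ε := by
      rw [cumEnergy_sub, abs_le]; constructor <;> linarith [h1.1, h1.2, h2.1, h2.2]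
    calc _ ≤ 1 * |cumEnergy (x - y) (m + 1)| :=
          mul_le_mul_of_nonneg_right (Real.sin_le_one _) (abs_nonneg _)
      _ ≤ _ := by rw [one_mul]; exact h3
  refine (Finset.sum_le_sum this).trans (le_of_eq ?_)
  simp


/-! ### The spectral gap of the heat bath dynamics -/

/-! ### A growth criterion for symmetric operators -/

section HilbertSpace

open scoped InnerProductSpace

/-- By symmetry and Cauchy–Schwarz the sequence of norms ‖Q^j f‖ is log-convex, so its successive
ratios never fall below the first one, ‖Qf‖/‖f‖. The constant c may depend on f; only the
exponential rate survives. -/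
lemma norm_le_of_norm_pow_le {H : Type*} [NormedAddCommGroup H] [InnerProductSpace ℂ H]
    {Q : H →L[ℂ] H} (hQ : ∀ f g, ⟪Q g, f⟫_ℂ = ⟪g, Q f⟫_ℂ) {f : H} {c r : ℝ} (hr : 0 ≤ r)
    (h : ∀ j : ℕ, ‖(Q ^ j) f‖ ≤ c * r ^ j) : ‖Q f‖ ≤ r * ‖f‖ := by
  by_contra! hlt
  have hstep : ∀ j : ℕ, ‖(Q ^ (j + 1)) f‖ ^ 2 ≤ ‖(Q ^ j) f‖ * ‖(Q ^ (j + 2)) f‖ := by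
    intro j
    have h1 : ⟪(Q ^ (j + 1)) f, (Q ^ (j + 1)) f⟫_ℂ = ⟪(Q ^ j) f, (Q ^ (j + 2)) f⟫_ℂ := by
      rw [pow_succ' Q (j + 1), pow_succ' Q j, mul_apply_eq_comp, hQ, mul_apply_eq_comp,
        mul_apply_eq_comp]
    have h2 := norm_inner_le_norm (𝕜 := ℂ) ((Q ^ j) f) ((Q ^ (j + 2)) f)
    rw [← h1, inner_self_eq_norm_sq_to_K] at h2
    simpa using h2
  have hf : 0 < ‖f‖ := by
    rw [norm_pos_iff]; rintro rfl
    simp at hlt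
  set ρ := ‖Q f‖ / ‖f‖ with hρ
  have hρr : r < ρ := by rw [hρ, lt_div_iff₀ hf]; exact hlt
  have hρ0 : 0 < ρ := hr.trans_lt hρr
  have hpos : ∀ j : ℕ, 0 < ‖(Q ^ j) f‖ ∧ ρ * ‖(Q ^ j) f‖ ≤ ‖(Q ^ (j + 1)) f‖ := by
    intro j
    induction j with
    | zero =>
      refine ⟨by simpa using hf, le_of_eq ?_⟩
      simp only [pow_zero, one_apply_eq_self, zero_add, pow_one]
      rw [hρ, div_mul_cancel₀ _ hf.ne']
    | succ j ih =>
      have h1 : 0 < ‖(Q ^ (j + 1)) f‖ := lt_of_lt_of_le (mul_pos hρ0 ih.1) ih.2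
      refine ⟨h1, ?_⟩
      have h2 := hstep j
      by_contra! h3
      have h4 : ‖(Q ^ j) f‖ * ‖(Q ^ (j + 2)) f‖ < ‖(Q ^ j) f‖ * (ρ * ‖(Q ^ (j + 1)) f‖) :=
        mul_lt_mul_of_pos_left h3 ih.1
      nlinarith
  have hge : ∀ j : ℕ, ρ ^ j * ‖f‖ ≤ ‖(Q ^ j) f‖ := by
    intro j
    induction j with
    | zero => simp
    | succ j ih =>
      refine le_trans ?_ (hpos j).2
      rw [pow_succ', mul_assoc]
      exact mul_le_mul_of_nonneg_left ih hρ0.le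
  -- The comparison of geometric sequences divides by r; for r = 0 the bound at j = 1 is enough.
  rcases hr.eq_or_lt with h0 | h0
  · have h1 := h 1
    rw [← h0, pow_one, pow_one, mul_zero] at h1
    rw [← h0, zero_mul] at hlt
    linarith
  · have hbig : 1 < ρ / r := by rw [lt_div_iff₀ h0, one_mul]; exact hρr
    obtain ⟨j, hj⟩ := pow_unbounded_of_one_lt (c / ‖f‖) hbig
    rw [div_pow, div_lt_div_iff₀ hf (by positivity)] at hj
    linarith [hge j, h j]

end HilbertSpace

/-! ### The averaged heat bath operator and its L² contraction -/

section HeatBath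

open scoped InnerProductSpace

/-- The constant function `1` in `L²`. -/
def oneL2 {X : Type*} [MeasurableSpace X] (π : Measure X) [IsFiniteMeasure π] : Lp ℂ 2 π :=
  (memLp_const (1 : ℂ)).toLp

lemma inner_oneL2 {X : Type*} [MeasurableSpace X] {π : Measure X} [IsFiniteMeasure π]
    (f : Lp ℂ 2 π) : ⟪oneL2 π, f⟫_ℂ = ∫ x, f x ∂π := by
  rw [L2.inner_def]
  refine integral_congr_ae ?_
  filter_upwards [(memLp_const (1 : ℂ) : MemLp (fun _ : X => (1 : ℂ)) 2 π).coeFn_toLp] with x hx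
  rw [oneL2, hx]; simp

lemma norm_oneL2 {X : Type*} [MeasurableSpace X] {π : Measure X} [IsProbabilityMeasure π] :
    ‖oneL2 π‖ = 1 := by
  have h : ⟪oneL2 π, oneL2 π⟫_ℂ = 1 := by
    rw [inner_oneL2, oneL2, integral_congr_ae (MemLp.coeFn_toLp _)]; simp
  rw [inner_self_eq_norm_sq_to_K] at h
  have h2 : ((‖oneL2 π‖ ^ 2 : ℝ) : ℂ) = ((1 : ℝ) : ℂ) := by simpa using h
  exact (pow_eq_one_iff_of_nonneg (norm_nonneg _) two_ne_zero).1 (Complex.ofReal_injective h2)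

lemma bondOp_oneL2 {n : ℕ} {i : Fin n} {k : Config n → ℝ → ℝ} {M : ℝ} {π : Measure (Config n)}
    [IsFiniteMeasure π] (hk : IsBoundedRate k M) (hs : IsSymmetricOn i k π) :
    bondOp hk hs (oneL2 π) = 0 := by
  refine Lp.ext ?_
  refine (bondOp_toLp hk hs (memLp_const (1 : ℂ))).trans ?_
  filter_upwards [Lp.coeFn_zero ℂ 2 π] with x hx
  rw [hx]; simp

lemma isBoundedRate_heat {n : ℕ} :
    IsBoundedRate (fun (_ : Config n) α => heatDensity α) (1 / weightMass) :=
  ⟨continuous_heatDensity.measurable.comp measurable_snd, fun _ => heatDensity_nonneg,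
    fun _ => heatDensity_le⟩

lemma isSymmetricOn_heat {n : ℕ} {ε : ℝ} (hε : 0 < ε) (i : Fin n) :
    IsSymmetricOn i (fun _ α => heatDensity α) (condLaw n ε) :=
  isSymmetricOn_condLaw i hε (κ := fun _ α => heatDensity α)
    (continuous_heatDensity.measurable.comp measurable_snd)
    (fun β _ α _ => by simp only [heatDensity]; ring)

/-- The heat bath operator of bond `i`. -/
def heatOp {n : ℕ} {ε : ℝ} (hε : 0 < ε) (i : Fin n) :
    Lp ℂ 2 (condLaw n ε) →L[ℂ] Lp ℂ 2 (condLaw n ε) :=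
  bondOp isBoundedRate_heat (isSymmetricOn_heat hε i)

/-- The average over the bonds of the heat bath kernels. -/
def heatAvg {n : ℕ} (f : Config n → ℂ) (x : Config n) : ℂ :=
  (1 / n : ℝ) • ∑ i : Fin n, ∫ α, heatDensity α • f (exchange i α x) ∂unitVol

/-- The average over the bonds of the heat bath kernels as an operator. -/
def heatAvgOp {n : ℕ} {ε : ℝ} (hε : 0 < ε) :
    Lp ℂ 2 (condLaw n ε) →L[ℂ] Lp ℂ 2 (condLaw n ε) :=
  1 + (1 / n : ℝ) • ∑ i : Fin n, heatOp hε i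

/-- Bounded measurable functions that are Lipschitz on the simplex for the contracting distance. -/
structure IsSineLipschitz {n : ℕ} (ε K : ℝ) (f : Config n → ℂ) : Prop where
  measurable : Measurable f
  bounded : ∃ B, ∀ x, ‖f x‖ ≤ B
  lipschitz : ∀ x ∈ simplex n ε, ∀ y ∈ simplex n ε, ‖f x - f y‖ ≤ K * sineNorm (x - y)

lemma integrable_heatDensity_smul {n : ℕ} {f : Config n → ℂ} (hf : Measurable f) {B : ℝ}
    (hB : ∀ x, ‖f x‖ ≤ B) (i : Fin n) (x : Config n) :
    Integrable (fun α => heatDensity α • f (exchange i α x)) unitVol := by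
  refine Integrable.of_bound (C := 1 / weightMass * B) ?_ (Filter.Eventually.of_forall fun α => ?_)
  · exact (continuous_heatDensity.measurable.smul
      (hf.comp (measurable_exchange_left i x))).aestronglyMeasurable
  · rw [norm_smul, Real.norm_of_nonneg (heatDensity_nonneg α)]
    exact mul_le_mul (heatDensity_le α) (hB _) (norm_nonneg _) (by have := weightMass_pos; positivity)

/-- The contraction factor of the averaged heat bath dynamics. -/
def contraction (n : ℕ) : ℝ := 1 - (1 - Real.cos (Real.pi / (n + 1))) / n

lemma contraction_nonneg (n : ℕ) : 0 ≤ contraction n := by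
  -- For n = 0 the division by zero makes the factor equal to 1.
  rcases Nat.eq_zero_or_pos n with rfl | hn
  · simp [contraction]
  have hn' : (1 : ℝ) ≤ n := by exact_mod_cast hn
  have h1 : 0 ≤ Real.cos (Real.pi / (n + 1)) := by
    refine Real.cos_nonneg_of_neg_pi_div_two_le_of_le ?_ ?_
    · have : 0 ≤ Real.pi / (n + 1) := by positivity
      linarith [Real.pi_pos]
    · exact div_le_div_of_nonneg_left Real.pi_pos.le two_pos (by linarith)
  have h2 : (1 - Real.cos (Real.pi / (n + 1))) / n ≤ 1 := by
    rw [div_le_one (by linarith)]; linarith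
  rw [contraction]; linarith

/-- Coupling: both configurations undergo the exchange with the same bond and the same α. Exchanges
are linear, so their difference undergoes it too, and the averaged contraction of `sineNorm`
applies. -/
lemma IsSineLipschitz.heatAvg {n : ℕ} (hn : 0 < n) {ε K : ℝ} {f : Config n → ℂ} (hK : 0 ≤ K)
    (hf : IsSineLipschitz ε K f) : IsSineLipschitz ε (K * contraction n) (heatAvg f) := by
  obtain ⟨B, hB⟩ := hf.bounded
  have hn' : (0 : ℝ) < n := by exact_mod_cast hn
  have hB0 : 0 ≤ B := (norm_nonneg _).trans (hB 0)
  refine ⟨?_, ⟨B, fun x => ?_⟩, fun x hx y hy => ?_⟩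
  · unfold BilliardLattice.heatAvg
    suffices h : Measurable fun x => ∑ i : Fin n,
      ∫ α, heatDensity α • f (exchange i α x) ∂unitVol from h.const_smul (1 / n : ℝ)
    refine Finset.measurable_fun_sum _ fun i _ => ?_
    refine (StronglyMeasurable.integral_prod_right (f := fun x α =>
      heatDensity α • f (exchange i α x)) ?_).measurable
    refine Measurable.stronglyMeasurable ?_
    exact (continuous_heatDensity.measurable.comp measurable_snd).smul
      (hf.measurable.comp (measurable_exchange i))
  · rw [BilliardLattice.heatAvg, norm_smul, Real.norm_of_nonneg (by positivity)]
    have h1 : ∀ i : Fin n, ‖∫ α, heatDensity α • f (exchange i α x) ∂unitVol‖ ≤ B := by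
      intro i
      refine (norm_integral_le_of_norm_le (g := fun α => heatDensity α * B) ?_
        (Filter.Eventually.of_forall fun α => ?_)).trans (le_of_eq ?_)
      · exact integrable_mul_heatDensity continuous_const
      · rw [norm_smul, Real.norm_of_nonneg (heatDensity_nonneg α)]
        exact mul_le_mul_of_nonneg_left (hB _) (heatDensity_nonneg α)
      · rw [integral_mul_const, integral_heatDensity, one_mul]
    have h2 := norm_sum_le_of_le Finset.univ fun i _ => h1 i
    rw [Finset.sum_const, Finset.card_univ, Fintype.card_fin, nsmul_eq_mul] at h2
    calc _ ≤ 1 / (n : ℝ) * (n * B) := mul_le_mul_of_nonneg_left h2 (by positivity)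
      _ = B := by field_simp
  · have h0 : ∑ j, (x - y) j = 0 := sum_sub_eq_zero hx hy
    rw [BilliardLattice.heatAvg, BilliardLattice.heatAvg, ← smul_sub, norm_smul,
      Real.norm_of_nonneg (by positivity), ← Finset.sum_sub_distrib]
    have hc : ∀ i : Fin n, Continuous fun α => sineNorm (exchange i α (x - y)) := by
      intro i
      have : Continuous fun α : ℝ => exchange i α (x - y) :=
        (continuous_exchange i).comp (Continuous.prodMk continuous_const continuous_id)
      unfold sineNorm cumEnergy
      refine continuous_finsetSum _ fun m _ => continuous_const.mul (continuous_abs.comp ?_)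
      refine continuous_finsetSum _ fun j _ => ?_
      split_ifs
      · exact (continuous_apply j).comp this
      · exact continuous_const
    have h1 : ∀ i : Fin n, ‖∫ α, heatDensity α • f (exchange i α x) ∂unitVol -
        ∫ α, heatDensity α • f (exchange i α y) ∂unitVol‖ ≤
        K * ∫ α, heatDensity α * sineNorm (exchange i α (x - y)) ∂unitVol := by
      intro i
      rw [← integral_sub (integrable_heatDensity_smul hf.measurable hB i x)
        (integrable_heatDensity_smul hf.measurable hB i y), ← integral_const_mul]
      refine norm_integral_le_of_norm_le ((integrable_mul_heatDensity (hc i)).const_mul K) ?_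
      filter_upwards [ae_unitVol] with α hα
      have hα' := Ioo_subset_Icc_self hα
      rw [← smul_sub, norm_smul, Real.norm_of_nonneg (heatDensity_nonneg α), mul_left_comm]
      refine mul_le_mul_of_nonneg_left ?_ (heatDensity_nonneg α)
      rw [← exchange_sub]
      exact hf.lipschitz _ (exchange_mem_simplex i hα' hx) _ (exchange_mem_simplex i hα' hy)
    have h2 := norm_sum_le_of_le Finset.univ fun i _ => h1 i
    rw [← Finset.mul_sum] at h2
    calc _ ≤ 1 / (n : ℝ) * (K * ((n - (1 - Real.cos (Real.pi / (n + 1)))) * sineNorm (x - y))) := by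
          refine mul_le_mul_of_nonneg_left (h2.trans ?_) (by positivity)
          exact mul_le_mul_of_nonneg_left (sum_integral_sineNorm_exchange_le h0) hK
      _ = _ := by rw [contraction]; field_simp

lemma IsSineLipschitz.memLp {n : ℕ} {ε K : ℝ} {f : Config n → ℂ} (hf : IsSineLipschitz ε K f)
    (π : Measure (Config n)) [IsFiniteMeasure π] : MemLp f 2 π := by
  obtain ⟨B, hB⟩ := hf.bounded
  exact MemLp.of_bound hf.measurable.aestronglyMeasurable B (Filter.Eventually.of_forall hB)

lemma heatAvgOp_toLp {n : ℕ} (hn : 0 < n) {ε K : ℝ} (hε : 0 < ε) (hK : 0 ≤ K)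
    {f : Config n → ℂ} (hf : IsSineLipschitz ε K f) :
    heatAvgOp hε (hf.memLp _).toLp = ((hf.heatAvg hn hK).memLp (condLaw n ε)).toLp := by
  have hn' : (n : ℝ) ≠ 0 := by exact_mod_cast hn.ne'
  obtain ⟨B, hB⟩ := hf.bounded
  refine Lp.ext ?_
  refine Filter.EventuallyEq.trans ?_ (MemLp.coeFn_toLp _).symm
  have h1 : ∀ᵐ x ∂(condLaw n ε), ∀ i : Fin n, heatOp hε i (hf.memLp _).toLp x =
      ∫ α, heatDensity α • (f (exchange i α x) - f x) ∂unitVol := by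
    rw [eventually_countable_forall]
    exact fun i => bondOp_toLp isBoundedRate_heat (isSymmetricOn_heat hε i) (hf.memLp _)
  have e : heatAvgOp hε (hf.memLp _).toLp = (hf.memLp _).toLp +
      (1 / n : ℝ) • ∑ i : Fin n, heatOp hε i (hf.memLp _).toLp := by
    simp [heatAvgOp]
  rw [e]
  filter_upwards [h1, Lp.coeFn_add ((hf.memLp (condLaw n ε)).toLp)
    ((1 / n : ℝ) • ∑ i : Fin n, heatOp hε i (hf.memLp _).toLp),
    Lp.coeFn_smul (1 / n : ℝ) (∑ i : Fin n, heatOp hε i (hf.memLp _).toLp),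
    Lp.coeFn_fun_finsetSum Finset.univ (fun i : Fin n => heatOp hε i (hf.memLp _).toLp),
    (hf.memLp (condLaw n ε)).coeFn_toLp] with x h1 h2 h3 h4 h5
  rw [h2, Pi.add_apply, h3, Pi.smul_apply, h4, h5, heatAvg]
  simp_rw [h1]
  have h6 : ∀ i : Fin n, ∫ α, heatDensity α • (f (exchange i α x) - f x) ∂unitVol =
      ∫ α, heatDensity α • f (exchange i α x) ∂unitVol - f x := by
    intro i
    simp_rw [smul_sub]
    rw [integral_sub (integrable_heatDensity_smul hf.measurable hB i x), integral_smul_const,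
      integral_heatDensity, one_smul]
    refine Integrable.smul_const ?_ _
    simpa using integrable_mul_heatDensity continuous_const (g := fun _ => 1)
  simp_rw [h6, Finset.sum_sub_distrib]
  rw [Finset.sum_const, Finset.card_univ, Fintype.card_fin, smul_sub, ← Nat.cast_smul_eq_nsmul ℝ,
    smul_smul, one_div_mul_cancel hn', one_smul]
  ring

lemma heatAvgOp_inner_symm {n : ℕ} {ε : ℝ} (hε : 0 < ε) (f g : Lp ℂ 2 (condLaw n ε)) :
    ⟪heatAvgOp hε g, f⟫_ℂ = ⟪g, heatAvgOp hε f⟫_ℂ := by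
  simp only [heatAvgOp, add_apply, one_apply_eq_self, smul_apply,
    sum_apply, inner_add_left, inner_add_right, sum_inner, inner_sum,
    inner_smul_left_eq_star_smul, inner_smul_right_eq_smul, heatOp, bondOp_inner_symm,
    starRingEnd_apply, star_trivial]

lemma heatAvgOp_oneL2 {n : ℕ} {ε : ℝ} (hε : 0 < ε) :
    heatAvgOp hε (oneL2 (condLaw n ε)) = oneL2 _ := by
  simp [heatAvgOp, heatOp, bondOp_oneL2]

/-- Each application multiplies the Lipschitz constant by the contraction factor and keeps the mean
zero, the operator being symmetric and fixing constants. A mean-zero Lipschitz function is bounded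
by its constant times the diameter bound n(n+1)ε of the simplex. -/
lemma norm_heatAvgOp_pow_le {n : ℕ} (hn : 0 < n) {ε : ℝ} (hε : 0 < ε) (j : ℕ) :
    ∀ (K : ℝ) (f : Config n → ℂ), 0 ≤ K → ∀ hf : IsSineLipschitz ε K f,
      ∫ x, f x ∂(condLaw n ε) = 0 →
      ‖(heatAvgOp hε ^ j) (hf.memLp (condLaw n ε)).toLp‖ ≤
        K * (n * ((n + 1) * ε)) * contraction n ^ j := by
  induction j with
  | zero =>
    intro K f hK hf h0
    obtain ⟨B, hB⟩ := hf.bounded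
    rw [pow_zero, pow_zero, mul_one, one_apply_eq_self]
    have hint : Integrable f (condLaw n ε) := (hf.memLp _).integrable (by norm_num)
    have hsup : ∀ᵐ x ∂(condLaw n ε), ‖f x‖ ≤ K * (n * ((n + 1) * ε)) := by
      filter_upwards [ae_condLaw hε] with x hx
      have h1 : f x = ∫ y, (f x - f y) ∂(condLaw n ε) := by
        rw [integral_sub (integrable_const _) hint, h0]; simp
      rw [h1]
      refine (norm_integral_le_of_norm_le_const (C := K * (n * ((n + 1) * ε))) ?_).trans ?_
      · filter_upwards [ae_condLaw hε] with y hy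
        exact (hf.lipschitz x hx y hy).trans (mul_le_mul_of_nonneg_left (sineNorm_sub_le hx hy) hK)
      · simp
    rw [Lp.norm_toLp]
    refine ENNReal.toReal_le_of_le_ofReal (by positivity) ?_
    refine (eLpNorm_le_of_ae_bound hsup).trans ?_
    simp
  | succ j ih =>
    intro K f hK hf h0
    have hmean : ∫ x, heatAvg f x ∂(condLaw n ε) = 0 := by
      have h1 : ⟪oneL2 (condLaw n ε), heatAvgOp hε (hf.memLp _).toLp⟫_ℂ = 0 := by
        rw [← heatAvgOp_inner_symm, heatAvgOp_oneL2, inner_oneL2,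
          integral_congr_ae (hf.memLp _).coeFn_toLp, h0]
      rwa [heatAvgOp_toLp hn hε hK hf, inner_oneL2, integral_congr_ae (MemLp.coeFn_toLp _)] at h1
    rw [pow_succ, mul_apply_eq_comp, heatAvgOp_toLp hn hε hK hf]
    refine (ih _ _ (mul_nonneg hK (contraction_nonneg n)) (hf.heatAvg hn hK) hmean).trans (le_of_eq ?_)
    ring

lemma exists_isSineLipschitz_of_contDiff {n : ℕ} {ε : ℝ} {g : Config n → ℂ}
    (hc : HasCompactSupport g) (hg : ContDiff ℝ 1 g) (c : ℂ) :
    ∃ K, 0 ≤ K ∧ IsSineLipschitz ε K (fun x => g x - c) := by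
  obtain ⟨L, hL⟩ := hg.lipschitzWith_of_hasCompactSupport hc one_ne_zero
  obtain ⟨B, hB⟩ := hc.exists_bound_of_continuous hg.continuous
  obtain ⟨R, hR0, hR⟩ := norm_le_sineNorm (n := n)
  refine ⟨L * R, by positivity, ?_, ⟨B + ‖c‖, fun x => ?_⟩, fun x hx y hy => ?_⟩
  · exact (hg.continuous.sub continuous_const).measurable
  · exact (norm_sub_le _ _).trans (add_le_add_left (hB x) _)
  · rw [sub_sub_sub_cancel_right]
    refine (hL.norm_sub_le x y).trans ?_
    rw [mul_assoc]
    exact mul_le_mul_of_nonneg_left (hR _ (sum_sub_eq_zero hx hy)) L.2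

/-- For smooth compactly supported functions minus their mean, the decay of the iterates combines
with `norm_le_of_norm_pow_le`; density does the rest, since the resulting bound no longer involves a
Lipschitz constant. -/
lemma norm_heatAvgOp_le {n : ℕ} (hn : 0 < n) {ε : ℝ} (hε : 0 < ε) (f : Lp ℂ 2 (condLaw n ε))
    (hf : ⟪oneL2 _, f⟫_ℂ = 0) : ‖heatAvgOp hε f‖ ≤ contraction n * ‖f‖ := by
  let π := condLaw n ε
  -- Composing with the projection off the constants gives a closed condition on all of L², so the
  -- approximating functions need not have mean zero.
  let P : Lp ℂ 2 π → Lp ℂ 2 π := fun g => g - ⟪oneL2 π, g⟫_ℂ • oneL2 π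
  have hP : Continuous P := by
    have h1 : Continuous fun g : Lp ℂ 2 π => ⟪oneL2 π, g⟫_ℂ :=
      continuous_const.inner continuous_id
    exact continuous_id.sub (h1.smul continuous_const)
  have hclosed : IsClosed {g : Lp ℂ 2 π | ‖heatAvgOp hε (P g)‖ ≤ contraction n * ‖P g‖} :=
    isClosed_le ((heatAvgOp hε).continuous.comp hP).norm (continuous_const.mul hP.norm)
  have hdense := Lp.dense_hasCompactSupport_contDiff (F := ℂ) (μ := π) (p := 2) (by norm_num)
  have hall : ∀ g : Lp ℂ 2 π, ‖heatAvgOp hε (P g)‖ ≤ contraction n * ‖P g‖ := by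
    intro g
    refine hclosed.closure_subset_iff.2 ?_ (hdense g)
    rintro u ⟨g, hug, hgc, hgd⟩
    obtain ⟨K, hK, hlip⟩ := exists_isSineLipschitz_of_contDiff (ε := ε) hgc
      (hgd.of_le (by simp)) (⟪oneL2 π, u⟫_ℂ)
    have hPu : P u = (hlip.memLp π).toLp := by
      refine Lp.ext (Filter.EventuallyEq.trans ?_ (MemLp.coeFn_toLp _).symm)
      filter_upwards [Lp.coeFn_sub u (⟪oneL2 π, u⟫_ℂ • oneL2 π), hug,
        Lp.coeFn_smul (⟪oneL2 π, u⟫_ℂ) (oneL2 π),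
        (memLp_const (1 : ℂ) : MemLp (fun _ : Config n => (1 : ℂ)) 2 π).coeFn_toLp]
        with x h1 h2 h3 h4
      simp only [P]
      rw [h1, Pi.sub_apply, h2, h3, Pi.smul_apply, oneL2, h4]
      simp
    have hmean : ∫ x, (g x - ⟪oneL2 π, u⟫_ℂ) ∂π = 0 := by
      have h1 : ⟪oneL2 π, P u⟫_ℂ = 0 := by
        simp only [P, inner_sub_right, inner_smul_right, inner_self_eq_norm_sq_to_K, norm_oneL2]
        simp
      rwa [hPu, inner_oneL2, integral_congr_ae (MemLp.coeFn_toLp _)] at h1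
    change ‖heatAvgOp hε (P u)‖ ≤ contraction n * ‖P u‖
    rw [hPu]
    exact norm_le_of_norm_pow_le (heatAvgOp_inner_symm hε) (contraction_nonneg n)
      fun j => norm_heatAvgOp_pow_le hn hε j K _ hK hlip hmean
  have hPf : P f = f := by
    change f - ⟪oneL2 (condLaw n ε), f⟫_ℂ • _ = f
    rw [hf, zero_smul, sub_zero]
  have := hall f
  rwa [hPf] at this

lemma heat_gap {n : ℕ} (hn : 0 < n) {ε : ℝ} (hε : 0 < ε) (f : Lp ℂ 2 (condLaw n ε))
    (hf : ⟪oneL2 _, f⟫_ℂ = 0) :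
    ∑ i : Fin n, (⟪f, heatOp hε i f⟫_ℂ).re ≤
      -(1 - Real.cos (Real.pi / (n + 1))) * ‖f‖ ^ 2 := by
  have hn' : (0 : ℝ) < n := by exact_mod_cast hn
  have h1 : (⟪f, heatAvgOp hε f⟫_ℂ).re ≤ contraction n * ‖f‖ ^ 2 := by
    refine (Complex.re_le_norm _).trans ((norm_inner_le_norm _ _).trans ?_)
    have := mul_le_mul_of_nonneg_left (norm_heatAvgOp_le hn hε f hf) (norm_nonneg f)
    calc _ ≤ _ := this
      _ = _ := by ring
  have h2 : (⟪f, heatAvgOp hε f⟫_ℂ).re =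
      ‖f‖ ^ 2 + 1 / n * ∑ i : Fin n, (⟪f, heatOp hε i f⟫_ℂ).re := by
    have h3 : (⟪f, f⟫_ℂ).re = ‖f‖ ^ 2 := inner_self_eq_norm_sq (𝕜 := ℂ) f
    simp only [heatAvgOp, add_apply, one_apply_eq_self, smul_apply,
      sum_apply, inner_add_right, inner_sum, inner_smul_right_eq_smul,
      Complex.add_re, h3, Complex.smul_re, Complex.re_sum, smul_eq_mul]
  rw [h2, contraction] at h1
  have h4 : 1 / (n : ℝ) * ∑ i : Fin n, (⟪f, heatOp hε i f⟫_ℂ).re ≤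
      1 / n * (-(1 - Real.cos (Real.pi / (n + 1))) * ‖f‖ ^ 2) := by
    have : (1 - (1 - Real.cos (Real.pi / (n + 1))) / n) * ‖f‖ ^ 2 = ‖f‖ ^ 2 +
      1 / n * (-(1 - Real.cos (Real.pi / (n + 1))) * ‖f‖ ^ 2) := by ring
    linarith
  exact le_of_mul_le_mul_left h4 (by positivity)

end HeatBath


/-! ### The generator on `L²` and its spectrum -/

section Spectrum

open scoped InnerProductSpace

/-- For real l > -g, l ≠ 0, the resolvent is built without splitting the space: add g on the line of
e to make the operator coercive, then correct on that line by an invertible factor. -/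
lemma spectrum_subset_of_gap {H : Type*} [NormedAddCommGroup H] [InnerProductSpace ℂ H]
    [CompleteSpace H] {T : H →L[ℂ] H} (hT : ∀ f g, ⟪T g, f⟫_ℂ = ⟪g, T f⟫_ℂ) {e : H}
    (he : ‖e‖ = 1) (hTe : T e = 0) {g : ℝ}
    (hgap : ∀ f, ⟪e, f⟫_ℂ = 0 → (⟪f, T f⟫_ℂ).re ≤ -g * ‖f‖ ^ 2) :
    spectrum ℂ T ⊆ Complex.ofReal '' (Iic (-g) ∪ {0}) := by
  intro z hz
  have hsa : IsSelfAdjoint T :=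
    ContinuousLinearMap.isSelfAdjoint_iff_isSymmetric.2 fun x y => hT y x
  have hzr : z = z.re := hsa.mem_spectrum_eq_re hz
  refine ⟨z.re, ?_, hzr.symm⟩
  by_contra hnot
  simp only [mem_union, mem_Iic, mem_singleton_iff, not_or, not_le] at hnot
  obtain ⟨hlt, hne⟩ := hnot
  set l : ℝ := z.re with hl
  refine hz ?_
  have hpos : 0 < l + g := by linarith
  have hee : ⟪e, e⟫_ℂ = 1 := by rw [inner_self_eq_norm_sq_to_K, he]; simp
  let E : H →L[ℂ] H := (innerSL ℂ e).smulRight e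
  have hE : ∀ f, E f = ⟪e, f⟫_ℂ • e := fun f => by simp [E]
  have hEE : E * E = E := by
    ext f
    rw [mul_apply_eq_comp, hE, hE, inner_smul_right, hee, mul_one]
  have hTE : T * E = 0 := by
    ext f
    rw [mul_apply_eq_comp, hE, map_smul, hTe, smul_zero]; rfl
  -- On e this operator is l + g, and on the orthogonal complement its form is at least l + g by the
  -- gap.
  let B : H →L[ℂ] H := algebraMap ℂ (H →L[ℂ] H) (l : ℂ) - T + (g : ℂ) • E
  have hB : IsUnit B := by
    refine ContinuousLinearMap.isUnit_of_forall_le_norm_inner_map B (c := ⟨l + g, hpos.le⟩)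
      (by exact_mod_cast hpos) fun f => ?_
    set a := ⟪e, f⟫_ℂ with ha
    set f₀ := f - a • e with hf₀
    have hf : f = a • e + f₀ := by rw [hf₀]; abel
    have hef₀ : ⟪e, f₀⟫_ℂ = 0 := by
      rw [hf₀, inner_sub_right, inner_smul_right, hee, mul_one, ← ha, sub_self]
    have hTf : T f = T f₀ := by rw [hf, map_add, map_smul, hTe, smul_zero, zero_add]
    have h1 : (⟪f, B f⟫_ℂ).re = l * ‖f‖ ^ 2 - (⟪f₀, T f₀⟫_ℂ).re + g * ‖a‖ ^ 2 := by
      have e1 : B f = (l : ℂ) • f - T f₀ + (g : ℂ) • (a • e) := by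
        simp only [B, add_apply, sub_apply, smul_apply, hE, ← ha, ← hTf]
        rw [ContinuousLinearMap.algebraMap_apply]
      have e2 : ⟪f, T f₀⟫_ℂ = ⟪f₀, T f₀⟫_ℂ := by
        conv_lhs => rw [hf, inner_add_left, inner_smul_left, ← hT, hTe]
        simp
      have e3 : ⟪f, e⟫_ℂ = (starRingEnd ℂ) a := by rw [ha, inner_conj_symm]
      rw [e1, inner_add_right, inner_sub_right, inner_smul_right, inner_smul_right,
        inner_smul_right, e2, e3, inner_self_eq_norm_sq_to_K, Complex.mul_conj]
      simp only [Complex.add_re, Complex.sub_re, Complex.re_ofReal_mul, Complex.ofReal_re,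
        Complex.normSq_eq_norm_sq]
      norm_cast
    have h2 : ‖f‖ ^ 2 = ‖a‖ ^ 2 + ‖f₀‖ ^ 2 := by
      have h3 : ⟪a • e, f₀⟫_ℂ = 0 := by rw [inner_smul_left, hef₀, mul_zero]
      have h4 := norm_add_sq_eq_norm_sq_add_norm_sq_of_inner_eq_zero (𝕜 := ℂ) (a • e) f₀ h3
      rw [← hf, norm_smul, he, mul_one] at h4
      simpa [sq] using h4
    have h3 := hgap f₀ hef₀
    calc ‖f‖ ^ 2 * (l + g) ≤ (⟪f, B f⟫_ℂ).re := by rw [h1, h2]; linarith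
      _ ≤ ‖⟪f, B f⟫_ℂ‖ := Complex.re_le_norm _
      _ = ‖⟪B f, f⟫_ℂ‖ := norm_inner_symm _ _
  -- On e the shifted operator acts as l + g while l - T acts as l; the quotient c is the correction
  -- there, invertible because l ≠ 0.
  set c : ℂ := l / (l + g) with hc
  have hpos' : ((l : ℂ) + g) ≠ 0 := by exact_mod_cast hpos.ne'
  have hl' : (l : ℂ) ≠ 0 := by exact_mod_cast hne
  have hc0 : c ≠ 0 := div_ne_zero hl' hpos'
  have hD : IsUnit (1 + (c - 1) • E) := by
    have key : ∀ a b : ℂ, a * b = 1 → (1 + (a - 1) • E) * (1 + (b - 1) • E) = 1 := by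
      intro a b hab
      have h1 : (1 + (a - 1) • E) * (1 + (b - 1) • E) =
          1 + ((b - 1) + (a - 1) + (a - 1) * (b - 1)) • E := by
        rw [add_mul, mul_add, mul_add, smul_mul_smul_comm, hEE]
        simp only [one_mul, mul_one]
        module
      have h0 : (b - 1) + (a - 1) + (a - 1) * (b - 1) = 0 := by linear_combination hab
      rw [h1, h0, zero_smul, add_zero]
    exact ⟨⟨_, _, key c c⁻¹ (mul_inv_cancel₀ hc0), key c⁻¹ c (inv_mul_cancel₀ hc0)⟩, rfl⟩
  have hfac : algebraMap ℂ (H →L[ℂ] H) z - T = B * (1 + (c - 1) • E) := by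
    have h1 : B * E = ((l : ℂ) + g) • E := by
      simp only [B, add_mul, sub_mul, hTE, smul_mul_assoc, hEE, Algebra.algebraMap_eq_smul_one,
        one_mul]
      module
    rw [mul_add, mul_one, mul_smul_comm, h1, smul_smul]
    have h2 : (c - 1) * ((l : ℂ) + g) = -g := by rw [hc]; field_simp; ring
    rw [h2, hzr]
    simp only [B]
    module
  rw [spectrum.mem_resolventSet_iff, hfac]
  exact hB.mul hD

end Spectrum

/-! ### Comparison of the generator with the heat bath -/

section Generator

open scoped InnerProductSpace

/-- The rates of the generator across bond `i`. -/
def bondRate {n : ℕ} (Λ : ℝ → ℝ) (i : Fin n) (x : Config n) (α : ℝ) : ℝ :=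
  Λ (bondEnergy i x) * jumpRate (ratio i x) α

lemma measurable_bondRate {n : ℕ} {Λ : ℝ → ℝ} (hΛ : Measurable Λ) (i : Fin n) :
    Measurable (Function.uncurry (bondRate Λ i)) := by
  have h1 : Measurable fun p : Config n × ℝ => Λ (bondEnergy i p.1) :=
    hΛ.comp ((measurable_bondEnergy i).comp measurable_fst)
  have h2 : Measurable fun p : Config n × ℝ => jumpRate (ratio i p.1) p.2 :=
    measurable_jumpRate.comp (((measurable_ratio i).comp measurable_fst).prodMk measurable_snd)
  exact h1.mul h2

lemma isBoundedRate_bondRate {n : ℕ} {Λ : ℝ → ℝ} (hΛ : Measurable Λ) (h0 : ∀ s, 0 ≤ Λ s) {M : ℝ}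
    (hM : ∀ s, Λ s ≤ M) (i : Fin n) :
    IsBoundedRate (bondRate Λ i) (M * (√(2 * Real.pi) / 2)) :=
  ⟨measurable_bondRate hΛ i, fun _ _ => mul_nonneg (h0 _) (jumpRate_nonneg _ _),
    fun _ _ => mul_le_mul (hM _) (jumpRate_le _ _) (jumpRate_nonneg _ _) ((h0 0).trans (hM 0))⟩

lemma isSymmetricOn_bondRate {n : ℕ} {Λ : ℝ → ℝ} (hΛ : Measurable Λ) (h0 : ∀ s, 0 ≤ Λ s) {ε : ℝ}
    (hε : 0 < ε) (i : Fin n) : IsSymmetricOn i (bondRate Λ i) (condLaw n ε) :=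
  (isSymmetricOn_condLaw i hε (κ := jumpRate) measurable_jumpRate
    fun _ hβ _ hα => detailed_balance hβ hα).mul_left
    (c := fun x => Λ (bondEnergy i x)) (hΛ.comp (measurable_bondEnergy i)) (fun _ => h0 _)
    (fun α x => by rw [bondEnergy_exchange])

lemma generator_eq_bondRate {E : Type*} [NormedAddCommGroup E] [NormedSpace ℝ E] (Λ : ℝ → ℝ)
    {n : ℕ} (A : Config n → E) (x : Config n) : generator Λ A x =
      ∑ i : Fin n, ∫ α, bondRate Λ i x α • (A (exchange i α x) - A x) ∂unitVol :=
  generator_eq Λ A x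

/-- The function `Λ` frozen outside `[0, S]`. -/
def clamp (S : ℝ) (Λ : ℝ → ℝ) (s : ℝ) : ℝ := Λ (max 0 (min s S))

lemma clamp_of_mem {S s : ℝ} (Λ : ℝ → ℝ) (hs : s ∈ Icc 0 S) : clamp S Λ s = Λ s := by
  rw [clamp, min_eq_left hs.2, max_eq_right hs.1]

lemma continuous_clamp {Λ : ℝ → ℝ} (hΛ : ContinuousOn Λ (Ici 0)) (S : ℝ) :
    Continuous (clamp S Λ) :=
  hΛ.comp_continuous (by fun_prop) fun s => mem_Ici.2 (le_max_left _ _)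

lemma exists_clamp_le {Λ : ℝ → ℝ} (hΛ : ContinuousOn Λ (Ici 0)) (S : ℝ) :
    ∃ M, ∀ s, clamp S Λ s ≤ M := by
  obtain ⟨M, hM⟩ := isCompact_Icc.exists_bound_of_continuousOn
    (hΛ.mono (Icc_subset_Ici_self : Icc (0 : ℝ) (max 0 S) ⊆ Ici 0))
  refine ⟨M, fun s => (le_abs_self _).trans (hM _ ⟨le_max_left _ _, ?_⟩)⟩
  exact max_le_max le_rfl (min_le_right _ _)

lemma bondEnergy_mem_of_mem_simplex {n : ℕ} {ε : ℝ} {x : Config n} (hx : x ∈ simplex n ε)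
    (i : Fin n) : bondEnergy i x ∈ Icc 0 ((n + 1) * ε) := by
  refine ⟨bondEnergy_nonneg i hx.1, ?_⟩
  rw [← sum_eq_of_mem_simplex hx, bondEnergy, ← Finset.sum_pair (castSucc_ne_succ i)]
  exact Finset.sum_le_sum_of_subset_of_nonneg (Finset.subset_univ _) fun j _ _ => hx.1 j

/-- On the simplex no bond carries more than the total energy (n+1)ε, so Λ_s may be replaced by a
bounded continuous function on the whole line. -/
lemma generator_clamp {E : Type*} [NormedAddCommGroup E] [NormedSpace ℝ E] (Λ : ℝ → ℝ) {n : ℕ}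
    {ε : ℝ} (A : Config n → E) {x : Config n} (hx : x ∈ simplex n ε) :
    generator (clamp ((n + 1) * ε) Λ) A x = generator Λ A x := by
  simp only [generator_eq]
  refine Finset.sum_congr rfl fun i _ => ?_
  rw [clamp_of_mem Λ (bondEnergy_mem_of_mem_simplex hx i)]

/-- Dirichlet forms of symmetric jump operators are monotone in the rates, even though the operators
act through different jump measures. -/
lemma mul_norm_bondGrad_sq_le {n : ℕ} {i : Fin n} {k k' : Config n → ℝ → ℝ} {M M' c : ℝ}
    {π : Measure (Config n)} [IsFiniteMeasure π] (hk : IsBoundedRate k M)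
    (hs : IsSymmetricOn i k π) (hk' : IsBoundedRate k' M') (hs' : IsSymmetricOn i k' π)
    (hc : 0 ≤ c) (hle : ∀ᵐ x ∂π, ∀ᵐ α ∂unitVol, c * k' x α ≤ k x α) (f : Lp ℂ 2 π) :
    c * ‖bondGrad hk' hs' f‖ ^ 2 ≤ ‖bondGrad hk hs f‖ ^ 2 := by
  have hf := (Lp.stronglyMeasurable f).measurable
  have hG : Measurable fun p : Config n × ℝ => ‖f (target i p) - f p.1‖ₑ ^ 2 :=
    (((hf.comp (measurable_target i)).sub (hf.comp measurable_fst)).enorm).pow_const 2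
  rw [← ENNReal.ofReal_le_ofReal_iff (by positivity), ENNReal.ofReal_mul hc, norm_bondGrad_sq,
    norm_bondGrad_sq, lintegral_jumpMeasure hk hG, lintegral_jumpMeasure hk' hG,
    ← lintegral_const_mul]
  · refine lintegral_mono_ae ?_
    filter_upwards [hle] with x hx
    rw [← lintegral_const_mul]
    · refine lintegral_mono_ae ?_
      filter_upwards [hx] with α hα
      rw [← mul_assoc, ← ENNReal.ofReal_mul hc]
      exact mul_le_mul_left (ENNReal.ofReal_le_ofReal hα) _
    · exact (hk'.measurable_ofReal.mul hG).comp (measurable_const.prodMk measurable_id)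
  · exact (hk'.measurable_ofReal.mul hG).lintegral_prod_right'

/-- sin² = (1 - cos)(1 + cos) ≤ 2(1 - cos) at the angle π/(n+1), and the sine increases on [0, π/2].
-/
lemma half_sin_sq_le {n : ℕ} (hn : 1 ≤ n) : 1 / 2 * Real.sin (Real.pi / (((n : ℝ) + 1) + 2)) ^ 2 ≤
    1 - Real.cos (Real.pi / (n + 1)) := by
  have hn' : (1 : ℝ) ≤ n := by exact_mod_cast hn
  have hp := Real.pi_pos
  have h1 : Real.pi / (((n : ℝ) + 1) + 2) ≤ Real.pi / (n + 1) :=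
    div_le_div_of_nonneg_left hp.le (by positivity) (by linarith)
  have h2 : Real.pi / ((n : ℝ) + 1) ≤ Real.pi / 2 :=
    div_le_div_of_nonneg_left hp.le two_pos (by linarith)
  have h3 : 0 ≤ Real.pi / (((n : ℝ) + 1) + 2) := by positivity
  have h4 : Real.sin (Real.pi / (((n : ℝ) + 1) + 2)) ≤ Real.sin (Real.pi / (n + 1)) :=
    Real.sin_le_sin_of_le_of_le_pi_div_two (by linarith) h2 h1
  have h5 : 0 ≤ Real.sin (Real.pi / (((n : ℝ) + 1) + 2)) :=
    Real.sin_nonneg_of_nonneg_of_le_pi h3 (by linarith)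
  have h6 := Real.sin_sq_add_cos_sq (Real.pi / ((n : ℝ) + 1))
  have h7 := Real.cos_le_one (Real.pi / ((n : ℝ) + 1))
  nlinarith

/-- The generator acts on `L²` of the conditional laws, with a spectral gap. -/
theorem exists_generator_spectrum {Λs : ℝ → ℝ} (hΛs : ContinuousOn Λs (Ici 0)) {c : ℝ}
    (hc : 0 < c) (hΛc : ∀ s, 0 ≤ s → c ≤ Λs s) {n : ℕ} (hn : 1 ≤ n) {ε : ℝ} (hε : 0 < ε) :
    ∃ T : Lp ℂ 2 (condLaw n ε) →L[ℂ] Lp ℂ 2 (condLaw n ε),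
      IsGeneratorOnL2 Λs (condLaw n ε) T ∧
      spectrum ℂ T ⊆ Complex.ofReal '' (Iic (-(c * (√(2 * Real.pi) / 4 * weightMass) * (1 / 2) *
        Real.sin (Real.pi / (((n : ℝ) + 1) + 2)) ^ 2)) ∪ {0}) := by
  set Λ := clamp ((n + 1) * ε) Λs with hΛ
  have hcont := continuous_clamp hΛs ((n + 1) * ε)
  obtain ⟨M, hM⟩ := exists_clamp_le hΛs ((n + 1) * ε)
  have hge : ∀ s, c ≤ Λ s := fun s => hΛc _ (le_max_left _ _)
  have h0 : ∀ s, 0 ≤ Λ s := fun s => hc.le.trans (hge s)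
  have hk : ∀ i : Fin n, IsBoundedRate (bondRate Λ i) _ := fun i =>
    isBoundedRate_bondRate hcont.measurable h0 hM i
  have hs := fun i : Fin n => isSymmetricOn_bondRate hcont.measurable h0 hε i
  have hcw : 0 ≤ c * (√(2 * Real.pi) / 4 * weightMass) := by
    have := weightMass_pos
    positivity
  refine ⟨∑ i, bondOp (hk i) (hs i), ?_, ?_⟩
  · intro A hA
    have h1 : ∀ᵐ x ∂(condLaw n ε), ∀ i : Fin n, bondOp (hk i) (hs i) hA.toLp x =
        ∫ α, bondRate Λ i x α • (A (exchange i α x) - A x) ∂unitVol := by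
      rw [eventually_countable_forall]
      exact fun i => bondOp_toLp (hk i) (hs i) hA
    rw [sum_apply]
    filter_upwards [h1, ae_condLaw hε,
      Lp.coeFn_fun_finsetSum Finset.univ (fun i : Fin n => bondOp (hk i) (hs i) hA.toLp)]
      with x hx1 hx2 hx3
    rw [hx3, ← generator_clamp Λs A hx2, generator_eq_bondRate]
    exact Finset.sum_congr rfl fun i _ => hx1 i
  · refine spectrum_subset_of_gap (e := oneL2 _) ?_ norm_oneL2 ?_ ?_
    · intro f g
      simp only [sum_apply, sum_inner, inner_sum, bondOp_inner_symm]
    · simp only [sum_apply, bondOp_oneL2, Finset.sum_const_zero]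
    · intro f hf
      have hgap := heat_gap hn hε f hf
      -- Larger rates make the negative form smaller. The constant is c from Λ_s, √(2π)/4 from the
      -- minorization, and the mass of w because the heat bath density is normalized.
      have hterm : ∀ i : Fin n, (⟪f, bondOp (hk i) (hs i) f⟫_ℂ).re ≤
          c * (√(2 * Real.pi) / 4 * weightMass) * (⟪f, heatOp hε i f⟫_ℂ).re := by
        intro i
        rw [heatOp, inner_bondOp_self, inner_bondOp_self]
        have := mul_norm_bondGrad_sq_le (hk i) (hs i) isBoundedRate_heat
          (isSymmetricOn_heat hε i) hcw (by
            filter_upwards [ae_condLaw hε] with x hx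
            filter_upwards [ae_unitVol] with α hα
            have h1 := ratioWeight_le_jumpRate (ratio_mem i hx.1) (Ioo_subset_Icc_self hα)
            have h2 : c * (√(2 * Real.pi) / 4 * weightMass) * heatDensity α =
                c * (√(2 * Real.pi) / 4 * ratioWeight α) := by
              rw [heatDensity]
              have := weightMass_pos.ne'
              field_simp
            rw [h2, bondRate]
            exact mul_le_mul (hge _) h1 (mul_nonneg (by positivity) (ratioWeight_nonneg α)) (h0 _))
          f
        linarith
      rw [sum_apply, inner_sum, Complex.re_sum]
      calc _ ≤ ∑ i : Fin n, c * (√(2 * Real.pi) / 4 * weightMass) * (⟪f, heatOp hε i f⟫_ℂ).re :=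
            Finset.sum_le_sum fun i _ => hterm i
        _ ≤ c * (√(2 * Real.pi) / 4 * weightMass) *
              (-(1 - Real.cos (Real.pi / (n + 1))) * ‖f‖ ^ 2) := by
            rw [← Finset.mul_sum]
            exact mul_le_mul_of_nonneg_left hgap hcw
        _ ≤ _ := by
            have h1 := mul_le_mul_of_nonneg_left (half_sin_sq_le hn) hcw
            have h2 := mul_le_mul_of_nonneg_right h1 (sq_nonneg ‖f‖)
            linarith

end Generator


/-! ### Uniqueness of the stationary law: null invariant sets -/

/-- The previous value of a sequence of partial sums. -/
def prevSum {n : ℕ} (G : Config n) (j : Fin (n + 1)) : ℝ :=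
  Fin.cases (motive := fun _ => ℝ) 0 (fun i => G i.castSucc) j

lemma prevSum_succ {n : ℕ} (G : Config n) (i : Fin n) : prevSum G i.succ = G i.castSucc := rfl

/-- The configuration with given partial sums. -/
def increments {n : ℕ} : Config n →ₗ[ℝ] Config n where
  toFun G j := G j - prevSum G j
  map_add' G G' := by
    ext j
    refine Fin.cases ?_ (fun i => ?_) j
    · simp [prevSum]
    · simp [prevSum]; ring
  map_smul' c G := by
    ext j
    refine Fin.cases ?_ (fun i => ?_) j
    · simp [prevSum]
    · simp [prevSum]; ring

lemma increments_apply {n : ℕ} (G : Config n) (j : Fin (n + 1)) :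
    increments G j = G j - prevSum G j := rfl

lemma increments_injective {n : ℕ} : Function.Injective (increments : Config n →ₗ[ℝ] Config n) := by
  rw [← LinearMap.ker_eq_bot, LinearMap.ker_eq_bot']
  intro G hG
  ext j
  have h : ∀ j, G j = prevSum G j := fun j => by
    have := congrFun hG j
    rw [increments_apply] at this
    simpa [sub_eq_zero] using this
  induction j using Fin.induction with
  | zero => exact h 0
  | succ i ih => rw [h, prevSum_succ, ih]; rfl

lemma increments_surjective {n : ℕ} : Function.Surjective (increments : Config n →ₗ[ℝ] Config n) :=
  LinearMap.injective_iff_surjective.1 increments_injective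

lemma volume_preimage_increments {n : ℕ} {C : Set (Config n)} (hC : volume C = 0) :
    volume (increments ⁻¹' C) = 0 := by
  have hdet : LinearMap.det (increments : Config n →ₗ[ℝ] Config n) ≠ 0 := by
    refine isUnit_iff_ne_zero.1 ?_
    rw [← LinearMap.isUnit_iff_isUnit_det, Module.End.isUnit_iff]
    exact ⟨increments_injective, increments_surjective⟩
  rw [Measure.addHaar_preimage_linearMap volume hdet, hC, mul_zero]

lemma bondEnergy_increments {n : ℕ} (i : Fin n) (G : Config n) :
    bondEnergy i (increments G) = G i.succ - prevSum G i.castSucc := by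
  rw [bondEnergy, increments_apply, increments_apply, prevSum_succ]; ring

lemma prevSum_update {n : ℕ} (G : Config n) (i : Fin n) (t : ℝ) {j : Fin (n + 1)}
    (hj : j ≠ i.succ) : prevSum (Function.update G i.castSucc t) j = prevSum G j := by
  revert hj
  refine Fin.cases ?_ (fun k => ?_) j
  · intro _; rfl
  · intro hk
    rw [prevSum_succ, prevSum_succ, Function.update_of_ne]
    intro h
    exact hk (by rw [Fin.castSucc_injective _ h])

/-- Parametrized by its partial sums, a configuration changes in one coordinate only, which becomes
uniform between its neighbours when α is uniform and the bond energy is positive. So Lebesgue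
measure can be tracked coordinate by coordinate. -/
lemma exchange_increments {n : ℕ} (i : Fin n) (α : ℝ) (G : Config n) :
    exchange i α (increments G) = increments (Function.update G i.castSucc
      (prevSum G i.castSucc + α * (G i.succ - prevSum G i.castSucc))) := by
  ext j
  rw [increments_apply]
  by_cases h₂ : j = i.succ
  · subst h₂
    rw [exchange_succ, bondEnergy_increments, prevSum_succ, Function.update_self,
      Function.update_of_ne (castSucc_ne_succ i).symm]
    ring
  · rw [prevSum_update _ _ _ h₂]
    by_cases h₁ : j = i.castSucc
    · subst h₁
      rw [exchange_castSucc, bondEnergy_increments, Function.update_self]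
      ring
    · rw [exchange_of_ne _ _ h₁ h₂, Function.update_of_ne h₁, increments_apply]

lemma ae_comp_affine {q : ℝ → Prop} (h : ∀ᵐ t : ℝ, q t) (p : ℝ) {a : ℝ} (ha : a ≠ 0) :
    ∀ᵐ α ∂unitVol, q (p + α * a) := by
  have h1 : Measure.QuasiMeasurePreserving (fun α : ℝ => α * a) volume volume :=
    ⟨by fun_prop, by
      rw [Real.map_volume_mul_right ha]
      exact Measure.smul_absolutelyContinuous⟩
  have h2 : ∀ᵐ t : ℝ, q (p + t) :=
    (measurePreserving_add_left volume p).quasiMeasurePreserving.ae h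
  exact ae_restrict_of_ae (h1.ae h2)

instance : NeZero (unitVol : Measure ℝ) := ⟨IsProbabilityMeasure.ne_zero _⟩

/-- A set of configurations stable under almost all exchanges. -/
def IsExchangeInvariant {n : ℕ} (C : Set (Config n)) : Prop :=
  ∀ x ∈ C, ∀ i : Fin n, ∀ᵐ α ∂unitVol, exchange i α x ∈ C

/-- Sweep from right to left: if bond m-1 has positive energy, almost every exchange there stays in
C, and α > 0 makes the next bond to the left positive. Thus each of the first m partial sums
contributes a positive integral. -/
lemma lmarginal_pos_of_invariant {n : ℕ} {C : Set (Config n)} (hC : MeasurableSet C)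
    (hinv : IsExchangeInvariant C) (hnn : ∀ x ∈ C, ∀ j, 0 ≤ x j) (m : ℕ) (hm : m ≤ n) :
    ∀ G : Config n, increments G ∈ C →
      (∀ i : Fin n, i.val + 1 = m → 0 < bondEnergy i (increments G)) →
      (∫⋯∫⁻_(Finset.univ.filter fun j : Fin (n + 1) => j.val < m),
        ((increments ⁻¹' C).indicator 1) ∂(fun _ => volume)) G ≠ 0 := by
  have hmeas : Measurable (increments : Config n → Config n) :=
    (LinearMap.continuous_of_finiteDimensional increments).measurable
  have hf : Measurable ((increments ⁻¹' C).indicator (1 : Config n → ℝ≥0∞)) :=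
    measurable_one.indicator (hmeas hC)
  induction m with
  | zero =>
    intro G hG _
    simp [hG]
  | succ m ih =>
    intro G hG hpos
    let i : Fin n := ⟨m, hm⟩
    have hset : (Finset.univ.filter fun j : Fin (n + 1) => j.val < m + 1) =
        insert i.castSucc (Finset.univ.filter fun j : Fin (n + 1) => j.val < m) := by
      ext j
      simp only [Finset.mem_filter, Finset.mem_univ, true_and, Finset.mem_insert, Fin.ext_iff, i,
        Fin.val_castSucc]
      omega
    have hnot : i.castSucc ∉ Finset.univ.filter fun j : Fin (n + 1) => j.val < m := by
      simp [i]
    rw [hset, lmarginal_insert _ hf hnot]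
    have hi := hpos i rfl
    rw [bondEnergy_increments] at hi
    intro h0
    rw [lintegral_eq_zero_iff] at h0
    · have h1 := ae_comp_affine h0 (prevSum G i.castSucc) hi.ne'
      obtain ⟨α, h2, h3, hα⟩ := (h1.and ((hinv _ hG i).and ae_unitVol)).exists
      rw [exchange_increments] at h3
      refine ih (by omega) _ h3 (fun i' hi' => ?_) h2
      rw [bondEnergy_increments]
      have hsucc : i'.succ = i.castSucc := by
        ext; simp [i, hi']
      have hprev : prevSum G i.castSucc = G i'.castSucc := by rw [← hsucc, prevSum_succ]
      have hge : prevSum G i'.castSucc ≤ G i'.castSucc := by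
        have := hnn _ hG i'.castSucc
        rw [increments_apply] at this
        linarith
      rw [hsucc, Function.update_self, prevSum_update _ _ _ (by
        intro h
        have : i'.val = i.val + 1 := by simpa using congrArg Fin.val h
        have : i.val = m := rfl
        omega)]
      have := mul_pos hα.1 hi
      linarith [hprev]
    · exact (hf.lmarginal _).comp (measurable_update G)

/-- Exchanges conserve the last partial sum, the total energy, so they fill only the other n
coordinates; the scaling of the cone supplies the last one. -/
lemma volume_pos_of_invariant_cone {n : ℕ} {C : Set (Config n)} (hC : MeasurableSet C)
    (hinv : IsExchangeInvariant C) (hnn : ∀ x ∈ C, ∀ j, 0 ≤ x j)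
    (hcone : ∀ c : ℝ, 0 < c → ∀ x ∈ C, c • x ∈ C) {x : Config n} (hx : x ∈ C)
    (hlast : 0 < x (Fin.last n)) : volume C ≠ 0 := by
  intro h0
  have hmeas : Measurable (increments : Config n → Config n) :=
    (LinearMap.continuous_of_finiteDimensional increments).measurable
  have hf : Measurable ((increments ⁻¹' C).indicator (1 : Config n → ℝ≥0∞)) :=
    measurable_one.indicator (hmeas hC)
  obtain ⟨G, rfl⟩ := increments_surjective x
  have h1 := volume_preimage_increments h0
  have hpos : ∀ i : Fin n, i.val + 1 = n → 0 < bondEnergy i (increments G) := by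
    intro i hi
    have : i.succ = Fin.last n := by ext; simpa using hi
    rw [bondEnergy, this]
    linarith [hnn _ hx i.castSucc]
  have hG : 0 < G (Fin.last n) := by
    have hmono : ∀ j, 0 ≤ G j := by
      intro j
      induction j using Fin.induction with
      | zero => simpa [increments_apply, prevSum] using hnn _ hx 0
      | succ i ih =>
        have := hnn _ hx i.succ
        rw [increments_apply, prevSum_succ] at this
        linarith
    have hp : 0 ≤ prevSum G (Fin.last n) := by
      generalize Fin.last n = j
      refine Fin.cases ?_ (fun i => ?_) j
      · exact le_rfl
      · rw [prevSum_succ]; exact hmono _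
    rw [increments_apply] at hlast
    linarith
  rw [← lintegral_indicator_one (hmeas hC), volume_pi, lintegral_eq_lmarginal_univ G] at h1
  have hset : (Finset.univ : Finset (Fin (n + 1))) =
      insert (Fin.last n) (Finset.univ.filter fun j : Fin (n + 1) => j.val < n) := by
    ext j
    simp only [Finset.mem_filter, Finset.mem_univ, true_and, Finset.mem_insert, Fin.ext_iff,
      Fin.val_last, true_iff]
    omega
  rw [hset, lmarginal_insert _ hf (by simp)] at h1
  have h1' := (lintegral_eq_zero_iff (f := fun t => (∫⋯∫⁻_(Finset.univ.filter
    fun j : Fin (n + 1) => j.val < n), ((increments ⁻¹' C).indicator 1) ∂(fun _ => volume))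
    (Function.update G (Fin.last n) t)) ((hf.lmarginal _).comp (measurable_update G))).1 h1
  obtain ⟨α, h2, hα⟩ := ((ae_comp_affine h1' 0 (one_ne_zero)).and ae_unitVol).exists
  rw [zero_add, mul_one] at h2
  -- The scaling that gives the total energy the chosen value α.
  set c := α / G (Fin.last n) with hc
  have hc0 : 0 < c := div_pos hα.1 hG
  have h3 := lmarginal_pos_of_invariant hC hinv hnn n le_rfl (c • G)
    (by rw [map_smul]; exact hcone c hc0 _ hx)
    (fun i hi => by rw [map_smul, bondEnergy_smul]; exact mul_pos hc0 (hpos i hi))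
  refine h3 (Eq.trans ?_ h2)
  -- After integrating out all other coordinates, only the last one matters, and there the two
  -- points agree.
  refine lmarginal_congr _ _ fun j hj => ?_
  have hj' : j = Fin.last n := by
    simp only [Finset.mem_filter, Finset.mem_univ, true_and, not_lt] at hj
    ext; simp; omega
  subst hj'
  rw [Function.update_self, Pi.smul_apply, smul_eq_mul, hc, div_mul_cancel₀ _ hG.ne']

/-- Energy is carried to the right end bond by bond, each time by an exchange with α < 1 that stays
in C. -/
lemma exists_last_pos {n : ℕ} {C : Set (Config n)}
    (hinv : IsExchangeInvariant C) (hnn : ∀ x ∈ C, ∀ j, 0 ≤ x j) {x : Config n} (hx : x ∈ C)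
    (hm : 0 < meanEnergy x) : ∃ y ∈ C, 0 < y (Fin.last n) := by
  obtain ⟨j, hj⟩ : ∃ j, 0 < x j := by
    by_contra! hcon
    have : meanEnergy x ≤ 0 := by
      rw [meanEnergy_eq]
      exact mul_nonpos_of_nonneg_of_nonpos (by positivity) (Finset.sum_nonpos fun j _ => hcon j)
    linarith
  have key : ∀ k : ℕ, j.val ≤ k → ∀ hk : k < n + 1, ∃ y ∈ C, 0 < y ⟨k, hk⟩ := by
    intro k hjk
    induction k, hjk using Nat.le_induction with
    | base => exact fun _ => ⟨x, hx, hj⟩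
    | succ k hjk ih =>
      intro hk
      obtain ⟨y, hy, hypos⟩ := ih (by omega)
      let i : Fin n := ⟨k, by omega⟩
      obtain ⟨α, hα1, hα2⟩ := ((hinv y hy i).and ae_unitVol).exists
      refine ⟨_, hα1, ?_⟩
      have : (⟨k + 1, hk⟩ : Fin (n + 1)) = i.succ := rfl
      rw [this, exchange_succ]
      refine mul_pos (by linarith [hα2.2]) ?_
      exact add_pos_of_pos_of_nonneg hypos (hnn y hy _)
  exact key n (by omega) (by omega)

/-- The Gamma density is positive off the coordinate hyperplanes, which are Lebesgue null. -/
lemma volume_eq_zero_of_gibbs {n : ℕ} {C : Set (Config n)}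
    (hnn : ∀ x ∈ C, ∀ j, 0 ≤ x j) (h : gibbs n 1 C = 0) : volume C = 0 := by
  have := Fact.mk (one_pos : (0 : ℝ) < 1)
  have hm : Measurable (gammaPDF (3 / 2) (1 / 1)) := (measurable_gammaPDFReal _ _).ennreal_ofReal
  have hsf : ∀ _ : Fin (n + 1), SigmaFinite ((volume : Measure ℝ).withDensity
      (gammaPDF (3 / 2) (1 / 1))) := fun _ => by
    change SigmaFinite (siteLaw 1)
    infer_instance
  have e : gibbs n 1 = (volume : Measure (Config n)).withDensity
      fun x => ∏ j, gammaPDF (3 / 2) (1 / 1) (x j) := by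
    rw [volume_pi]
    exact @pi_withDensity (Fin (n + 1)) _ (fun _ => ℝ) _ (fun _ => volume) _
      (fun _ => gammaPDF (3 / 2) (1 / 1)) (fun _ => hm) hsf
  rw [e, withDensity_apply_eq_zero (by fun_prop)] at h
  refine measure_mono_null (t := ({x | ∏ j, gammaPDF (3 / 2) (1 / 1) (x j) ≠ 0} ∩ C) ∪
    ⋃ j, {x | x j = 0}) (fun x hx => ?_) (measure_union_null h (measure_iUnion_null fun j => ?_))
  · by_cases hex : ∃ j, x j = 0
    · exact Or.inr (mem_iUnion.2 hex)
    · push Not at hex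
      refine Or.inl ⟨?_, hx⟩
      refine Finset.prod_ne_zero_iff.2 fun j _ => ?_
      have hpos : 0 < x j := lt_of_le_of_ne (hnn x hx j) (hex j).symm
      exact (ENNReal.ofReal_pos.2 (gammaPDFReal_pos (by norm_num) (by norm_num) hpos)).ne'
  · rw [volume_pi]
    exact Measure.pi_hyperplane _ j 0

lemma direction_exchange {n : ℕ} (i : Fin n) (α : ℝ) (x : Config n) :
    direction (exchange i α x) = exchange i α (direction x) := by
  rw [direction, direction, meanEnergy_exchange, exchange_smul]

/-- An invariant null set of the simplex is empty. -/
lemma eq_empty_of_invariant_null {n : ℕ} {ε : ℝ} (hε : 0 < ε) {S : Set (Config n)}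
    (hS : MeasurableSet S) (hsub : S ⊆ simplex n ε) (hinv : IsExchangeInvariant S)
    (hnull : condLaw n ε S = 0) : S = ∅ := by
  by_contra hne
  obtain ⟨x, hx⟩ := nonempty_iff_ne_empty.2 hne
  have hd : Measurable fun x : Config n => ε • direction x := measurable_direction.const_smul ε
  -- The cone over S. Its null and invariance properties come from those of S through the direction.
  let C : Set (Config n) := {x | ∀ j, 0 ≤ x j} ∩ (meanEnergy ⁻¹' Ioi 0 ∩
    (fun x => ε • direction x) ⁻¹' S)
  have hC : MeasurableSet C :=
    (measurableSet_nonneg n).inter ((measurable_meanEnergy measurableSet_Ioi).inter (hd hS))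
  have hnn : ∀ x ∈ C, ∀ j, 0 ≤ x j := fun x hx => hx.1
  have hCinv : IsExchangeInvariant C := by
    intro x hx i
    filter_upwards [hinv _ hx.2.2 i, ae_unitVol] with α h1 h2
    refine ⟨exchange_nonneg i (Ioo_subset_Icc_self h2) hx.1, ?_, ?_⟩
    · change 0 < meanEnergy (exchange i α x)
      rw [meanEnergy_exchange]; exact hx.2.1
    · change ε • direction (exchange i α x) ∈ S
      rwa [direction_exchange, ← exchange_smul]
  have hcone : ∀ c : ℝ, 0 < c → ∀ x ∈ C, c • x ∈ C := by
    intro c hc x hx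
    refine ⟨fun j => mul_nonneg hc.le (hx.1 j), ?_, ?_⟩
    · change 0 < meanEnergy (c • x)
      rw [meanEnergy_smul]; exact mul_pos hc hx.2.1
    · change ε • direction (c • x) ∈ S
      rw [direction_smul hc.ne']; exact hx.2.2
  have hxC : x ∈ C := by
    have hm : meanEnergy x = ε := (hsub hx).2
    refine ⟨(hsub hx).1, by rw [mem_preimage, hm]; exact hε, ?_⟩
    change ε • direction x ∈ S
    rw [direction, hm, smul_smul, mul_inv_cancel₀ hε.ne', one_smul]
    exact hx
  have hCnull : gibbs n 1 C = 0 := by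
    rw [condLaw_eq_map_gibbs, Measure.map_apply hd hS] at hnull
    exact measure_mono_null (fun y hy => hy.2.2) hnull
  obtain ⟨y, hy, hypos⟩ := exists_last_pos hCinv hnn hxC hxC.2.1
  exact volume_pos_of_invariant_cone hC hCinv hnn hcone hy hypos
    (volume_eq_zero_of_gibbs hnn hCnull)


/-! ### Uniqueness of the stationary law -/

section Stationary

variable {n : ℕ} {Λ : ℝ → ℝ} {M : ℝ}

lemma measurable_generator (hΛ : Measurable Λ) {A : Config n → ℝ} (hA : Measurable A) :
    Measurable (generator Λ A) := by
  have e : generator Λ A = fun x =>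
      ∑ i : Fin n, ∫ α, bondRate Λ i x α • (A (exchange i α x) - A x) ∂unitVol :=
    funext fun x => generator_eq_bondRate Λ A x
  rw [e]
  refine Finset.measurable_fun_sum _ fun i _ => ?_
  have h : Measurable fun p : Config n × ℝ =>
      bondRate Λ i p.1 p.2 • (A (exchange i p.2 p.1) - A p.1) :=
    (measurable_bondRate hΛ i).smul ((hA.comp (measurable_exchange i)).sub
      (hA.comp measurable_fst))
  exact (h.stronglyMeasurable.integral_prod_right' (ν := unitVol)).measurable

lemma integrable_generator {π : Measure (Config n)} [IsFiniteMeasure π] (hΛ : Measurable Λ)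
    (h0 : ∀ s, 0 ≤ Λ s) (hM : ∀ s, Λ s ≤ M) {A : Config n → ℝ} (hA : Measurable A) {B : ℝ}
    (hB : ∀ x, |A x| ≤ B) : Integrable (generator Λ A) π := by
  have e : generator Λ A = fun x =>
      ∑ i : Fin n, ∫ α, bondRate Λ i x α • (A (exchange i α x) - A x) ∂unitVol :=
    funext fun x => generator_eq_bondRate Λ A x
  rw [e]
  refine integrable_finsetSum _ fun i _ => ?_
  have hk := isBoundedRate_bondRate hΛ h0 hM i
  have := isFiniteMeasure_jumpMeasure (π := π) hk
  have hi : Integrable (fun p : Config n × ℝ => A (exchange i p.2 p.1) - A p.1)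
      (jumpMeasure (bondRate Λ i) π) :=
    (Integrable.of_bound (hA.comp (measurable_exchange i)).aestronglyMeasurable B
      (ae_of_all _ fun p => hB _)).sub
      (Integrable.of_bound (hA.comp measurable_fst).aestronglyMeasurable B
        (ae_of_all _ fun p => hB _))
  exact (integral_jumpMeasure hk hi).1

lemma isStationaryOn_condLaw {Λs : ℝ → ℝ} (hΛs : ContinuousOn Λs (Ici 0))
    (h0 : ∀ s, 0 ≤ s → 0 ≤ Λs s) {ε : ℝ} (hε : 0 < ε) :
    IsStationaryOn Λs ε (condLaw n ε) where
  isProbabilityMeasure := inferInstance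
  concentrated := mem_ae_iff.1 (ae_condLaw hε)
  integral_generator A hA := by
    rintro ⟨B, hB⟩
    have hcont := continuous_clamp hΛs ((n + 1) * ε)
    obtain ⟨M, hM⟩ := exists_clamp_le hΛs ((n + 1) * ε)
    have h0' : ∀ s, 0 ≤ clamp ((n + 1) * ε) Λs s := fun s => h0 _ (le_max_left _ _)
    have hi := fun i : Fin n => integral_jump_eq_zero
      (isBoundedRate_bondRate hcont.measurable h0' hM i)
      (isSymmetricOn_bondRate hcont.measurable h0' hε i) hA hB
    have e : generator Λs A =ᵐ[condLaw n ε] fun x => ∑ i : Fin n,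
        ∫ α, bondRate (clamp ((n + 1) * ε) Λs) i x α • (A (exchange i α x) - A x) ∂unitVol := by
      filter_upwards [ae_condLaw hε] with x hx
      rw [← generator_clamp Λs A hx, generator_eq_bondRate]
    rw [integral_congr_ae e, integral_finsetSum _ fun i _ => (hi i).1]
    exact Finset.sum_eq_zero fun i _ => (hi i).2

/-- The indicator function of a set of configurations. -/
abbrev indic (B : Set (Config n)) : Config n → ℝ := B.indicator fun _ => 1

lemma measurable_indic {B : Set (Config n)} (hB : MeasurableSet B) : Measurable (indic B) :=
  measurable_const.indicator hB

lemma abs_indic_le (B : Set (Config n)) (x : Config n) : |indic B x| ≤ 1 := by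
  by_cases h : x ∈ B <;> simp [h]

lemma generator_indic_nonneg (h0 : ∀ s, 0 ≤ Λ s) {B : Set (Config n)} {x : Config n}
    (hx : x ∉ B) : 0 ≤ generator Λ (indic B) x := by
  rw [generator_eq_bondRate]
  refine Finset.sum_nonneg fun i _ => integral_nonneg fun α => ?_
  refine smul_nonneg (mul_nonneg (h0 _) (jumpRate_nonneg _ _)) ?_
  rw [indic, indicator_of_notMem hx, sub_zero]
  exact indicator_nonneg (fun _ _ => zero_le_one) _

lemma generator_indic_nonpos (h0 : ∀ s, 0 ≤ Λ s) {B : Set (Config n)} {x : Config n}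
    (hx : x ∈ B) : generator Λ (indic B) x ≤ 0 := by
  rw [generator_eq_bondRate]
  refine Finset.sum_nonpos fun i _ => integral_nonpos fun α => ?_
  refine smul_nonpos_of_nonneg_of_nonpos (mul_nonneg (h0 _) (jumpRate_nonneg _ _)) ?_
  have := (le_abs_self _).trans (abs_indic_le B (exchange i α x))
  rw [show indic B x = 1 from indicator_of_mem hx _]
  linarith

/-- At a point of B every bond contributes a nonpositive integrand, so a zero sum forces each to
vanish almost everywhere; positivity of the rates then forbids leaving B. -/
lemma ae_exchange_mem_of_generator_eq_zero (hΛ : Measurable Λ) (hpos : ∀ s, 0 < Λ s)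
    (hM : ∀ s, Λ s ≤ M) {B : Set (Config n)} (hB : MeasurableSet B) {x : Config n} (hx : x ∈ B)
    (hnn : ∀ j, 0 ≤ x j) (h : generator Λ (indic B) x = 0) (i : Fin n) :
    ∀ᵐ α ∂unitVol, exchange i α x ∈ B := by
  have h0 : ∀ s, 0 ≤ Λ s := fun s => (hpos s).le
  have hle : ∀ j : Fin n, ∀ α, bondRate Λ j x α • (indic B (exchange j α x) - indic B x) ≤ 0 := by
    intro j α
    refine smul_nonpos_of_nonneg_of_nonpos (mul_nonneg (h0 _) (jumpRate_nonneg _ _)) ?_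
    have := (le_abs_self _).trans (abs_indic_le B (exchange j α x))
    rw [show indic B x = 1 from indicator_of_mem hx _]
    linarith
  rw [generator_eq_bondRate,
    Finset.sum_eq_zero_iff_of_nonpos fun j _ => integral_nonpos (hle j)] at h
  have hi := h i (Finset.mem_univ i)
  have hint : Integrable
      (fun α => bondRate Λ i x α • (indic B (exchange i α x) - indic B x)) unitVol := by
    have hk := isBoundedRate_bondRate hΛ h0 hM i
    refine Integrable.of_bound (C := M * (√(2 * Real.pi) / 2) * 2) ?_ (ae_of_all _ fun α => ?_)
    · have h1 : Measurable fun α => bondRate Λ i x α :=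
        hk.measurable.comp (measurable_const.prodMk measurable_id)
      have h2 : Measurable fun α => indic B (exchange i α x) :=
        (measurable_indic hB).comp (measurable_exchange_left i x)
      exact (h1.smul (h2.sub measurable_const)).aestronglyMeasurable
    · rw [norm_smul]
      refine mul_le_mul ?_ ?_ (norm_nonneg _) ((hk.nonneg x α).trans (hk.le x α))
      · rw [Real.norm_of_nonneg (hk.nonneg x α)]; exact hk.le x α
      · refine (norm_sub_le _ _).trans ?_
        have h1 := abs_indic_le B (exchange i α x)
        have h2 := abs_indic_le B x
        rw [Real.norm_eq_abs, Real.norm_eq_abs]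
        linarith
  have hz : (fun α => -(bondRate Λ i x α • (indic B (exchange i α x) - indic B x)))
      =ᵐ[unitVol] 0 := by
    refine (integral_eq_zero_iff_of_nonneg (fun α => neg_nonneg.2 (hle i α)) hint.neg).1 ?_
    rw [integral_neg, hi, neg_zero]
  filter_upwards [hz, ae_unitVol] with α h1 h2
  by_contra hout
  have hrate : 0 < bondRate Λ i x α := mul_pos (hpos _) (jumpRate_pos (ratio_mem i hnn) h2)
  simp only [Pi.zero_apply, indicator_of_mem hx, indicator_of_notMem hout, smul_eq_mul] at h1
  linarith

/-- `B` carries the positive part of `μ - π`, and its complement the negative part. -/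
structure IsHahnSet (μ π : Measure (Config n)) (B : Set (Config n)) : Prop where
  measurableSet : MeasurableSet B
  le_of_subset : ∀ E, MeasurableSet E → E ⊆ B → π E ≤ μ E
  le_of_subset_compl : ∀ E, MeasurableSet E → E ⊆ Bᶜ → μ E ≤ π E

/-- Let η be μ - π on B. Off B the generator of the indicator is nonnegative and μ ≤ π, so equality
of the total integrals makes its integral against η nonnegative; on B it is nonpositive. Hence it
vanishes η-almost everywhere, and discarding the rest of B loses no positive part. -/
lemma IsHahnSet.inter_generator {μ π : Measure (Config n)} [IsFiniteMeasure μ] [IsFiniteMeasure π]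
    (hΛ : Measurable Λ) (h0 : ∀ s, 0 ≤ Λ s) (hM : ∀ s, Λ s ≤ M) {B : Set (Config n)}
    (hB : IsHahnSet μ π B)
    (hst : ∫ x, generator Λ (indic B) x ∂μ = ∫ x, generator Λ (indic B) x ∂π) :
    IsHahnSet μ π (B ∩ {x | generator Λ (indic B) x = 0}) := by
  have hBm := hB.measurableSet
  set g := generator Λ (indic B) with hg
  have hgm : Measurable g := measurable_generator hΛ (measurable_indic hBm)
  have hgi : ∀ ρ : Measure (Config n), IsFiniteMeasure ρ → Integrable g ρ := fun ρ _ =>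
    integrable_generator hΛ h0 hM (measurable_indic hBm) (abs_indic_le B)
  have hZ : MeasurableSet {x | g x = 0} := hgm (measurableSet_singleton 0)
  have hle : π.restrict B ≤ μ.restrict B := by
    refine Measure.le_iff.2 fun E hE => ?_
    rw [Measure.restrict_apply hE, Measure.restrict_apply hE]
    exact hB.le_of_subset _ (hE.inter hBm) inter_subset_right
  have hle' : μ.restrict Bᶜ ≤ π.restrict Bᶜ := by
    refine Measure.le_iff.2 fun E hE => ?_
    rw [Measure.restrict_apply hE, Measure.restrict_apply hE]
    exact hB.le_of_subset_compl _ (hE.inter hBm.compl) inter_subset_right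
  have hc : ∫ x in Bᶜ, g x ∂μ ≤ ∫ x in Bᶜ, g x ∂π := by
    refine integral_mono_measure hle' ?_ (hgi _ inferInstance)
    exact ae_restrict_of_forall_mem hBm.compl fun x hx => generator_indic_nonneg h0 hx
  set η := μ.restrict B - π.restrict B with hη
  have hadd : η + π.restrict B = μ.restrict B := Measure.sub_add_cancel_of_le hle
  have hηac : ∀ᵐ x ∂η, x ∈ B := by
    have h1 : ∀ᵐ x ∂(μ.restrict B), x ∈ B := ae_restrict_mem hBm
    rw [← hadd, ae_add_measure_iff] at h1
    exact h1.1
  have hηfin : IsFiniteMeasure η := by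
    refine ⟨lt_of_le_of_lt ?_ (measure_lt_top (μ.restrict B) univ)⟩
    rw [← hadd]
    exact le_self_add
  have hηz : 0 ≤ ∫ x, g x ∂η := by
    have h1 := integral_add_compl hBm (hgi μ inferInstance)
    have h2 := integral_add_compl hBm (hgi π inferInstance)
    have h3 : ∫ x in B, g x ∂μ = ∫ x, g x ∂η + ∫ x in B, g x ∂π := by
      rw [← integral_add_measure (hgi _ inferInstance) (hgi _ inferInstance), hadd]
    linarith
  have hae : ∀ᵐ x ∂η, g x = 0 := by
    have h1 : 0 ≤ᵐ[η] fun x => -g x := by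
      filter_upwards [hηac] with x hx
      exact neg_nonneg.2 (generator_indic_nonpos h0 hx)
    have h2 : ∫ x, -g x ∂η = 0 := by
      have h3 := integral_nonneg_of_ae h1
      rw [integral_neg] at h3 ⊢
      linarith
    filter_upwards [(integral_eq_zero_iff_of_nonneg_ae h1 (hgi η hηfin).neg).1 h2] with x hx
    simpa using hx
  refine ⟨hBm.inter hZ, fun E hE hsub => hB.le_of_subset E hE (hsub.trans inter_subset_left),
    fun E hE hsub => ?_⟩
  rw [← measure_inter_add_sdiff E hBm, ← measure_inter_add_sdiff (μ := π) E hBm]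
  refine add_le_add ?_ (hB.le_of_subset_compl _ (hE.diff hBm) fun x hx => hx.2)
  rw [← Measure.restrict_apply hE, ← Measure.restrict_apply hE, ← hadd, Measure.add_apply]
  have hEη : η E = 0 := by
    refine measure_mono_null (t := {x | ¬ (x ∈ B ∧ g x = 0)}) (fun x hx hx' => hsub hx hx') ?_
    exact ae_iff.1 (hηac.and hae)
  rw [hEη, zero_add]

/-- The lower bound is inherited from the first set, the upper bound by monotone convergence along
the growing complements. -/
lemma IsHahnSet.iInter {μ π : Measure (Config n)} {B : ℕ → Set (Config n)}
    (hB : ∀ k, IsHahnSet μ π (B k)) (hanti : Antitone B) : IsHahnSet μ π (⋂ k, B k) := by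
  refine ⟨MeasurableSet.iInter fun k => (hB k).measurableSet, fun E hE hsub =>
    (hB 0).le_of_subset E hE (hsub.trans (iInter_subset _ 0)), fun E hE hsub => ?_⟩
  have hun : E = ⋃ k, E ∩ (B k)ᶜ := by
    rw [← inter_iUnion, ← compl_iInter, inter_eq_left.2 hsub]
  have hmono : Monotone fun k => E ∩ (B k)ᶜ := fun a b hab =>
    inter_subset_inter_right _ (compl_subset_compl.2 (hanti hab))
  rw [hun, hmono.measure_iUnion, hmono.measure_iUnion]
  exact iSup_mono fun k => (hB k).le_of_subset_compl _ (hE.inter (hB k).measurableSet.compl)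
    inter_subset_right

/-- Invariant sets of the simplex have full measure unless they are null. -/
lemma condLaw_compl_eq_zero_of_invariant (hn : 1 ≤ n) {ε : ℝ} (hε : 0 < ε) {B : Set (Config n)}
    (hB : MeasurableSet B) (hinv : IsExchangeInvariant B) (hne : condLaw n ε B ≠ 0) :
    condLaw n ε Bᶜ = 0 := by
  open scoped InnerProductSpace in
  have hmem : MemLp (B.indicator fun _ => (1 : ℂ)) 2 (condLaw n ε) :=
    (memLp_const 1).indicator hB
  set f := hmem.toLp with hf
  set e := oneL2 (condLaw n ε) with he
  set p := ⟪e, f⟫_ℂ with hp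
  -- Starting in B the indicator does not change under almost every resampling, and off B the other
  -- factor is zero.
  have hff : ∀ i, ⟪f, heatOp hε i f⟫_ℂ = 0 := by
    intro i
    rw [L2.inner_def]
    refine integral_eq_zero_of_ae ?_
    filter_upwards [hmem.coeFn_toLp, bondOp_toLp isBoundedRate_heat (isSymmetricOn_heat hε i) hmem]
      with x h1 h2
    rw [heatOp, h2, hf, h1]
    by_cases hx : x ∈ B
    · rw [integral_eq_zero_of_ae, inner_zero_right]; · rfl
      filter_upwards [hinv x hx i] with α hα
      simp [hx, hα]
    · simp [hx]
  have hef : ∀ i, ⟪e, heatOp hε i f⟫_ℂ = 0 := by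
    intro i
    rw [heatOp, ← bondOp_inner_symm, bondOp_oneL2, inner_zero_left]
  have hee : ⟪e, e⟫_ℂ = 1 := by
    rw [inner_self_eq_norm_sq_to_K, he, norm_oneL2]; simp
  have hgap := heat_gap hn hε (f - p • e) (by
    rw [inner_sub_right, inner_smul_right, hee, mul_one, sub_self])
  have hzero : ∀ i, ⟪f - p • e, heatOp hε i (f - p • e)⟫_ℂ = 0 := by
    intro i
    have h1 : heatOp hε i (f - p • e) = heatOp hε i f := by
      rw [map_sub, map_smul, heatOp, bondOp_oneL2, smul_zero, sub_zero]
    rw [h1, inner_sub_left, inner_smul_left, hff, hef, mul_zero, sub_zero]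
  simp only [hzero, Complex.zero_re, Finset.sum_const_zero] at hgap
  have hcos : Real.cos (Real.pi / ((n : ℝ) + 1)) < 1 := by
    have hpi := Real.pi_pos
    have hn' : (0 : ℝ) < (n : ℝ) + 1 := by positivity
    have h1 : Real.pi / ((n : ℝ) + 1) ≤ Real.pi := div_le_self hpi.le (by
      have : (0 : ℝ) ≤ n := by positivity
      linarith)
    simpa using Real.cos_lt_cos_of_nonneg_of_le_pi le_rfl h1 (by positivity)
  -- The mean-zero part has zero form, so a strictly positive gap leaves only a constant; an
  -- indicator that is almost surely constant is 0 or 1.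
  have hnorm : ‖f - p • e‖ ^ 2 = 0 := by
    have := sq_nonneg ‖f - p • e‖
    nlinarith
  have hfe : f = p • e := by
    rw [← sub_eq_zero, ← norm_eq_zero]
    exact pow_eq_zero_iff two_ne_zero |>.1 hnorm
  have hae : ∀ᵐ x ∂(condLaw n ε), B.indicator (fun _ => (1 : ℂ)) x = p := by
    have h1 : (e : Config n → ℂ) =ᵐ[condLaw n ε] fun _ => 1 := MemLp.coeFn_toLp _
    filter_upwards [hmem.coeFn_toLp, h1, Lp.coeFn_smul p e] with x h1 h2 h3
    rw [← h1, ← hf, hfe, h3, Pi.smul_apply, h2, smul_eq_mul, mul_one]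
  obtain ⟨y, hy, hy'⟩ : ∃ y ∈ B, B.indicator (fun _ => (1 : ℂ)) y = p := by
    by_contra! hcon
    refine hne (measure_mono_null (fun x hx => ?_) (ae_iff.1 hae))
    exact hcon x hx
  rw [indicator_of_mem hy] at hy'
  rw [← hy'] at hae
  refine measure_mono_null (fun x hx => ?_) (ae_iff.1 hae)
  change ¬ (B.indicator (fun _ => (1 : ℂ)) x = 1)
  rw [indicator_of_notMem hx]
  exact zero_ne_one

lemma eq_of_le_of_isProbabilityMeasure {X : Type*} [MeasurableSpace X] {μ ν : Measure X}
    [IsProbabilityMeasure μ] [IsProbabilityMeasure ν] (h : μ ≤ ν) : μ = ν :=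
  Measure.eq_of_le_of_measure_univ_eq h (by simp)

/-- The conditional law is the only stationary law on the simplex. -/
theorem isStationaryOn_iff {Λs : ℝ → ℝ} (hΛs : ContinuousOn Λs (Ici 0)) {c : ℝ} (hc : 0 < c)
    (hΛc : ∀ s, 0 ≤ s → c ≤ Λs s) (hn : 1 ≤ n) {ε : ℝ} (hε : 0 < ε) (μ : Measure (Config n)) :
    IsStationaryOn Λs ε μ ↔ μ = condLaw n ε := by
  have hst := isStationaryOn_condLaw (n := n) hΛs (fun s hs => hc.le.trans (hΛc s hs)) hε
  refine ⟨fun hμ => ?_, fun h => h ▸ hst⟩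
  have := hμ.isProbabilityMeasure
  have hcont := continuous_clamp hΛs ((n + 1) * ε)
  obtain ⟨M, hM⟩ := exists_clamp_le hΛs ((n + 1) * ε)
  set Λ := clamp ((n + 1) * ε) Λs with hΛ
  have hpos : ∀ s, 0 < Λ s := fun s => hc.trans_le (hΛc _ (le_max_left _ _))
  have h0 : ∀ s, 0 ≤ Λ s := fun s => (hpos s).le
  have hclamp : ∀ ρ : Measure (Config n), IsStationaryOn Λs ε ρ → ∀ B : Set (Config n),
      MeasurableSet B → ∫ x, generator Λ (indic B) x ∂ρ = 0 := by
    intro ρ hρ B hB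
    rw [← hρ.integral_generator (indic B) (measurable_indic hB) ⟨1, abs_indic_le B⟩]
    refine integral_congr_ae ?_
    have h1 : ∀ᵐ x ∂ρ, x ∈ simplex n ε := mem_ae_iff.2 hρ.concentrated
    filter_upwards [h1] with x hx
    exact generator_clamp Λs _ hx
  obtain ⟨B₀, hB₀, hge, hle⟩ := hahn_decomposition μ (condLaw n ε)
  have hsimp := measurableSet_simplex n ε
  have hnull : ∀ ρ : Measure (Config n), ρ (simplex n ε)ᶜ = 0 → ∀ E : Set (Config n),
      ρ (E ∩ simplex n ε) = ρ E := by
    intro ρ hρ E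
    exact measure_inter_conull hρ
  -- One pruning step ensures that points kept in the next set jump into the present one. Only the
  -- intersection is stable: a point of it lies in B (k+1) for every k, so almost every exchange
  -- stays in every B k.
  let B : ℕ → Set (Config n) := fun k => Nat.rec (B₀ ∩ simplex n ε)
    (fun _ S => S ∩ {x | generator Λ (indic S) x = 0}) k
  have hBsucc : ∀ k, B (k + 1) = B k ∩ {x | generator Λ (indic (B k)) x = 0} := fun k => rfl
  have hanti : Antitone B := antitone_nat_of_succ_le fun k => inter_subset_left
  have hHahn : ∀ k, IsHahnSet μ (condLaw n ε) (B k) := by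
    intro k
    induction k with
    | zero =>
      refine ⟨hB₀.inter hsimp, fun E hE hsub => hge E hE (hsub.trans inter_subset_left),
        fun E hE hsub => ?_⟩
      rw [← hnull μ hμ.concentrated E, ← hnull _ hst.concentrated E]
      exact hle _ (hE.inter hsimp) fun x hx hx' => hsub hx.1 ⟨hx', hx.2⟩
    | succ k ih =>
      rw [hBsucc]
      refine ih.inter_generator hcont.measurable h0 hM ?_
      rw [hclamp μ hμ _ ih.measurableSet, hclamp _ hst _ ih.measurableSet]
  have hlim := IsHahnSet.iInter hHahn hanti
  have hsub : (⋂ k, B k) ⊆ simplex n ε := (iInter_subset _ 0).trans inter_subset_right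
  have hinv : IsExchangeInvariant (⋂ k, B k) := by
    intro x hx i
    have h1 : ∀ᵐ α ∂unitVol, ∀ k, exchange i α x ∈ B k := by
      rw [ae_all_iff]
      intro k
      have h2 := mem_iInter.1 hx (k + 1)
      rw [hBsucc] at h2
      exact ae_exchange_mem_of_generator_eq_zero hcont.measurable hpos hM (hHahn k).measurableSet
        h2.1 (hsub hx).1 h2.2 i
    filter_upwards [h1] with α hα
    exact mem_iInter.2 hα
  -- Null means empty, so μ ≤ π on every set; otherwise the set is full for π and π ≤ μ. Equal total
  -- masses turn either inequality into equality.
  by_cases hz : condLaw n ε (⋂ k, B k) = 0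
  · have hempty := eq_empty_of_invariant_null hε hlim.measurableSet hsub hinv hz
    refine eq_of_le_of_isProbabilityMeasure (Measure.le_iff.2 fun E hE => ?_)
    exact hlim.le_of_subset_compl E hE (by rw [hempty, compl_empty]; exact subset_univ E)
  · have hfull := condLaw_compl_eq_zero_of_invariant hn hε hlim.measurableSet hinv hz
    refine (eq_of_le_of_isProbabilityMeasure (Measure.le_iff.2 fun E hE => ?_)).symm
    rw [← measure_inter_conull (s := E) hfull]
    exact (hlim.le_of_subset _ (hE.inter hlim.measurableSet) inter_subset_right).trans
      (measure_mono inter_subset_left)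

end Stationary

/-! ### Reversibility of the Gamma product laws -/

/-- The diagonal terms f(x,x) agree on both sides, and the rest is the symmetry of the jump measure.
-/
lemma integral_jump_swap {n : ℕ} {i : Fin n} {k : Config n → ℝ → ℝ} {M : ℝ}
    {π : Measure (Config n)} [IsFiniteMeasure π] (hk : IsBoundedRate k M)
    (hs : IsSymmetricOn i k π) {f : Config n → Config n → ℝ}
    (hf : Measurable (Function.uncurry f)) {B : ℝ} (hB : ∀ x y, |f x y| ≤ B) :
    Integrable (fun x => ∫ α, k x α • (f (exchange i α x) x - f x x) ∂unitVol) π ∧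
    Integrable (fun x => ∫ α, k x α • (f x (exchange i α x) - f x x) ∂unitVol) π ∧
    ∫ x, ∫ α, k x α • (f (exchange i α x) x - f x x) ∂unitVol ∂π =
      ∫ x, ∫ α, k x α • (f x (exchange i α x) - f x x) ∂unitVol ∂π := by
  have := isFiniteMeasure_jumpMeasure (π := π) hk
  have ht := measurable_target i
  have hi : ∀ {u : Config n × ℝ → Config n × Config n}, Measurable u →
      Integrable (fun p => Function.uncurry f (u p)) (jumpMeasure k π) := fun hu =>
    Integrable.of_bound (hf.comp hu).aestronglyMeasurable B (ae_of_all _ fun p => hB _ _)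
  have h1 := hi (ht.prodMk measurable_fst)
  have h2 := hi (measurable_fst.prodMk ht)
  have h3 := hi (measurable_fst.prodMk (measurable_fst (α := Config n) (β := ℝ)))
  have e1 := integral_jumpMeasure hk (h1.sub h3)
  have e2 := integral_jumpMeasure hk (h2.sub h3)
  have hsw : ∫ p, Function.uncurry f (target i p, p.1) ∂(jumpMeasure k π) =
      ∫ p, Function.uncurry f (p.1, target i p) ∂(jumpMeasure k π) := by
    rw [← integral_map (f := Function.uncurry f) (ht.prodMk measurable_fst).aemeasurable
      hf.aestronglyMeasurable, ← map_jumpMeasure_swap hk hs,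
      integral_map (measurable_fst.prodMk ht).aemeasurable hf.aestronglyMeasurable]
  refine ⟨e1.1, e2.1, ?_⟩
  refine (e1.2.symm.trans ?_).trans e2.2
  simp only [Pi.sub_apply]
  rw [integral_sub h1 h3, integral_sub h2 h3, hsw]

lemma bondEnergy_le_sum {n : ℕ} (i : Fin n) {x : Config n} (hx : ∀ j, 0 ≤ x j) :
    bondEnergy i x ≤ ∑ j, x j := by
  rw [bondEnergy, ← Finset.sum_pair (castSucc_ne_succ i)]
  exact Finset.sum_le_sum_of_subset_of_nonneg (Finset.subset_univ _) fun j _ _ => hx j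

/-- Λ_s may be unbounded, so one works on {total energy ≤ R}. Total energy is conserved, hence the
cutoff preserves symmetry, and rates are bounded there; the assumed integrability lets R tend to
infinity. -/
theorem isReversible_gibbs {Λs : ℝ → ℝ} (hΛs : ContinuousOn Λs (Ici 0))
    (h0 : ∀ s, 0 ≤ s → 0 ≤ Λs s) {n : ℕ} {ε : ℝ} (hε : 0 < ε) : IsReversible Λs (gibbs n ε) := by
  have := Fact.mk hε
  rintro f hf ⟨B, hB⟩ hi1 hi2
  let S : ℕ → Set (Config n) := fun R => {x | ∑ j, x j ≤ R}
  have hS : ∀ R, MeasurableSet (S R) := fun R => measurableSet_le (by fun_prop) measurable_const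
  have hmono : Monotone S := fun a b hab x (hx : ∑ j, x j ≤ a) =>
    show ∑ j, x j ≤ b from hx.trans (Nat.cast_le.2 hab)
  have hun : ⋃ R, S R = univ := eq_univ_of_forall fun x => by
    obtain ⟨R, hR⟩ := exists_nat_ge (∑ j, x j)
    exact mem_iUnion.2 ⟨R, hR⟩
  have key : ∀ R : ℕ, ∫ x in S R, generator Λs (fun y => f y x) x ∂(gibbs n ε) =
      ∫ x in S R, generator Λs (fun y => f x y) x ∂(gibbs n ε) := by
    intro R
    have hcont := continuous_clamp hΛs R
    obtain ⟨M, hM⟩ := exists_clamp_le hΛs R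
    have h0' : ∀ s, 0 ≤ clamp R Λs s := fun s => h0 _ (le_max_left _ _)
    let c : Fin n → Config n → ℝ := fun i x =>
      (S R).indicator (fun _ => 1) x * clamp R Λs (bondEnergy i x)
    have hind : Measurable ((S R).indicator fun _ => (1 : ℝ)) := measurable_const.indicator (hS R)
    have hind0 : ∀ x, 0 ≤ (S R).indicator (fun _ => (1 : ℝ)) x :=
      fun x => indicator_nonneg (fun _ _ => zero_le_one) x
    have hind1 : ∀ x, (S R).indicator (fun _ => (1 : ℝ)) x ≤ 1 :=
      fun x => indicator_le_self' (fun _ _ => zero_le_one) x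
    have hc : ∀ i, Measurable (c i) := fun i =>
      hind.mul (hcont.measurable.comp (measurable_bondEnergy i))
    have hc0 : ∀ i x, 0 ≤ c i x := fun i x => mul_nonneg (hind0 x) (h0' _)
    have hcM : ∀ i x, c i x ≤ M := fun i x =>
      (mul_le_of_le_one_left (h0' _) (hind1 x)).trans (hM _)
    let k : Fin n → Config n → ℝ → ℝ := fun i x α => c i x * jumpRate (ratio i x) α
    have hk : ∀ i, IsBoundedRate (k i) (M * (√(2 * Real.pi) / 2)) := fun i =>
      ⟨((hc i).comp measurable_fst).mul (measurable_jumpRate.comp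
        (((measurable_ratio i).comp measurable_fst).prodMk measurable_snd)),
        fun x α => mul_nonneg (hc0 i x) (jumpRate_nonneg _ _),
        fun x α => mul_le_mul (hcM i x) (jumpRate_le _ _) (jumpRate_nonneg _ _)
          ((hc0 i x).trans (hcM i x))⟩
    have hsym : ∀ i, IsSymmetricOn i (k i) (gibbs n ε) := fun i =>
      (isSymmetricOn_pi_siteLaw i hε (κ := jumpRate) measurable_jumpRate
        fun _ hβ _ hα => detailed_balance hβ hα).mul_left (hc i) (hc0 i) fun α x => by
          have : exchange i α x ∈ S R ↔ x ∈ S R := by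
            change ∑ j, exchange i α x j ≤ R ↔ ∑ j, x j ≤ R
            rw [sum_exchange]
          simp only [c, bondEnergy_exchange, indicator_apply, this]
    have hsw := fun i => integral_jump_swap (hk i) (hsym i) hf hB
    have e : ∀ A : Config n → Config n → ℝ,
        (S R).indicator (fun x => generator Λs (A x) x) =ᵐ[gibbs n ε] fun x => ∑ i : Fin n,
          ∫ α, k i x α • (A x (exchange i α x) - A x x) ∂unitVol := by
      intro A
      filter_upwards [ae_gibbs_pos hε] with x hx
      by_cases hxS : x ∈ S R
      · rw [indicator_of_mem hxS, generator_eq]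
        refine Finset.sum_congr rfl fun i _ => ?_
        have hmem : bondEnergy i x ∈ Icc (0 : ℝ) R :=
          ⟨bondEnergy_nonneg i fun j => (hx j).le,
            (bondEnergy_le_sum i fun j => (hx j).le).trans hxS⟩
        simp only [k, c, indicator_of_mem hxS, one_mul, clamp_of_mem Λs hmem]
      · simp [k, c, hxS]
    rw [← integral_indicator (hS R), ← integral_indicator (hS R),
      integral_congr_ae (e fun x y => f y x), integral_congr_ae (e fun x y => f x y),
      integral_finsetSum _ fun i _ => (hsw i).1, integral_finsetSum _ fun i _ => (hsw i).2.1]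
    exact Finset.sum_congr rfl fun i _ => (hsw i).2.2
  have t1 := tendsto_setIntegral_of_monotone hS hmono hi1.integrableOn
  have t2 := tendsto_setIntegral_of_monotone hS hmono hi2.integrableOn
  simp only [hun, setIntegral_univ, key] at t1 t2
  exact tendsto_nhds_unique t1 t2

/-! ### Reversible laws are invariant under the heat bath of a bond -/

section Reversible

variable {n : ℕ} {Λ : ℝ → ℝ} {c : ℝ}

/-- Distinct bonds share at most one site, so an exchange across j that alters only sites of bond i
leaves one site of j unchanged, and by conservation the other too. This lets a test function single
out one bond. -/
lemma exchange_eq_self_of_ne {i j : Fin n} (hij : j ≠ i) {α : ℝ} {x : Config n}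
    (h : ∀ k : Fin (n + 1), k ≠ i.castSucc → k ≠ i.succ → exchange j α x k = x k) :
    exchange j α x = x := by
  have hv : j.val ≠ i.val := fun h => hij (Fin.ext h)
  have hor : α * bondEnergy j x = x j.castSucc ∨ (1 - α) * bondEnergy j x = x j.succ := by
    by_cases h1 : j.val = i.val + 1
    · right
      rw [← exchange_succ]
      refine h _ (fun h2 => ?_) (fun h2 => ?_)
      · have := congrArg Fin.val h2
        simp at this
        omega
      · have := congrArg Fin.val h2
        simp at this
        omega
    · left
      rw [← exchange_castSucc]
      refine h _ (fun h2 => ?_) (fun h2 => ?_)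
      · have := congrArg Fin.val h2
        simp at this
        omega
      · have := congrArg Fin.val h2
        simp at this
        omega
  have hb : bondEnergy j x = x j.castSucc + x j.succ := rfl
  ext k
  by_cases h₂ : k = j.succ
  · subst h₂; rw [exchange_succ]; rcases hor with h | h <;> linarith
  · by_cases h₁ : k = j.castSucc
    · subst h₁; rw [exchange_castSucc]; rcases hor with h | h <;> linarith
    · rw [exchange_of_ne _ _ h₁ h₂]

/-- The pairs of distinct configurations connected by an exchange across bond `i`. -/
def bondPairs (i : Fin n) : Set (Config n × Config n) :=
  {p | ((∀ j, 0 ≤ p.1 j) ∧ (∀ j, 0 ≤ p.2 j)) ∧ p.1 ≠ p.2 ∧ 0 < bondEnergy i p.2 ∧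
    ∀ j, j ≠ i.castSucc → j ≠ i.succ → p.1 j = p.2 j}

lemma measurableSet_bondPairs (i : Fin n) : MeasurableSet (bondPairs i) := by
  have heq : {p : Config n × Config n | ∀ j, j ≠ i.castSucc → j ≠ i.succ → p.1 j = p.2 j} =
      ⋂ j, ⋂ (_ : j ≠ i.castSucc), ⋂ (_ : j ≠ i.succ), {p | p.1 j = p.2 j} := by
    ext p; simp
  have hm : MeasurableSet
      {p : Config n × Config n | ∀ j, j ≠ i.castSucc → j ≠ i.succ → p.1 j = p.2 j} := by
    rw [heq]
    exact MeasurableSet.iInter fun j => MeasurableSet.iInter fun _ => MeasurableSet.iInter fun _ =>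
      measurableSet_eq_fun (by fun_prop) (by fun_prop)
  exact ((measurable_fst (measurableSet_nonneg n)).inter
    (measurable_snd (measurableSet_nonneg n))).inter
    ((isClosed_eq continuous_fst continuous_snd).measurableSet.compl.inter
    ((measurableSet_lt measurable_const ((measurable_bondEnergy i).comp measurable_snd)).inter hm))

/-- The test function that replaces the jump rates across bond `i` by those of the heat bath. -/
def heatTest (Λ : ℝ → ℝ) (i : Fin n) (G : Config n → ℝ) (y x : Config n) : ℝ :=
  (bondPairs i).indicator (fun p => ratioWeight (ratio i p.1) /
    (Λ (bondEnergy i p.2) * jumpRate (ratio i p.2) (ratio i p.1)) * G p.2) (y, x)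

lemma measurable_heatTest (hΛ : Measurable Λ) (i : Fin n) {G : Config n → ℝ} (hG : Measurable G) :
    Measurable (Function.uncurry (heatTest Λ i G)) := by
  refine Measurable.indicator ?_ (measurableSet_bondPairs i)
  have h1 : Measurable fun p : Config n × Config n => jumpRate (ratio i p.2) (ratio i p.1) :=
    measurable_jumpRate.comp (((measurable_ratio i).comp measurable_snd).prodMk
      ((measurable_ratio i).comp measurable_fst))
  have h2 : Measurable fun p : Config n × Config n => Λ (bondEnergy i p.2) :=
    hΛ.comp ((measurable_bondEnergy i).comp measurable_snd)
  have h3 : Measurable fun p : Config n × Config n => ratioWeight (ratio i p.1) :=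
    measurable_ratioWeight.comp ((measurable_ratio i).comp measurable_fst)
  exact (h3.div (h2.mul h1)).mul (hG.comp measurable_snd)

/-- The minorization of the jump density keeps the quotient bounded even where the density is small.
-/
lemma abs_heatTest_le (hc : 0 < c) (hΛc : ∀ s, c ≤ Λ s) (i : Fin n) {G : Config n → ℝ} {B : ℝ}
    (hB : ∀ x, |G x| ≤ B) (y x : Config n) :
    |heatTest Λ i G y x| ≤ 1 / (c * (√(2 * Real.pi) / 4)) * B := by
  have hB0 : 0 ≤ B := (abs_nonneg _).trans (hB 0)
  have hs : 0 < √(2 * Real.pi) / 4 := by positivity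
  rw [heatTest]
  by_cases h : (y, x) ∈ bondPairs i
  · rw [indicator_of_mem h, abs_mul]
    refine mul_le_mul ?_ (hB _) (abs_nonneg _) (by positivity)
    have h1 := ratioWeight_le_jumpRate (ratio_mem i h.1.2) (ratio_mem i h.1.1)
    have hw := ratioWeight_nonneg (ratio i y)
    have hJ := jumpRate_nonneg (ratio i x) (ratio i y)
    have hL := hΛc (bondEnergy i x)
    dsimp only at h1 ⊢
    rw [abs_of_nonneg (div_nonneg hw (mul_nonneg (hc.le.trans hL) hJ))]
    -- Where the jump density vanishes the quotient is zero by the convention for division.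
    rcases hJ.eq_or_lt with hJ0 | hJ0
    · rw [← hJ0, mul_zero, div_zero]; positivity
    · rw [div_le_div_iff₀ (mul_pos (hc.trans_le hL) hJ0) (by positivity), one_mul]
      calc ratioWeight (ratio i y) * (c * (√(2 * Real.pi) / 4))
          = c * (√(2 * Real.pi) / 4 * ratioWeight (ratio i y)) := by ring
        _ ≤ _ := mul_le_mul hL h1 (by positivity) (hc.le.trans hL)
  · rw [indicator_of_notMem h, abs_zero]; positivity

lemma heatTest_self (i : Fin n) (G : Config n → ℝ) (x : Config n) : heatTest Λ i G x x = 0 :=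
  indicator_of_notMem (fun h => h.2.1 rfl) _

lemma heatTest_eq_zero {i j : Fin n} (hij : j ≠ i) (G : Config n → ℝ) (α : ℝ) (x : Config n) :
    heatTest Λ i G (exchange j α x) x = 0 ∧ heatTest Λ i G x (exchange j α x) = 0 := by
  refine ⟨indicator_of_notMem (fun h => h.2.1 ?_) _, indicator_of_notMem (fun h => h.2.1 ?_) _⟩
  · exact exchange_eq_self_of_ne hij h.2.2.2
  · exact (exchange_eq_self_of_ne hij fun k h1 h2 => (h.2.2.2 k h1 h2).symm).symm

lemma exchange_ne {i : Fin n} {α : ℝ} {x : Config n} (hs : 0 < bondEnergy i x)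
    (hne : α ≠ ratio i x) : exchange i α x ≠ x := by
  intro h
  have := ratio_exchange i α hs.ne'
  rw [h] at this
  exact hne this.symm

lemma ae_ne_unitVol (β : ℝ) : ∀ᵐ α ∂unitVol, α ≠ β :=
  ae_restrict_of_ae (by
    rw [ae_iff]
    simp)

/-- The quotient cancels the rate of the jump from x and leaves w(α). The excluded diagonal is only
the null event that α is the present ratio. -/
lemma generator_heatTest_left (hc : 0 < c) (hΛc : ∀ s, c ≤ Λ s) (i : Fin n) (G : Config n → ℝ)
    {x : Config n} (hx : ∀ j, 0 ≤ x j) : generator Λ (fun y => heatTest Λ i G y x) x =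
      {x | 0 < bondEnergy i x}.indicator (fun x => weightMass * G x) x := by
  rw [generator_eq, Finset.sum_eq_single i]
  · by_cases hs : 0 < bondEnergy i x
    · rw [indicator_of_mem (by exact hs), weightMass, ← integral_mul_const]
      refine integral_congr_ae ?_
      filter_upwards [ae_unitVol, ae_ne_unitVol (ratio i x)] with α hα hne
      have hmem : (exchange i α x, x) ∈ bondPairs i :=
        ⟨⟨exchange_nonneg i (Ioo_subset_Icc_self hα) hx, hx⟩, exchange_ne hs hne, hs,
          fun j h1 h2 => exchange_of_ne α x h1 h2⟩
      have hJ := (jumpRate_pos (ratio_mem i hx) hα).ne'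
      have hL := (hc.trans_le (hΛc (bondEnergy i x))).ne'
      rw [heatTest_self, sub_zero, heatTest, indicator_of_mem hmem]
      simp only [ratio_exchange i α hs.ne', smul_eq_mul]
      field_simp
    · rw [indicator_of_notMem (by exact hs)]
      refine integral_eq_zero_of_ae (ae_of_all _ fun α => ?_)
      have h1 : heatTest Λ i G (exchange i α x) x = 0 :=
        indicator_of_notMem (fun h => hs h.2.2.1) _
      simp [h1, heatTest_self]
  · intro j _ hj
    simp [(heatTest_eq_zero hj G _ x).1, heatTest_self]
  · simp

/-- Now the quotient carries the rate of the reverse jump, and detailed balance converts w at the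
old ratio into w(α). At ratios 0 and 1 the weight w vanishes, which restricts the domain. -/
lemma generator_heatTest_right (hc : 0 < c) (hΛc : ∀ s, c ≤ Λ s) (i : Fin n) (G : Config n → ℝ)
    {x : Config n} (hx : ∀ j, 0 ≤ x j) : generator Λ (fun y => heatTest Λ i G x y) x =
      {x | 0 < bondEnergy i x ∧ ratio i x ∈ Ioo (0 : ℝ) 1}.indicator
        (fun x => ∫ α, ratioWeight α * G (exchange i α x) ∂unitVol) x := by
  rw [generator_eq, Finset.sum_eq_single i]
  · by_cases hs : 0 < bondEnergy i x ∧ ratio i x ∈ Ioo (0 : ℝ) 1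
    · rw [indicator_of_mem (by exact hs)]
      refine integral_congr_ae ?_
      filter_upwards [ae_unitVol, ae_ne_unitVol (ratio i x)] with α hα hne
      have hmem : (x, exchange i α x) ∈ bondPairs i :=
        ⟨⟨hx, exchange_nonneg i (Ioo_subset_Icc_self hα) hx⟩, (exchange_ne hs.1 hne).symm,
          by rw [bondEnergy_exchange]; exact hs.1,
          fun j h1 h2 => (exchange_of_ne α x h1 h2).symm⟩
      have hJ := (jumpRate_pos (Ioo_subset_Icc_self hα) hs.2).ne'
      have hL := (hc.trans_le (hΛc (bondEnergy i x))).ne'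
      have hbal := detailed_balance hs.2 hα
      rw [heatTest_self, sub_zero, heatTest, indicator_of_mem hmem]
      simp only [ratio_exchange i α hs.1.ne', bondEnergy_exchange, smul_eq_mul]
      field_simp
      rw [mul_comm (jumpRate _ _) (ratioWeight _), hbal]
      ring
    · rw [indicator_of_notMem (by exact hs)]
      refine integral_eq_zero_of_ae (ae_of_all _ fun α => ?_)
      have h1 : heatTest Λ i G x (exchange i α x) = 0 := by
        rw [heatTest]
        by_cases hmem : (x, exchange i α x) ∈ bondPairs i
        · rw [indicator_of_mem hmem]
          have hs' : 0 < bondEnergy i x := by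
            have := hmem.2.2.1
            rwa [bondEnergy_exchange] at this
          have hr := ratio_mem i hx
          have hw : ratioWeight (ratio i x) = 0 := by
            by_contra hw
            refine hs ⟨hs', lt_of_le_of_ne hr.1 fun h => hw ?_, lt_of_le_of_ne hr.2 fun h => hw ?_⟩
            · rw [← h]; simp [ratioWeight]
            · rw [h]; simp [ratioWeight]
          simp [hw]
        · rw [indicator_of_notMem hmem]
      simp [h1, heatTest_self]
  · intro j _ hj
    simp [(heatTest_eq_zero hj G _ x).2, heatTest_self]
  · simp

lemma measurable_integral_exchange (i : Fin n) {u : ℝ → ℝ} (hu : Measurable u)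
    {G : Config n → ℝ} (hG : Measurable G) :
    Measurable fun x => ∫ α, u α * G (exchange i α x) ∂unitVol := by
  have h : Measurable fun p : Config n × ℝ => u p.2 * G (exchange i p.2 p.1) :=
    (hu.comp measurable_snd).mul (hG.comp (measurable_exchange i))
  exact (h.stronglyMeasurable.integral_prod_right' (ν := unitVol)).measurable

lemma abs_integral_exchange_le (i : Fin n) {G : Config n → ℝ} {B : ℝ}
    (hB : ∀ x, |G x| ≤ B) (x : Config n) :
    |∫ α, ratioWeight α * G (exchange i α x) ∂unitVol| ≤ B := by
  have h := norm_integral_le_of_norm_le_const (μ := unitVol) (C := B)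
    (f := fun α => ratioWeight α * G (exchange i α x)) (ae_of_all _ fun α => by
      rw [norm_mul, Real.norm_of_nonneg (ratioWeight_nonneg α), Real.norm_eq_abs]
      exact (mul_le_of_le_one_left (abs_nonneg _) (ratioWeight_le_one α)).trans (hB _))
  simpa using h

lemma IsReversible.setIntegral_eq {μ : Measure (Config n)} [IsProbabilityMeasure μ]
    (hμ : ∀ᵐ x ∂μ, ∀ j, 0 ≤ x j) (hΛ : Measurable Λ) (hc : 0 < c) (hΛc : ∀ s, c ≤ Λ s)
    (hrev : IsReversible Λ μ) (i : Fin n) {G : Config n → ℝ} (hG : Measurable G) {B : ℝ}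
    (hB : ∀ x, |G x| ≤ B) :
    ∫ x in {x | 0 < bondEnergy i x}, weightMass * G x ∂μ =
      ∫ x in {x | 0 < bondEnergy i x ∧ ratio i x ∈ Ioo (0 : ℝ) 1},
        ∫ α, ratioWeight α * G (exchange i α x) ∂unitVol ∂μ := by
  have hE : MeasurableSet {x : Config n | 0 < bondEnergy i x} :=
    measurableSet_lt measurable_const (measurable_bondEnergy i)
  have hE' : MeasurableSet {x : Config n | 0 < bondEnergy i x ∧ ratio i x ∈ Ioo (0 : ℝ) 1} :=
    hE.inter (measurable_ratio i measurableSet_Ioo)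
  have e1 : (fun x => generator Λ (fun y => heatTest Λ i G y x) x) =ᵐ[μ]
      {x | 0 < bondEnergy i x}.indicator fun x => weightMass * G x := by
    filter_upwards [hμ] with x hx
    exact generator_heatTest_left hc hΛc i G hx
  have e2 : (fun x => generator Λ (fun y => heatTest Λ i G x y) x) =ᵐ[μ]
      {x | 0 < bondEnergy i x ∧ ratio i x ∈ Ioo (0 : ℝ) 1}.indicator
        fun x => ∫ α, ratioWeight α * G (exchange i α x) ∂unitVol := by
    filter_upwards [hμ] with x hx
    exact generator_heatTest_right hc hΛc i G hx
  have i1 : Integrable (fun x => weightMass * G x) μ :=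
    (Integrable.of_bound hG.aestronglyMeasurable B (ae_of_all _ hB)).const_mul _
  have i2 : Integrable (fun x => ∫ α, ratioWeight α * G (exchange i α x) ∂unitVol) μ :=
    Integrable.of_bound
      (measurable_integral_exchange i measurable_ratioWeight hG).aestronglyMeasurable B
      (ae_of_all _ (abs_integral_exchange_le i hB))
  have h := hrev (heatTest Λ i G) (measurable_heatTest hΛ i hG)
    ⟨_, abs_heatTest_le hc hΛc i hB⟩ ((i1.indicator hE).congr e1.symm)
    ((i2.indicator hE').congr e2.symm)
  rwa [integral_congr_ae e1, integral_congr_ae e2, integral_indicator hE,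
    integral_indicator hE'] at h

/-- A reversible law is invariant under resampling the energy ratio of a bond. -/
theorem IsReversible.integral_eq {μ : Measure (Config n)} [IsProbabilityMeasure μ]
    (hμ : ∀ᵐ x ∂μ, ∀ j, 0 ≤ x j) (hΛ : Measurable Λ) (hc : 0 < c) (hΛc : ∀ s, c ≤ Λ s)
    (hrev : IsReversible Λ μ) (i : Fin n) {G : Config n → ℝ} (hG : Measurable G) {B : ℝ}
    (hB : ∀ x, |G x| ≤ B) :
    ∫ x, G x ∂μ = ∫ x, ∫ α, heatDensity α * G (exchange i α x) ∂unitVol ∂μ := by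
  have hW := weightMass_pos
  set E := {x : Config n | 0 < bondEnergy i x} with hEdef
  set E' := {x : Config n | 0 < bondEnergy i x ∧ ratio i x ∈ Ioo (0 : ℝ) 1} with hEdef'
  have hE : MeasurableSet E := measurableSet_lt measurable_const (measurable_bondEnergy i)
  have hE' : MeasurableSet E' := hE.inter (measurable_ratio i measurableSet_Ioo)
  have hsub : E' ⊆ E := fun x hx => hx.1
  -- Testing with a constant shows that the ratios 0 and 1 are almost never attained at positive
  -- bond energy, so the two domains agree up to a null set.
  have hone := hrev.setIntegral_eq hμ hΛ hc hΛc i (G := fun _ => 1) measurable_const (B := 1)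
    (fun _ => by simp)
  simp only [mul_one, setIntegral_const, smul_eq_mul] at hone
  rw [← weightMass] at hone
  have hreal : μ.real E = μ.real E' := mul_right_cancel₀ hW.ne' hone
  have hEE : E' =ᵐ[μ] E := by
    refine ae_eq_of_subset_of_measure_ge hsub ?_ hE'.nullMeasurableSet (measure_ne_top _ _)
    exact ((ENNReal.toReal_eq_toReal_iff' (measure_ne_top _ _) (measure_ne_top _ _)).1 hreal).le
  have h := hrev.setIntegral_eq hμ hΛ hc hΛc i hG hB
  rw [setIntegral_congr_set hEE] at h
  have i1 : Integrable (fun x => weightMass * G x) μ :=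
    (Integrable.of_bound hG.aestronglyMeasurable B (ae_of_all _ hB)).const_mul _
  have i2 : Integrable (fun x => ∫ α, ratioWeight α * G (exchange i α x) ∂unitVol) μ :=
    Integrable.of_bound
      (measurable_integral_exchange i measurable_ratioWeight hG).aestronglyMeasurable B
      (ae_of_all _ (abs_integral_exchange_le i hB))
  have hcompl : ∫ x in Eᶜ, weightMass * G x ∂μ =
      ∫ x in Eᶜ, ∫ α, ratioWeight α * G (exchange i α x) ∂unitVol ∂μ := by
    refine setIntegral_congr_ae hE.compl ?_
    filter_upwards [hμ] with x hx hxE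
    have hs : bondEnergy i x = 0 := le_antisymm (not_lt.1 hxE) (bondEnergy_nonneg i hx)
    simp only [exchange_eq_self _ hx hs]
    rw [integral_mul_const, weightMass]
  have htot : weightMass * ∫ x, G x ∂μ =
      ∫ x, ∫ α, ratioWeight α * G (exchange i α x) ∂unitVol ∂μ := by
    rw [← integral_const_mul, ← integral_add_compl hE i1, ← integral_add_compl hE i2, h, hcompl]
  have hheat : ∀ x, ∫ α, heatDensity α * G (exchange i α x) ∂unitVol =
      weightMass⁻¹ * ∫ α, ratioWeight α * G (exchange i α x) ∂unitVol := by
    intro x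
    rw [← integral_const_mul]
    refine integral_congr_ae (ae_of_all _ fun α => ?_)
    simp only [heatDensity]
    ring
  simp only [hheat]
  rw [integral_const_mul, ← htot, inv_mul_cancel_left₀ hW.ne']

end Reversible

/-! ### Identification of the reversible product laws -/

/-- The second-moment constant of the Beta(3/2, 3/2) law, found without Beta functions. -/
lemma integral_heatDensity_mul_variance :
    ∫ α, heatDensity α * (α * (1 - α)) ∂unitVol = 3 / 16 := by
  have hW := weightMass_pos
  -- This is (α - 1/2)w³, with derivative 4w³ - (3/4)w and value zero at both ends; hence ∫w³ =
  -- (3/16)∫w.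
  let F : ℝ → ℝ := fun α => (α - 1 / 2) * (α * (1 - α) * ratioWeight α)
  have hF : Continuous F := by
    have := continuous_ratioWeight
    fun_prop
  have hd : ∀ α ∈ Ioo (0 : ℝ) 1,
      HasDerivAt F (4 * (ratioWeight α * (α * (1 - α))) - 3 / 4 * ratioWeight α) α := by
    intro α hα
    have hu : 0 < α * (1 - α) := mul_pos hα.1 (by linarith [hα.2])
    have h1 : HasDerivAt (fun a : ℝ => a * (1 - a)) (1 - 2 * α) α := by
      refine ((hasDerivAt_id α).mul ((hasDerivAt_id α).const_sub 1)).congr_deriv ?_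
      simp; ring
    have h2 : HasDerivAt ratioWeight ((1 - 2 * α) / (2 * ratioWeight α)) α := h1.sqrt hu.ne'
    refine (((hasDerivAt_id α).sub_const (1 / 2)).mul (h1.mul h2)).congr_deriv ?_
    have hw : ratioWeight α * ratioWeight α = α * (1 - α) := Real.mul_self_sqrt hu.le
    have hw0 : ratioWeight α ≠ 0 := (ratioWeight_pos hα).ne'
    simp only [id, Pi.mul_apply]
    field_simp
    rw [pow_two, hw]
    ring
  have hcont : Continuous fun α => 4 * (ratioWeight α * (α * (1 - α))) - 3 / 4 * ratioWeight α := by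
    have := continuous_ratioWeight
    fun_prop
  have hint := intervalIntegral.integral_eq_sub_of_hasDerivAt_of_le zero_le_one hF.continuousOn hd
    (hcont.intervalIntegrable 0 1)
  have hF0 : F 1 - F 0 = 0 := by simp [F]
  have hcont' : Continuous fun α => ratioWeight α * (α * (1 - α)) := by
    have := continuous_ratioWeight
    fun_prop
  have hi : Integrable (fun α => ratioWeight α * (α * (1 - α))) unitVol :=
    hcont'.continuousOn.integrableOn_compact isCompact_Icc
  rw [hF0, intervalIntegral.integral_of_le zero_le_one, ← integral_Icc_eq_integral_Ioc,
    integral_sub (hi.const_mul 4) (integrable_ratioWeight.const_mul _), integral_const_mul,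
    integral_const_mul] at hint
  rw [← weightMass] at hint
  have e : ∀ α, heatDensity α * (α * (1 - α)) =
      weightMass⁻¹ * (ratioWeight α * (α * (1 - α))) := fun α => by
    rw [heatDensity]; ring
  simp only [e]
  rw [integral_const_mul, show ∫ α, ratioWeight α * (α * (1 - α)) ∂unitVol = 3 / 16 * weightMass by
    linarith]
  field_simp

/-- The moments of the measure `exp (-p x) ν(dx)`. -/
def laplaceMoment (ν : Measure ℝ) (k : ℕ) (p : ℝ) : ℝ := ∫ x, x ^ k * Real.exp (-p * x) ∂ν

/-! ### Laplace transforms and the differential equation of the Gamma law -/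

section Laplace

variable {ν : Measure ℝ} [IsProbabilityMeasure ν]

lemma mem_interior_integrableExpSet (hν : ∀ᵐ x ∂ν, 0 ≤ x) {p : ℝ} (hp : 0 < p) :
    -p ∈ interior (integrableExpSet (fun x : ℝ => x) ν) := by
  refine interior_maximal (t := Iio 0) (fun t (ht : t < 0) => ?_) isOpen_Iio
    (by simpa using hp)
  refine Integrable.of_bound (C := 1) (by fun_prop) ?_
  filter_upwards [hν] with x hx
  rw [Real.norm_of_nonneg (Real.exp_pos _).le, Real.exp_le_one_iff]
  exact mul_nonpos_of_nonpos_of_nonneg ht.le hx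

lemma integrable_laplaceMoment (hν : ∀ᵐ x ∂ν, 0 ≤ x) {p : ℝ} (hp : 0 < p) (k : ℕ) :
    Integrable (fun x => x ^ k * Real.exp (-p * x)) ν :=
  integrable_pow_mul_exp_of_mem_interior_integrableExpSet (mem_interior_integrableExpSet hν hp) k

lemma hasDerivAt_laplaceMoment (hν : ∀ᵐ x ∂ν, 0 ≤ x) {p : ℝ} (hp : 0 < p) (k : ℕ) :
    HasDerivAt (laplaceMoment ν k) (-laplaceMoment ν (k + 1) p) p := by
  have h := (hasDerivAt_integral_pow_mul_exp_real (mem_interior_integrableExpSet hν hp) k).comp p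
    (hasDerivAt_neg p)
  rw [mul_neg_one] at h
  exact h

lemma laplaceMoment_zero_pos (hν : ∀ᵐ x ∂ν, 0 ≤ x) {p : ℝ} (hp : 0 < p) :
    0 < laplaceMoment ν 0 p := by
  have h := integrable_laplaceMoment hν hp 0
  simp only [laplaceMoment, pow_zero, one_mul] at h ⊢
  exact integral_exp_pos h

lemma laplaceMoment_one_pos (hν : ∀ᵐ x ∂ν, 0 ≤ x) (hne : ν ≠ Measure.dirac 0) {p : ℝ}
    (hp : 0 < p) : 0 < laplaceMoment ν 1 p := by
  have hnn : 0 ≤ᵐ[ν] fun x => x ^ 1 * Real.exp (-p * x) := by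
    filter_upwards [hν] with x hx
    simp only [pow_one, Pi.zero_apply]
    positivity
  refine lt_of_le_of_ne (integral_nonneg_of_ae hnn) fun h => hne ?_
  have h0 := (integral_eq_zero_iff_of_nonneg_ae hnn (integrable_laplaceMoment hν hp 1)).1 h.symm
  have h1 : ∀ᵐ x ∂ν, x = 0 := by
    filter_upwards [h0] with x hx
    simpa [Real.exp_ne_zero] using hx
  have h2 : (fun x : ℝ => x) =ᵐ[ν] fun _ => 0 := h1
  rw [← Measure.map_id' (μ := ν), Measure.map_congr h2, Measure.map_const, measure_univ, one_smul]

lemma tendsto_laplaceMoment_zero (hν : ∀ᵐ x ∂ν, 0 ≤ x) :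
    Filter.Tendsto (laplaceMoment ν 0) (nhdsWithin 0 (Ioi 0)) (nhds 1) := by
  have h : ContinuousWithinAt (laplaceMoment ν 0) (Ioi 0) 0 := by
    refine continuousWithinAt_of_dominated (bound := fun _ => 1)
      (Filter.Eventually.of_forall fun p => by fun_prop) ?_ (integrable_const 1)
      (ae_of_all _ fun x => by fun_prop)
    filter_upwards [self_mem_nhdsWithin] with p (hp : 0 < p)
    filter_upwards [hν] with x hx
    rw [pow_zero, one_mul, Real.norm_of_nonneg (Real.exp_pos _).le, Real.exp_le_one_iff]
    nlinarith
  have h0 : laplaceMoment ν 0 0 = 1 := by simp [laplaceMoment]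
  rw [ContinuousWithinAt, h0] at h
  exact h

lemma eq_const_of_hasDerivAt_zero {f : ℝ → ℝ} (h : ∀ p, 0 < p → HasDerivAt f 0 p) :
    ∃ a, ∀ p, 0 < p → f p = a :=
  isOpen_Ioi.exists_is_const_of_deriv_eq_zero isPreconnected_Ioi
    (fun p hp => (h p hp).differentiableAt.differentiableWithinAt) fun p hp => (h p hp).deriv

/-- The differential equation satisfied by the Laplace transform of the Gamma laws of shape `3/2`
characterizes them. -/
lemma exists_laplaceMoment_eq (hν : ∀ᵐ x ∂ν, 0 ≤ x) (hne : ν ≠ Measure.dirac 0)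
    (hode : ∀ p, 0 < p → laplaceMoment ν 0 p * laplaceMoment ν 2 p =
      5 / 3 * laplaceMoment ν 1 p ^ 2) :
    ∃ b, 0 < b ∧ ∀ p, 0 < p → laplaceMoment ν 0 p = (1 + b * p) ^ (-(3 / 2) : ℝ) := by
  set m := laplaceMoment ν with hm
  have hpos : ∀ p, 0 < p → 0 < m 0 p := fun p hp => laplaceMoment_zero_pos hν hp
  have hd : ∀ k p, 0 < p → HasDerivAt (m k) (-m (k + 1) p) p := fun k p hp =>
    hasDerivAt_laplaceMoment hν hp k
  -- A first integral: writing m for the Laplace transform, the equation says that -m′·m^(-5/3) is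
  -- constant.
  obtain ⟨q, hq⟩ := eq_const_of_hasDerivAt_zero (f := fun p => m 1 p * m 0 p ^ (-(5 / 3) : ℝ))
    fun p hp => by
      refine ((hd 1 p hp).mul ((hd 0 p hp).rpow_const (p := -(5 / 3))
        (Or.inl (hpos p hp).ne'))).congr_deriv ?_
      have e : m 0 p ^ (-(5 / 3) : ℝ) = m 0 p ^ (-(5 / 3) - 1 : ℝ) * m 0 p := by
        rw [← Real.rpow_add_one (hpos p hp).ne']; congr 1; ring
      rw [e]
      have := hode p hp
      rw [zero_add, show (1 + 1 : ℕ) = 2 from rfl]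
      linear_combination -m 0 p ^ (-(5 / 3) - 1 : ℝ) * this
  have hq0 : 0 < q := by
    rw [← hq 1 one_pos]
    exact mul_pos (laplaceMoment_one_pos hν hne one_pos) (Real.rpow_pos_of_pos (hpos 1 one_pos) _)
  -- Second integration: m^(-2/3) has derivative (2/3)q, so it is affine with slope (2/3)q.
  obtain ⟨a, ha⟩ := eq_const_of_hasDerivAt_zero
    (f := fun p => m 0 p ^ (-(2 / 3) : ℝ) - 2 / 3 * q * p) fun p hp => by
      refine (((hd 0 p hp).rpow_const (p := -(2 / 3)) (Or.inl (hpos p hp).ne')).sub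
        ((hasDerivAt_id p).const_mul (2 / 3 * q))).congr_deriv ?_
      have := hq p hp
      rw [show (-(2 / 3) - 1 : ℝ) = -(5 / 3) by norm_num, zero_add, ← this]
      ring
  -- The equation holds only for p > 0; the constant comes from the limit at 0, where the transform
  -- of a probability measure tends to 1.
  have ha1 : a = 1 := by
    have t1 : Filter.Tendsto (fun p => m 0 p ^ (-(2 / 3) : ℝ) - 2 / 3 * q * p)
        (nhdsWithin 0 (Ioi 0)) (nhds (1 ^ (-(2 / 3) : ℝ) - 2 / 3 * q * 0)) := by
      refine ((tendsto_laplaceMoment_zero hν).rpow_const (Or.inl one_ne_zero)).sub ?_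
      exact ((continuous_const.mul continuous_id).tendsto 0).mono_left nhdsWithin_le_nhds
    have t2 : Filter.Tendsto (fun p => m 0 p ^ (-(2 / 3) : ℝ) - 2 / 3 * q * p)
        (nhdsWithin 0 (Ioi 0)) (nhds a) := by
      refine tendsto_const_nhds.congr' ?_
      filter_upwards [self_mem_nhdsWithin] with p hp
      exact (ha p hp).symm
    have := tendsto_nhds_unique t1 t2
    simpa using this.symm
  refine ⟨2 / 3 * q, by positivity, fun p hp => ?_⟩
  have h1 : m 0 p ^ (-(2 / 3) : ℝ) = 1 + 2 / 3 * q * p := by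
    have := ha p hp
    rw [ha1] at this
    linarith
  rw [← h1, ← Real.rpow_mul (hpos p hp).le]
  norm_num

end Laplace

lemma laplaceMoment_siteLaw {b p : ℝ} (hb : 0 < b) (hp : 0 < p) :
    laplaceMoment (siteLaw b) 0 p = (1 + b * p) ^ (-(3 / 2) : ℝ) := by
  have := Fact.mk hb
  have hr : 0 < 1 / (1 / b + p) := by positivity
  have := Fact.mk hr
  have hbp : 0 < 1 + b * p := by positivity
  have h1 : siteLaw (1 / (1 / b + p)) univ = 1 := measure_univ
  rw [siteLaw_tilt hb hp.le, withDensity_apply _ MeasurableSet.univ, setLIntegral_univ] at h1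
  have h2 : ∫ x, (1 + b * p) ^ (3 / 2 : ℝ) * Real.exp (-(p * x)) ∂(siteLaw b) = 1 := by
    rw [integral_eq_lintegral_of_nonneg_ae (ae_of_all _ fun x => by positivity) (by fun_prop), h1,
      ENNReal.toReal_one]
  rw [integral_const_mul] at h2
  rw [laplaceMoment, Real.rpow_neg hbp.le]
  simp only [pow_zero, one_mul, neg_mul]
  exact eq_inv_of_mul_eq_one_right h2

section Pi

variable {n : ℕ} {ν : Fin (n + 1) → Measure ℝ} [∀ i, IsProbabilityMeasure (ν i)]

lemma integral_pi_pair {i j : Fin (n + 1)} (hij : i ≠ j) {a b : ℝ → ℝ} (hma : Measurable a)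
    (hmb : Measurable b) (ha : Integrable a (ν i)) (hb : Integrable b (ν j)) :
    Integrable (fun x : Config n => a (x i) * b (x j)) (Measure.pi ν) ∧
    ∫ x : Config n, a (x i) * b (x j) ∂(Measure.pi ν) = (∫ x, a x ∂(ν i)) * ∫ x, b x ∂(ν j) := by
  have hind : IndepFun (fun x : Config n => x i) (fun x => x j) (Measure.pi ν) :=
    (iIndepFun_pi (μ := ν) (X := fun _ x => x) fun _ => aemeasurable_id).indepFun hij
  have hind' : IndepFun (fun x : Config n => a (x i)) (fun x => b (x j)) (Measure.pi ν) :=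
    hind.comp hma hmb
  have hia : Integrable (fun x : Config n => a (x i)) (Measure.pi ν) := integrable_comp_eval ha
  have hib : Integrable (fun x : Config n => b (x j)) (Measure.pi ν) := integrable_comp_eval hb
  refine ⟨hind'.integrable_smul hia hib, ?_⟩
  rw [hind'.integral_fun_mul_eq_mul_integral hia.aestronglyMeasurable hib.aestronglyMeasurable,
    integral_comp_eval ha.aestronglyMeasurable, integral_comp_eval hb.aestronglyMeasurable]

end Pi

/-! ### From heat bath invariance to the Gamma laws -/

section Characterization

variable {n : ℕ} {ν : Fin (n + 1) → Measure ℝ} [∀ i, IsProbabilityMeasure (ν i)]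

lemma ae_pi_nonneg (hν : ∀ i, ν i (Iio 0) = 0) : ∀ᵐ x ∂(Measure.pi ν), ∀ j, 0 ≤ x j := by
  rw [eventually_countable_forall]
  intro j
  have h : ∀ᵐ y ∂(ν j), 0 ≤ y := by
    rw [ae_iff]; convert hν j using 2; ext y; simp
  exact (measurePreserving_eval ν j).quasiMeasurePreserving.ae h

/-- Λ_s is controlled only on [0, ∞); freezing it on the negative axis gives a continuous function
that is bounded below everywhere. -/
lemma IsReversible.max_zero {Λs : ℝ → ℝ} {μ : Measure (Config n)}
    (hμ : ∀ᵐ x ∂μ, ∀ j, 0 ≤ x j) (hrev : IsReversible Λs μ) :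
    IsReversible (fun s => Λs (max 0 s)) μ := by
  have e : ∀ A : Config n → Config n → ℝ,
      (fun x => generator (fun s => Λs (max 0 s)) (A x) x) =ᵐ[μ] fun x => generator Λs (A x) x := by
    intro A
    filter_upwards [hμ] with x hx
    rw [generator_eq, generator_eq]
    refine Finset.sum_congr rfl fun i _ => ?_
    rw [max_eq_right (bondEnergy_nonneg i hx)]
  intro f hf hB h1 h2
  rw [integral_congr_ae (e fun x y => f y x), integral_congr_ae (e fun x y => f x y)]
  exact hrev f hf hB (h1.congr (e fun x y => f y x)) (h2.congr (e fun x y => f x y))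

/-- Invariance under resampling the energy ratio of bond `i`. -/
def IsHeatInvariant (i : Fin n) (μ : Measure (Config n)) : Prop :=
  ∀ G : Config n → ℝ, Measurable G → (∃ B, ∀ x, |G x| ≤ B) →
    ∫ x, G x ∂μ = ∫ x, ∫ α, heatDensity α * G (exchange i α x) ∂unitVol ∂μ

/-- The resampling density is symmetric under α ↦ 1-α, so after resampling both sites of the bond
have the same law; by invariance they had it before. -/
lemma IsHeatInvariant.marginal_eq {i : Fin n} (h : IsHeatInvariant i (Measure.pi ν)) :
    ν i.castSucc = ν i.succ := by
  ext S hS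
  have hS1 : Measurable (S.indicator fun _ => (1 : ℝ)) := measurable_const.indicator hS
  have hb : ∀ t : ℝ, |S.indicator (fun _ => (1 : ℝ)) t| ≤ 1 := by
    intro t
    by_cases ht : t ∈ S <;> simp [ht]
  have hreal : ∀ j, ∫ x : Config n, S.indicator (fun _ => (1 : ℝ)) (x j) ∂(Measure.pi ν) =
      (ν j).real S := by
    intro j
    rw [integral_comp_eval hS1.aestronglyMeasurable, integral_indicator_const _ hS, smul_eq_mul,
      mul_one]
  have h1 := h (fun x => S.indicator (fun _ => (1 : ℝ)) (x i.castSucc))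
    (hS1.comp (measurable_pi_apply _)) ⟨1, fun x => hb _⟩
  have h2 := h (fun x => S.indicator (fun _ => (1 : ℝ)) (x i.succ))
    (hS1.comp (measurable_pi_apply _)) ⟨1, fun x => hb _⟩
  have hsymm : ∀ x : Config n,
      ∫ α, heatDensity α * S.indicator (fun _ => (1 : ℝ)) (exchange i α x i.succ) ∂unitVol =
      ∫ α, heatDensity α * S.indicator (fun _ => (1 : ℝ)) (exchange i α x i.castSucc) ∂unitVol := by
    intro x
    rw [← integral_unitVol_symm]
    simp only [heatDensity_symm, exchange_succ, exchange_castSucc, sub_sub_cancel]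
  rw [hreal] at h1 h2
  simp only [hsymm] at h2
  rw [← measureReal_eq_measureReal_iff, h1, h2]

/-- Test with xy·exp(-p(x+y)). The exponential depends on the conserved sum alone, and xy becomes
α(1-α)(x+y)², with mean factor 3/16. Hence m₁² = (3/16)(2m₀m₂ + 2m₁²). -/
lemma IsHeatInvariant.laplaceMoment_eq {ρ : Measure ℝ} [IsProbabilityMeasure ρ]
    (hρ : ρ (Iio 0) = 0) {i : Fin n}
    (h : IsHeatInvariant i (Measure.pi fun _ : Fin (n + 1) => ρ)) {p : ℝ} (hp : 0 < p) :
    laplaceMoment ρ 0 p * laplaceMoment ρ 2 p = 5 / 3 * laplaceMoment ρ 1 p ^ 2 := by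
  have hρ0 : ∀ᵐ x ∂ρ, 0 ≤ x := by
    rw [ae_iff]; convert hρ using 2; ext y; simp
  have hnn := ae_pi_nonneg (ν := fun _ : Fin (n + 1) => ρ) fun _ => hρ
  -- Absolute values keep the test function bounded on the whole line; under the law they make no
  -- difference.
  let u : ℝ → ℝ := fun t => |t| * Real.exp (-p * |t|)
  have hu : Measurable u := by fun_prop
  have hub : ∀ t, |u t| ≤ 1 / p := by
    intro t
    rw [abs_of_nonneg (by positivity), le_div_iff₀ hp]
    have h1 := Real.add_one_le_exp (p * |t|)
    have h2 : Real.exp (-p * |t|) * Real.exp (p * |t|) = 1 := by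
      rw [← Real.exp_add]; simp
    have h3 : p * |t| * Real.exp (-p * |t|) ≤ Real.exp (p * |t|) * Real.exp (-p * |t|) :=
      mul_le_mul_of_nonneg_right (by linarith) (Real.exp_pos _).le
    simp only [u]
    linarith
  have hG := h (fun x => u (x i.castSucc) * u (x i.succ))
    ((hu.comp (measurable_pi_apply _)).mul (hu.comp (measurable_pi_apply _)))
    ⟨1 / p * (1 / p), fun x => by
      rw [abs_mul]
      exact mul_le_mul (hub _) (hub _) (abs_nonneg _) (by positivity)⟩
  have hui : Integrable u ρ :=
    Integrable.of_bound hu.aestronglyMeasurable (1 / p) (ae_of_all _ hub)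
  have hu1 : ∫ x, u x ∂ρ = laplaceMoment ρ 1 p := by
    refine integral_congr_ae ?_
    filter_upwards [hρ0] with x hx
    simp only [u, abs_of_nonneg hx, pow_one]
  rw [(integral_pi_pair (ν := fun _ => ρ) (castSucc_ne_succ i) hu hu hui hui).2, hu1] at hG
  let a : ℕ → ℝ → ℝ := fun k t => t ^ k * Real.exp (-p * t)
  have ha : ∀ k, Measurable (a k) := fun k => by fun_prop
  have hai : ∀ k, Integrable (a k) ρ := fun k => integrable_laplaceMoment hρ0 hp k
  have hpair : ∀ k l, _ ∧ _ := fun k l => integral_pi_pair (ν := fun _ : Fin (n + 1) => ρ)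
    (castSucc_ne_succ i) (ha k) (ha l) (hai k) (hai l)
  have hinner : ∀ᵐ x ∂(Measure.pi fun _ : Fin (n + 1) => ρ),
      ∫ α, heatDensity α * (u (exchange i α x i.castSucc) * u (exchange i α x i.succ)) ∂unitVol =
      3 / 16 * (a 2 (x i.castSucc) * a 0 (x i.succ) +
        2 * (a 1 (x i.castSucc) * a 1 (x i.succ)) + a 0 (x i.castSucc) * a 2 (x i.succ)) := by
    filter_upwards [hnn] with x hx
    rw [← integral_heatDensity_mul_variance, ← integral_mul_const]
    refine integral_congr_ae ?_
    filter_upwards [ae_unitVol] with α hα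
    have hb := bondEnergy_nonneg i hx
    rw [exchange_castSucc, exchange_succ]
    simp only [u, a]
    rw [abs_of_nonneg (mul_nonneg hα.1.le hb),
      abs_of_nonneg (mul_nonneg (by linarith [hα.2]) hb)]
    have e1 : Real.exp (-p * (α * bondEnergy i x)) * Real.exp (-p * ((1 - α) * bondEnergy i x)) =
        Real.exp (-p * x i.castSucc) * Real.exp (-p * x i.succ) := by
      rw [← Real.exp_add, ← Real.exp_add, bondEnergy]; congr 1; ring
    calc _ = heatDensity α * (α * (1 - α)) * bondEnergy i x ^ 2 *
          (Real.exp (-p * (α * bondEnergy i x)) * Real.exp (-p * ((1 - α) * bondEnergy i x))) := by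
          ring
      _ = _ := by rw [e1, bondEnergy]; ring
  have hsum : Integrable (fun x : Config n => a 2 (x i.castSucc) * a 0 (x i.succ) +
      2 * (a 1 (x i.castSucc) * a 1 (x i.succ))) (Measure.pi fun _ => ρ) :=
    (hpair 2 0).1.add ((hpair 1 1).1.const_mul 2)
  rw [integral_congr_ae hinner, integral_const_mul, integral_add hsum (hpair 0 2).1,
    integral_add (hpair 2 0).1 ((hpair 1 1).1.const_mul 2), integral_const_mul, (hpair 2 0).2,
    (hpair 1 1).2, (hpair 0 2).2] at hG
  change laplaceMoment ρ 1 p * laplaceMoment ρ 1 p = 3 / 16 * (laplaceMoment ρ 2 p *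
    laplaceMoment ρ 0 p + 2 * (laplaceMoment ρ 1 p * laplaceMoment ρ 1 p) +
    laplaceMoment ρ 0 p * laplaceMoment ρ 2 p) at hG
  linarith

lemma eq_siteLaw_of_laplaceMoment {ρ : Measure ℝ} [IsProbabilityMeasure ρ] (hρ : ρ (Iio 0) = 0)
    {b : ℝ} (hb : 0 < b)
    (h : ∀ p, 0 < p → laplaceMoment ρ 0 p = (1 + b * p) ^ (-(3 / 2) : ℝ)) : ρ = siteLaw b := by
  have := Fact.mk hb
  refine measure_eq_of_laplace hρ ?_ fun k => ?_
  · exact measure_mono_null (t := {y | ¬ 0 < y})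
      (fun y (hy : y < 0) => show ¬ 0 < y from hy.le.not_gt) (ae_iff.1 (ae_siteLaw_pos hb))
  · rcases Nat.eq_zero_or_pos k with rfl | hk
    · simp
    · have hk' : (0 : ℝ) < k := by exact_mod_cast hk
      have h1 := (h k hk').trans (laplaceMoment_siteLaw hb hk').symm
      simpa only [laplaceMoment, pow_zero, one_mul, neg_mul] using h1

/-- The reversible product laws are the products of Gamma laws of a common scale. -/
theorem isReversible_pi_iff {Λs : ℝ → ℝ} (hΛs : ContinuousOn Λs (Ici 0)) {c : ℝ} (hc : 0 < c)
    (hΛc : ∀ s, 0 ≤ s → c ≤ Λs s) (hn : 1 ≤ n) (hν : ∀ i, ν i (Iio 0) = 0)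
    (hne : ∃ i, ν i ≠ Measure.dirac 0) :
    IsReversible Λs (Measure.pi ν) ↔ ∃ ε : ℝ, 0 < ε ∧ ∀ i, ν i = siteLaw ε := by
  constructor
  · intro hrev
    have hnn := ae_pi_nonneg hν
    have hinv : ∀ i, IsHeatInvariant i (Measure.pi ν) := by
      rintro i G hG ⟨B, hB⟩
      have hcont : Continuous fun s => Λs (max 0 s) :=
        hΛs.comp_continuous (by fun_prop) fun s => mem_Ici.2 (le_max_left _ _)
      exact (hrev.max_zero hnn).integral_eq hnn hcont.measurable hc
        (fun s => hΛc _ (le_max_left _ _)) i hG hB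
    have heq : ∀ j, ν j = ν 0 := by
      intro j
      induction j using Fin.induction with
      | zero => rfl
      | succ i ih => rw [← (hinv i).marginal_eq, ih]
    have hpi : Measure.pi ν = Measure.pi fun _ : Fin (n + 1) => ν 0 := by
      congr 1
      exact funext heq
    obtain ⟨j, hj⟩ := hne
    rw [heq j] at hj
    -- All marginals being equal, a single bond suffices, and there is one because n ≥ 1.
    have hinv0 := hinv ⟨0, hn⟩
    rw [hpi] at hinv0
    have hν0 : ∀ᵐ x ∂(ν 0), 0 ≤ x := by
      rw [ae_iff]; convert hν 0 using 2; ext y; simp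
    obtain ⟨b, hb, hφ⟩ := exists_laplaceMoment_eq hν0 hj
      fun p hp => hinv0.laplaceMoment_eq (hν 0) hp
    exact ⟨b, hb, fun i => (heq i).trans (eq_siteLaw_of_laplaceMoment (hν 0) hb hφ)⟩
  · rintro ⟨ε, hε, h⟩
    have hpi : Measure.pi ν = gibbs n ε := by
      rw [gibbs]
      congr 1
      exact funext h
    rw [hpi]
    exact isReversible_gibbs hΛs (fun s hs => hc.le.trans (hΛc s hs)) hε

end Characterization

end BilliardLattice

end

theorem mainTheorem5 (Λs : ℝ → ℝ) (hΛs : ContinuousOn Λs (Set.Ici 0))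
    (hΛs_pos : ∃ c : ℝ, 0 < c ∧ ∀ s : ℝ, 0 ≤ s → c ≤ Λs s) :
    -- the constant depends on `Λs` only, neither on the number of sites nor on the energy
    ∃ C : ℝ, 0 < C ∧ ∀ n : ℕ, 1 ≤ n →
      -- the reversible product measures
      (∀ ν : Fin (n + 1) → MeasureTheory.Measure ℝ,
        (∀ i, MeasureTheory.IsProbabilityMeasure (ν i)) → (∀ i, ν i (Set.Iio 0) = 0) →
        (∃ i, ν i ≠ MeasureTheory.Measure.dirac 0) →
        (BilliardLattice.IsReversible Λs (MeasureTheory.Measure.pi ν) ↔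
          ∃ ε : ℝ, 0 < ε ∧ ∀ i, ν i = BilliardLattice.siteLaw ε)) ∧
      -- the stationary distributions on the simplices, and the spectrum
      ∃ κ : ProbabilityTheory.Kernel ℝ (BilliardLattice.Config n),
        (∀ ε : ℝ, 0 < ε → BilliardLattice.IsConditioning
          (MeasureTheory.Measure.pi fun _ : Fin (n + 1) => BilliardLattice.siteLaw ε) κ) ∧
        ∀ ε : ℝ, 0 < ε →
          (∀ π : MeasureTheory.Measure (BilliardLattice.Config n),
            BilliardLattice.IsStationaryOn Λs ε π ↔ π = κ ε) ∧
          ∃ T : MeasureTheory.Lp ℂ 2 (κ ε) →L[ℂ] MeasureTheory.Lp ℂ 2 (κ ε),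
            BilliardLattice.IsGeneratorOnL2 Λs (κ ε) T ∧
            spectrum ℂ T ⊆ Complex.ofReal ''
              (Set.Iic (-(C * Real.sin (Real.pi / (((n : ℝ) + 1) + 2)) ^ 2)) ∪ {0}) := by
  obtain ⟨c, hc, hΛc⟩ := hΛs_pos
  -- The factors: the lower bound of Λ_s, the minorization constant with the mass of w, and 1/2 from
  -- comparing 1 - cos(π/(n+1)) with the squared sine. None depends on n or ε.
  refine ⟨c * (√(2 * Real.pi) / 4 * BilliardLattice.weightMass) * (1 / 2), ?_, fun n hn => ⟨?_,
    BilliardLattice.condLaw n, fun ε hε => BilliardLattice.isConditioning_condLaw hε,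
    fun ε hε => ⟨fun π => BilliardLattice.isStationaryOn_iff hΛs hc hΛc hn hε π,
      BilliardLattice.exists_generator_spectrum hΛs hc hΛc hn hε⟩⟩⟩
  · have := BilliardLattice.weightMass_pos
    positivity
  · intro ν hprob hν hne
    exact BilliardLattice.isReversible_pi_iff hΛs hc hΛc hn hν hne
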